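/- Let $\mathbb{T}=\mathbb{R}/2\mathbb{Z}$ (of total length $2$), let $\dot W$ be a space-time white noise on $\mathbb{R}_+\times\mathbb{T}$ defined on some probability space, and, for a Lipschitz function $\sigma:\mathbb{R}\to\mathbb{R}$ with $\sigma(0)=0$ and a non-random continuous function $u_0:\mathbb{T}\to[0,\infty)$, let $u$ be the continuous random-field solution of $$\partial_t u=\partial_x^2u+\sigma(u)\dot W\ \text{ on }(0,\infty)\times\mathbb{T},\qquad u(0)=u_0,$$ that is, $u$ is predictable (with respect to a filtration relative to which $\dot W$ is a white noise), almost surely continuous on $[0,\infty)\times\mathbb{T}$, satisfies $\sup_{t\le T}\sup_{x\in\mathbb{T}}\mathrm{E}(|u(t,x)|^2)<\infty$ for every $T>0$, and for all $t>0$, $x\in\mathbb{T}$, almost surely $$u(t,x)=\int_{\mathbb{T}}p_t(x-y)u_0(y)\,dy+\int_{(0,t)\times\mathbb{T}}p_{t-s}(x-y)\,\sigma(u(s,y))\,W(ds\,dy),$$ where the last integral is a Walsh stochastic integral and $p_t(x)=(4\pi t)^{-1/2}\sum_{n\in\mathbb{Z}}\exp(-(x+2n)^2/(4t))$ is the heat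 kernel on $\mathbb{T}$. For every $\varpi>0$ and $\frac43<\gamma<2$ there exists $L=L(\gamma,\varpi)>1$ such that $$\mathrm{P}\left\{\inf_{0\le t\le N^{-\gamma}}\|u(t)\|_{L^1(\mathbb{T})}\le\frac12\ \text{ or }\ \sup_{0\le t\le N^{-\gamma}}\|u(t)\|_{L^1(\mathbb{T})}\ge 2\right\}\le L\exp\left(-\frac{N^{(3\gamma-4)/3}}{L}\right),$$ uniformly for all real $N\ge2$, all Lipschitz continuous $\sigma:\mathbb{R}\to\mathbb{R}$ with $\sigma(0)=0$ and $\mathrm{Lip}(\sigma)\le\varpi$, and all continuous $u_0:\mathbb{T}\to[0,\infty)$ with $\|u_0\|_{L^1(\mathbb{T})}=1$ and $\|u_0\|_{L^\infty(\mathbb{T})}\le N$. -/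

import Mathlib

open MeasureTheory ProbabilityTheory Filter Topology
open scoped NNReal ENNReal

noncomputable section

namespace SHE

instance fact_two_pos : Fact ((0 : ℝ) < 2) := ⟨two_pos⟩

/-- The one-dimensional torus `ℝ / 2ℤ`. Its measure `volume` is the Haar measure of total
mass `2`, i.e. Lebesgue measure on `[-1, 1]`. -/
abbrev Torus : Type := AddCircle (2 : ℝ)

/-- Lebesgue measure on the time axis `ℝ₊ = [0, ∞)`. -/
def timeMeasure : Measure ℝ≥0 := ((volume : Measure ℝ).restrict (Set.Ici 0)).map Real.toNNReal

instance sFinite_timeMeasure : SFinite timeMeasure := by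
  unfold timeMeasure
  infer_instance

/-- Lebesgue measure `ds dy` on space-time `ℝ₊ × 𝕋`. -/
def spaceTimeMeasure : Measure (ℝ≥0 × Torus) := timeMeasure.prod volume

/-! ### The heat semigroup on the torus -/

/-- The periodized Gaussian `(4πt)^{-1/2} ∑_{n ∈ ℤ} exp(-(x + 2n)² / (4t))`, for real `x`. -/
def heatKernelReal (t x : ℝ) : ℝ :=
  (1 / √(4 * Real.pi * t)) * ∑' n : ℤ, Real.exp (-((x + 2 * n) ^ 2) / (4 * t))

theorem heatKernelReal_periodic (t : ℝ) : Function.Periodic (heatKernelReal t) 2 := by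
  intro x
  unfold heatKernelReal
  congr 1
  rw [← (Equiv.addRight (1 : ℤ)).tsum_eq
    (fun n : ℤ => Real.exp (-((x + 2 * n) ^ 2) / (4 * t)))]
  refine tsum_congr fun n => ?_
  simp only [Equiv.coe_addRight, Int.cast_add, Int.cast_one]
  congr 3
  ring

/-- The heat kernel `p_t` of `∂_t - ∂_x²` on the torus; `p_t(x, y) = p_t(x - y)`. -/
def heatKernel (t : ℝ) : Torus → ℝ := (heatKernelReal_periodic t).lift

/-- The heat semigroup `(P_t f)(x) = ∫ p_t(x - y) f(y) dy`. -/
def heatSemigroup (t : ℝ) (f : Torus → ℝ) (x : Torus) : ℝ :=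
  ∫ y, heatKernel t (x - y) * f y

/-! ### Space-time white noise and the Walsh integral -/

variable {Ω : Type*} {mΩ : MeasurableSpace Ω}

/-- `W` is a space-time white noise on `ℝ₊ × 𝕋` relative to the filtration `𝓕`: the family
`W(A)`, for `A` measurable of finite measure, is a centered Gaussian process with
`Cov(W(A), W(B)) = |A ∩ B|`; the noise on `[0, t] × 𝕋` is `𝓕 t`-measurable, and the noise on
`(t, ∞) × 𝕋` is independent of `𝓕 t`. (The values of `W` on other sets play no role.) -/
structure IsWhiteNoise (𝓕 : Filtration ℝ≥0 mΩ) (P : Measure Ω)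
    (W : Set (ℝ≥0 × Torus) → Ω → ℝ) : Prop where
  measurable : ∀ A, MeasurableSet A → spaceTimeMeasure A ≠ ∞ → Measurable (W A)
  gaussian : IsGaussianProcess
    (fun A : {A : Set (ℝ≥0 × Torus) // MeasurableSet A ∧ spaceTimeMeasure A ≠ ∞} => W A.1) P
  mean_zero : ∀ A, MeasurableSet A → spaceTimeMeasure A ≠ ∞ → ∫ ω, W A ω ∂P = 0
  covariance : ∀ A B, MeasurableSet A → spaceTimeMeasure A ≠ ∞ →
    MeasurableSet B → spaceTimeMeasure B ≠ ∞ →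
    ∫ ω, W A ω * W B ω ∂P = (spaceTimeMeasure (A ∩ B)).toReal
  adapted : ∀ (t : ℝ≥0) (A : Set (ℝ≥0 × Torus)), MeasurableSet A →
    A ⊆ Set.Iic t ×ˢ Set.univ → Measurable[𝓕 t] (W A)
  indep : ∀ t : ℝ≥0, Indep (𝓕 t)
    (⨆ A ∈ {A : Set (ℝ≥0 × Torus) |
        MeasurableSet A ∧ spaceTimeMeasure A ≠ ∞ ∧ A ⊆ Set.Ioi t ×ˢ Set.univ},
      MeasurableSpace.comap (W A) inferInstance) P

/-- An elementary random field `X(ω) 1_{(a, b]}(s) 1_A(y)`, where `X` is bounded and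
`𝓕 a`-measurable. -/
structure ElementaryField (𝓕 : Filtration ℝ≥0 mΩ) where
  a : ℝ≥0
  b : ℝ≥0
  A : Set Torus
  X : Ω → ℝ
  measurableSet_A : MeasurableSet A
  measurable_X : Measurable[𝓕 a] X
  bounded_X : ∃ C : ℝ, ∀ ω, |X ω| ≤ C

namespace ElementaryField

variable {𝓕 : Filtration ℝ≥0 mΩ}

/-- The field as a function of time, space and chance. -/
def toFun (e : ElementaryField 𝓕) (s : ℝ≥0) (y : Torus) (ω : Ω) : ℝ :=
  (Set.Ioc e.a e.b ×ˢ e.A).indicator (fun _ => e.X ω) (s, y)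

/-- The stochastic integral `X · W((a, b] × A)` of an elementary field. -/
def integral (W : Set (ℝ≥0 × Torus) → Ω → ℝ) (e : ElementaryField 𝓕) (ω : Ω) : ℝ :=
  e.X ω * W (Set.Ioc e.a e.b ×ˢ e.A) ω

end ElementaryField

/-- A random field `Φ(s, y)(ω)` is predictable: it is measurable for the product of the
predictable σ-algebra on `ℝ₊ × Ω` and the Borel σ-algebra of the torus. -/
def IsPredictableField (𝓕 : Filtration ℝ≥0 mΩ) (Φ : ℝ≥0 → Torus → Ω → ℝ) : Prop :=
  Measurable[𝓕.predictable.prod inferInstance]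
    (fun p : (ℝ≥0 × Ω) × Torus => Φ p.1.1 p.2 p.1.2)

/-- `X` is (a version of) the Walsh stochastic integral `∫_{ℝ₊ × 𝕋} Φ dW` of the predictable
random field `Φ`: there are finite sums `Φ_n` of elementary fields with
`E ∫∫ |Φ_n - Φ|² ds dy → 0` whose integrals converge to `X` in `L²(P)`. -/
def IsWalshIntegral (𝓕 : Filtration ℝ≥0 mΩ) (P : Measure Ω)
    (W : Set (ℝ≥0 × Torus) → Ω → ℝ) (Φ : ℝ≥0 → Torus → Ω → ℝ) (X : Ω → ℝ) : Prop :=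
  IsPredictableField 𝓕 Φ ∧ MemLp X 2 P ∧
  ∃ Φn : ℕ → List (ElementaryField 𝓕),
    Tendsto (fun n => eLpNorm
        (fun p : (ℝ≥0 × Ω) × Torus =>
          ((Φn n).map fun e => e.toFun p.1.1 p.2 p.1.2).sum - Φ p.1.1 p.2 p.1.2)
        2 ((timeMeasure.prod P).prod (volume : Measure Torus)))
      atTop (𝓝 0) ∧
    Tendsto (fun n => eLpNorm
        (fun ω => ((Φn n).map fun e => e.integral W ω).sum - X ω) 2 P)
      atTop (𝓝 0)

/-! ### The stochastic heat equation -/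

/-- `u` is the continuous random-field (mild) solution of
`∂_t u = ∂_x² u + σ(u) Ẇ` on `(0, ∞) × 𝕋` with `u(0) = u₀`: it is predictable, bounded in
`L²(P)` on bounded time intervals, almost surely jointly continuous on `[0, ∞) × 𝕋`, and for
all `t > 0` and `x`, almost surely
`u(t, x) = (P_t u₀)(x) + ∫_{(0, t) × 𝕋} p_{t - s}(x - y) σ(u(s, y)) W(ds dy)`. -/
structure IsMildSolution (𝓕 : Filtration ℝ≥0 mΩ) (P : Measure Ω)
    (W : Set (ℝ≥0 × Torus) → Ω → ℝ) (σ : ℝ → ℝ) (u₀ : Torus → ℝ)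
    (u : ℝ≥0 → Torus → Ω → ℝ) : Prop where
  predictable : IsPredictableField 𝓕 u
  moment : ∀ T : ℝ≥0, ∃ C : ℝ≥0, ∀ t ≤ T, ∀ x, eLpNorm (u t x) 2 P ≤ C
  continuous : ∀ᵐ ω ∂P, Continuous (fun p : ℝ≥0 × Torus => u p.1 p.2 ω)
  initial : ∀ᵐ ω ∂P, ∀ x, u 0 x ω = u₀ x
  mild : ∀ t : ℝ≥0, 0 < t → ∀ x : Torus,
    IsWalshIntegral 𝓕 P W
      (fun s y ω => (Set.Ioo 0 t).indicator
        (fun r : ℝ≥0 => heatKernel ((t : ℝ) - r) (x - y) * σ (u r y ω)) s)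
      (fun ω => u t x ω - heatSemigroup t u₀ x)

/-- The total mass `‖f‖_{L¹(𝕋)} ∈ [0, ∞]`. -/
def totalMass (f : Torus → ℝ) : ℝ≥0∞ := eLpNorm f 1 volume

end SHE

end

noncomputable section

namespace SHE

section

/-! ### Integral inequalities -/

/-! Write `u(t) = P_t u₀ + Z_t`, where `Z` is the stochastic convolution (`noisePart`). Since `u₀ ≥
0` has mass 1, so does `P_t u₀`. Hence `‖u(t)‖₁` differs from 1 by at most `‖Z_t‖₁`, and positivity
of `u` plays no role. With `T = N^{-γ}` it is enough to show that `sup_{t ≤ T} ‖Z_t‖₁ ≤ 2/5` outside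
an event of probability at most `2 · 4^{-n}`, for any integer `n ≥ 32` such that `n ϖ² √T` is below
an absolute constant. The largest admissible `n` is of order `N^{γ/2}`, and `γ/2` exceeds `(3γ-4)/3`
in the given range of `γ`.

Moments. For an elementary integrand, conditioning on the past turns each increment of the integral
into a centered Gaussian. This gives a Burkholder inequality for squared `L^{2n}` norms with a
constant linear in `n` (`mom_sum_integral_le`). It passes to Walsh integrals by density, in a form
localized to an event (`IsWalshIntegral.mom_indicator_le`).

Self-reproducing profile. The heat kernel and its time increments are dominated by the rational
kernel `g_t(x) = √t / (t + |x|²)`. The convolution of `g_a²` with `g_b²` is at most a multiple of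
`(a^{-1/2} + b^{-1/2}) g_{a+b}²`. By Minkowski the same holds with `g_b * u₀` in place of `g_b`, so
in the Duhamel formula the square of the profile `g_t * u₀` comes back with a factor of order `n ϖ²
√T`. When that factor is at most 1/2, iteration yields `‖u(t,x)‖²_{L^{2n}(P)} ≤ 1296 (g_t * u₀)(x)²`
(`mom_solution_le`). Finiteness of high moments is not known in advance. The iteration is therefore
run on the predictable set where `u` has stayed below `K`, which is where locality of the Walsh
integral is needed; locality itself comes from an exponential supermartingale bound
(`lintegral_exp_sum_integral_le`).

Chaining. The `L^{2n}` norm of `Z_t(x) - Z_s(x)` is bounded linearly in the profile, whose integral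
in `x` is at most 4. Integrating in `x` gives `E ‖Z_t - Z_s‖₁^{2n} ≤ (C n ϖ² (t-s)^{1/4}
T^{1/4})^n`. Markov's inequality, a union bound over dyadic increments (`measure_badEvent_le`) and
path continuity (`totalMass_mem_of_notMem_badEvent`) finish the argument. -/

/-- Minkowski's integral inequality. -/
theorem lintegral_minkowski {α β : Type*} [MeasurableSpace α] [MeasurableSpace β]
    {μ : Measure α} [IsFiniteMeasure μ] {ν : Measure β} [SFinite ν] {f : α → β → ℝ≥0∞}
    (hf : Measurable (Function.uncurry f)) {p : ℝ} (hp : 1 ≤ p) :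
    (∫⁻ b, (∫⁻ a, f a b ∂μ) ^ p ∂ν) ^ (1 / p) ≤
      ∫⁻ a, (∫⁻ b, f a b ^ p ∂ν) ^ (1 / p) ∂μ := by
  have hp0 : 0 < p := by linarith
  have hfb : ∀ b, Measurable fun a => f a b := fun b =>
    hf.comp (measurable_id.prodMk measurable_const)
  set B : α → ℝ≥0∞ := fun a => (∫⁻ b, f a b ^ p ∂ν) ^ (1 / p) with hB
  have hBm : Measurable B :=
    (Measurable.lintegral_prod_right' (f := fun q : α × β => f q.1 q.2 ^ p)
      (hf.pow_const p)).pow_const _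
  rcases eq_or_lt_of_le hp with rfl | hp1
  · simp only [ENNReal.rpow_one, div_one, hB]
    rw [lintegral_lintegral_swap]
    exact (hf.comp measurable_swap).aemeasurable
  rcases eq_or_ne (∫⁻ a, B a ∂μ) ∞ with hM | hM
  · rw [hM]; exact le_top
  have hBtop : ∀ᵐ a ∂μ, B a < ∞ := ae_lt_top hBm hM
  refine ENNReal.le_of_forall_pos_le_add fun δ hδ _ => ?_
  obtain ⟨ε, hε, hεδ⟩ : ∃ ε : ℝ≥0∞, 0 < ε ∧ ε * μ Set.univ ≤ δ ∧ ε ≠ ∞ := by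
    refine ⟨δ / (μ Set.univ + 1), ?_, ?_, ?_⟩
    · exact ENNReal.div_pos (by simpa using hδ.ne') (by simp)
    · rw [mul_comm, ← mul_div_assoc]
      refine ENNReal.div_le_of_le_mul ?_
      rw [mul_comm]; gcongr; exact le_self_add
    · exact ENNReal.div_ne_top ENNReal.coe_ne_top (by simp)
  -- The shift by `ε` makes the weight positive, so that its negative powers are usable, and
  -- finiteness of `μ` keeps the total cost below `δ`. Hölder is applied to `f = (f Bε^{-1/q}) ·
  -- Bε^{1/q}`. After exchanging the integrals, the inner one is at most `Bε ^ p * Bε ^ (1 - p) =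
  -- Bε`.
  set Bε : α → ℝ≥0∞ := fun a => B a + ε with hBε
  have hBεm : Measurable Bε := hBm.add_const _
  set q := p / (p - 1) with hq
  have hpq : p.HolderConjugate q := Real.HolderConjugate.conjExponent hp1
  have hMε : ∫⁻ a, Bε a ∂μ ≤ ∫⁻ a, B a ∂μ + δ := by
    simp only [hBε]
    rw [lintegral_add_left hBm, lintegral_const]
    gcongr; exact hεδ.1
  refine le_trans ?_ hMε
  have hpos : ∀ a, Bε a ≠ 0 := fun a => by simp [hBε, hε.ne']
  have hfin : ∀ᵐ a ∂μ, Bε a ≠ ∞ := by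
    filter_upwards [hBtop] with a ha
    simp [hBε, ha.ne, hεδ.2]
  have hq0 : 0 < q := hpq.symm.pos
  have key : ∀ b, (∫⁻ a, f a b ∂μ) ^ p ≤
      (∫⁻ a, f a b ^ p * Bε a ^ (1 - p) ∂μ) * (∫⁻ a, Bε a ∂μ) ^ (p - 1) := by
    intro b
    have h1 : ∫⁻ a, f a b ∂μ ≤
        ∫⁻ a, ((fun a => f a b * Bε a ^ (-(1 / q))) * fun a => Bε a ^ (1 / q)) a ∂μ := by
      refine lintegral_mono_ae ?_
      filter_upwards [hfin] with a ha
      simp only [Pi.mul_apply]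
      rw [mul_assoc, ← ENNReal.rpow_add _ _ (hpos a) ha]
      simp
    have h2 := h1.trans (ENNReal.lintegral_mul_le_Lp_mul_Lq μ hpq
      (((hfb b).mul (hBεm.pow_const _)).aemeasurable) (hBεm.pow_const _).aemeasurable)
    calc (∫⁻ a, f a b ∂μ) ^ p ≤ _ := ENNReal.rpow_le_rpow h2 hp0.le
      _ = _ := by
        rw [ENNReal.mul_rpow_of_nonneg _ _ hp0.le, ← ENNReal.rpow_mul, ← ENNReal.rpow_mul]
        congr 1
        · rw [one_div_mul_cancel hp0.ne', ENNReal.rpow_one]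
          refine lintegral_congr fun a => ?_
          rw [ENNReal.mul_rpow_of_nonneg _ _ hp0.le, ← ENNReal.rpow_mul]
          congr 2
          rw [hq]; field_simp; ring
        · have : 1 / q * p = p - 1 := by
            rw [hq]; field_simp
          rw [this]
          congr 1
          refine lintegral_congr fun a => ?_
          rw [← ENNReal.rpow_mul, one_div_mul_cancel hq0.ne', ENNReal.rpow_one]
  have hint : ∫⁻ b, (∫⁻ a, f a b ∂μ) ^ p ∂ν ≤ (∫⁻ a, Bε a ∂μ) ^ p := by
    have hmeas : Measurable fun x : β × α => f x.2 x.1 ^ p * Bε x.2 ^ (1 - p) :=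
      ((hf.comp measurable_swap).pow_const p).mul ((hBεm.comp measurable_snd).pow_const _)
    calc ∫⁻ b, (∫⁻ a, f a b ∂μ) ^ p ∂ν
        ≤ ∫⁻ b, (∫⁻ a, f a b ^ p * Bε a ^ (1 - p) ∂μ) * (∫⁻ a, Bε a ∂μ) ^ (p - 1) ∂ν :=
          lintegral_mono key
      _ = (∫⁻ b, ∫⁻ a, f a b ^ p * Bε a ^ (1 - p) ∂μ ∂ν) * (∫⁻ a, Bε a ∂μ) ^ (p - 1) :=
          lintegral_mul_const _ hmeas.lintegral_prod_right
      _ = (∫⁻ a, ∫⁻ b, f a b ^ p * Bε a ^ (1 - p) ∂ν ∂μ) * (∫⁻ a, Bε a ∂μ) ^ (p - 1) := by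
          rw [lintegral_lintegral_swap hmeas.aemeasurable]
      _ ≤ (∫⁻ a, Bε a ∂μ) * (∫⁻ a, Bε a ∂μ) ^ (p - 1) := by
          gcongr ?_ * _
          refine lintegral_mono_ae ?_
          filter_upwards [hfin] with a ha
          have hfa : Measurable fun b => f a b := hf.comp measurable_prodMk_left
          rw [lintegral_mul_const _ (hfa.pow_const p)]
          have : ∫⁻ b, f a b ^ p ∂ν = B a ^ p := by
            rw [hB, ← ENNReal.rpow_mul, one_div_mul_cancel hp0.ne', ENNReal.rpow_one]
          rw [this]
          calc B a ^ p * Bε a ^ (1 - p) ≤ Bε a ^ p * Bε a ^ (1 - p) := by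
                gcongr; exact le_self_add
            _ = Bε a := by
                rw [← ENNReal.rpow_add _ _ (hpos a) ha]; simp
      _ = (∫⁻ a, Bε a ∂μ) ^ p := by
          nth_rewrite 1 [← ENNReal.rpow_one (∫⁻ a, Bε a ∂μ)]
          rw [← ENNReal.rpow_add_of_nonneg _ _ zero_le_one (by linarith)]
          ring_nf
  calc (∫⁻ b, (∫⁻ a, f a b ∂μ) ^ p ∂ν) ^ (1 / p) ≤ ((∫⁻ a, Bε a ∂μ) ^ p) ^ (1 / p) := by
        gcongr
    _ = _ := by rw [← ENNReal.rpow_mul, mul_one_div_cancel hp0.ne', ENNReal.rpow_one]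

/-! ### Moments of Gaussian variables -/

/-- Consecutive factors are paired: `(2n-2l)(2n-2l-1) ≤ 2(n-l) · 2n`. This is what converts
binomials of order `2n` into binomials of order `n`. -/
theorem descFactorial_two_mul_le (n l : ℕ) :
    (2 * n).descFactorial (2 * l) ≤ n.descFactorial l * (4 * n) ^ l := by
  induction l with
  | zero => simp
  | succ l ih =>
    rw [show 2 * (l + 1) = 2 * l + 1 + 1 by ring, Nat.descFactorial_succ, Nat.descFactorial_succ,
      Nat.descFactorial_succ, pow_succ]
    calc (2 * n - (2 * l + 1)) * ((2 * n - 2 * l) * (2 * n).descFactorial (2 * l))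
        ≤ (2 * n) * ((2 * (n - l)) * (n.descFactorial l * (4 * n) ^ l)) := by
          gcongr <;> omega
      _ = (n - l) * n.descFactorial l * ((4 * n) ^ l * (4 * n)) := by ring

theorem integrable_pow_gaussianReal (v : ℝ≥0) (k : ℕ) :
    Integrable (fun z : ℝ => z ^ k) (gaussianReal 0 v) := by
  have h := (memLp_id_gaussianReal (μ := 0) (v := v) k).integrable_norm_pow'
  refine (integrable_norm_iff (by fun_prop)).1 ?_
  simpa [norm_pow] using h

theorem integral_odd_pow_gaussianReal (v : ℝ≥0) (k : ℕ) :
    ∫ z, z ^ (2 * k + 1) ∂gaussianReal 0 v = 0 := by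
  have h : ∫ z, z ^ (2 * k + 1) ∂(gaussianReal 0 v).map (fun x => -x) =
      ∫ z, (-z) ^ (2 * k + 1) ∂gaussianReal 0 v :=
    integral_map (by fun_prop) (by fun_prop)
  rw [gaussianReal_map_neg, neg_zero] at h
  simp_rw [Odd.neg_pow (⟨k, rfl⟩ : Odd (2 * k + 1))] at h
  rw [integral_neg] at h
  linarith

/-- One term of the cosh series is compared with `E cosh(λZ) = exp(vλ²/2)`. The choice `λ² = 2l/v`
minimises `exp(vλ²/2) / λ^{2l}` and makes the exponent equal to `l`; then `e ≤ 3`. Keeping `l ^ l`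
on the left avoids Stirling's formula. -/
theorem integral_even_pow_gaussianReal_le (v : ℝ≥0) (l : ℕ) :
    (l : ℝ) ^ l * ∫ z, z ^ (2 * l) ∂gaussianReal 0 v ≤ (2 * l).factorial * (3 / 2 * v) ^ l := by
  rcases Nat.eq_zero_or_pos l with rfl | hl
  · simp
  rcases eq_or_ne v 0 with rfl | hv
  · simp [hl.ne']
  have hv0 : (0 : ℝ) < v := by positivity
  have hl0 : (0 : ℝ) < l := by positivity
  set lam : ℝ := √(2 * l / v) with hlam
  have hlam2 : lam ^ 2 = 2 * l / v := Real.sq_sqrt (by positivity)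
  have hmgf : ∀ t : ℝ, ∫ z, Real.exp (t * z) ∂gaussianReal 0 v = Real.exp (v * t ^ 2 / 2) := by
    intro t
    have := congrFun (mgf_fun_id_gaussianReal (μ := 0) (v := v)) t
    simpa [mgf] using this
  have hint : ∀ t : ℝ, Integrable (fun z => Real.exp (t * z)) (gaussianReal 0 v) :=
    fun t => integrable_exp_mul_gaussianReal t
  have hcosh : ∫ z, Real.cosh (lam * z) ∂gaussianReal 0 v = Real.exp l := by
    have : ∀ z, Real.cosh (lam * z) = (Real.exp (lam * z) + Real.exp (-lam * z)) / 2 := by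
      intro z; rw [Real.cosh_eq]; ring_nf
    simp_rw [this]
    rw [integral_div, integral_add (hint _) (hint _), hmgf, hmgf, neg_sq, hlam2]
    have : (v : ℝ) * (2 * l / v) / 2 = l := by field_simp
    rw [this]; ring
  have hci : Integrable (fun z => Real.cosh (lam * z)) (gaussianReal 0 v) := by
    have : (fun z => Real.cosh (lam * z)) =
        fun z => (Real.exp (lam * z) + Real.exp (-lam * z)) / 2 := by
      ext z; rw [Real.cosh_eq]; ring_nf
    rw [this]
    exact ((hint _).add (hint _)).div_const 2
  have hpt : ∀ z : ℝ, (lam * z) ^ (2 * l) / (2 * l).factorial ≤ Real.cosh (lam * z) := by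
    intro z
    refine le_hasSum (Real.hasSum_cosh (lam * z)) l fun j _ => ?_
    have : 0 ≤ (lam * z) ^ (2 * j) := by rw [pow_mul]; positivity
    positivity
  have h1 : ∫ z, (lam * z) ^ (2 * l) / (2 * l).factorial ∂gaussianReal 0 v ≤ Real.exp l := by
    rw [← hcosh]
    refine integral_mono (f := fun z => (lam * z) ^ (2 * l) / (2 * l).factorial) ?_ hci hpt
    simp_rw [mul_pow]
    exact ((integrable_pow_gaussianReal v _).const_mul _).div_const _
  simp_rw [mul_pow] at h1
  rw [integral_div, integral_const_mul, pow_mul lam, hlam2, div_le_iff₀ (by positivity)] at h1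
  have hexp : Real.exp l ≤ 3 ^ l := by
    rw [← Real.exp_one_pow]
    gcongr
    exact (Real.exp_one_lt_d9.trans (by norm_num)).le
  have h2 : (2 * l / v : ℝ) ^ l * ∫ z, z ^ (2 * l) ∂gaussianReal 0 v ≤
      3 ^ l * (2 * l).factorial := h1.trans (by gcongr)
  have h3 : (l : ℝ) ^ l = (2 * l / v : ℝ) ^ l * (v / 2) ^ l := by
    rw [← mul_pow]; congr 1; field_simp
  rw [h3]
  calc (2 * l / v : ℝ) ^ l * (v / 2) ^ l * ∫ z, z ^ (2 * l) ∂gaussianReal 0 v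
      = (v / 2 : ℝ) ^ l * ((2 * l / v : ℝ) ^ l * ∫ z, z ^ (2 * l) ∂gaussianReal 0 v) := by ring
    _ ≤ (v / 2 : ℝ) ^ l * (3 ^ l * (2 * l).factorial) := by gcongr
    _ = _ := by
      rw [← mul_assoc, ← mul_pow, mul_comm]; congr 2; ring

/-- The factor `6nv` is `4n` from the descending factorials times `3v/2` from the moment, while `l!
≤ l^l` absorbs the power on the left of the moment bound. The right side is a term of a binomial
expansion of order `n`. -/
theorem choose_mul_integral_pow_le (v : ℝ≥0) {n l : ℕ} (hl : l ≤ n) :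
    ((2 * n).choose (2 * l) : ℝ) * ∫ z, z ^ (2 * l) ∂gaussianReal 0 v ≤
      n.choose l * (6 * n * v) ^ l := by
  rcases Nat.eq_zero_or_pos l with rfl | hl0
  · simp
  have h1 := integral_even_pow_gaussianReal_le v l
  have hl1 : (0 : ℝ) < (l : ℝ) ^ l := by positivity
  have h2 : (((2 * n).choose (2 * l) * (2 * l).factorial : ℕ) : ℝ) ≤
      ((n.choose l * l ^ l * (4 * n) ^ l : ℕ) : ℝ) := by
    refine Nat.cast_le.2 ?_
    have h3 := descFactorial_two_mul_le n l
    rw [Nat.descFactorial_eq_factorial_mul_choose, Nat.descFactorial_eq_factorial_mul_choose] at h3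
    calc _ = (2 * l).factorial * (2 * n).choose (2 * l) := mul_comm _ _
      _ ≤ _ := h3
      _ ≤ l ^ l * n.choose l * (4 * n) ^ l := by gcongr; exact Nat.factorial_le_pow l
      _ = _ := by ring
  push_cast at h2
  refine le_of_mul_le_mul_left ?_ hl1
  calc (l : ℝ) ^ l * (((2 * n).choose (2 * l) : ℝ) * ∫ z, z ^ (2 * l) ∂gaussianReal 0 v)
      = ((2 * n).choose (2 * l) : ℝ) * ((l : ℝ) ^ l * ∫ z, z ^ (2 * l) ∂gaussianReal 0 v) := by ring
    _ ≤ ((2 * n).choose (2 * l) : ℝ) * ((2 * l).factorial * (3 / 2 * v) ^ l) := by gcongr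
    _ = (((2 * n).choose (2 * l) : ℝ) * (2 * l).factorial) * (3 / 2 * v) ^ l := by ring
    _ ≤ (n.choose l * (l : ℝ) ^ l * (4 * n) ^ l) * (3 / 2 * v) ^ l := by gcongr
    _ = (l : ℝ) ^ l * (n.choose l * ((4 * n) ^ l * (3 / 2 * v) ^ l)) := by ring
    _ = _ := by rw [← mul_pow]; congr 3; ring

theorem sum_range_eq_sum_even {f : ℕ → ℝ} (hf : ∀ k, f (2 * k + 1) = 0) (n : ℕ) :
    ∑ k ∈ Finset.range (2 * n + 1), f k = ∑ l ∈ Finset.range (n + 1), f (2 * l) := by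
  induction n with
  | zero => simp
  | succ n ih =>
    rw [show 2 * (n + 1) + 1 = 2 * n + 1 + 1 + 1 by ring, Finset.sum_range_succ,
      Finset.sum_range_succ, ih, hf, Finset.sum_range_succ _ (n + 1)]
    simp [mul_add]

/-- Moments of a shifted centered Gaussian variable. -/
theorem lintegral_add_pow_gaussianReal_le (v : ℝ≥0) (m : ℝ) (n : ℕ) :
    ∫⁻ z, ‖m + z‖ₑ ^ (2 * n) ∂gaussianReal 0 v ≤ (‖m‖ₑ ^ 2 + 6 * n * v) ^ n := by
  have hexp : ∀ z : ℝ, (m + z) ^ (2 * n) =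
      ∑ k ∈ Finset.range (2 * n + 1), m ^ (2 * n - k) * ((2 * n).choose k : ℝ) * z ^ k := by
    intro z
    rw [add_comm, add_pow]
    exact Finset.sum_congr rfl fun k _ => by ring
  have hi : ∀ k, Integrable (fun z : ℝ => m ^ (2 * n - k) * ((2 * n).choose k : ℝ) * z ^ k)
      (gaussianReal 0 v) := fun k => (integrable_pow_gaussianReal v k).const_mul _
  -- Odd moments vanish, and the even terms are dominated one by one by those of `(6nv + m²)^n`.
  have hint : ∫ z, (m + z) ^ (2 * n) ∂gaussianReal 0 v ≤ (m ^ 2 + 6 * n * v) ^ n := by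
    simp_rw [hexp]
    rw [integral_finsetSum _ fun k _ => hi k, sum_range_eq_sum_even
      (f := fun k => ∫ z, m ^ (2 * n - k) * ((2 * n).choose k : ℝ) * z ^ k ∂gaussianReal 0 v)
      (fun k => by rw [integral_const_mul, integral_odd_pow_gaussianReal, mul_zero]),
      add_comm (m ^ 2), add_pow]
    refine Finset.sum_le_sum (N := ℝ) fun l hl => ?_
    have hl' : l ≤ n := Nat.lt_succ_iff.1 (Finset.mem_range.1 hl)
    rw [integral_const_mul, mul_assoc]
    have : m ^ (2 * n - 2 * l) = (m ^ 2) ^ (n - l) := by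
      rw [← pow_mul]; congr 1; omega
    rw [this]
    calc (m ^ 2) ^ (n - l) * (((2 * n).choose (2 * l) : ℝ) * ∫ z, z ^ (2 * l) ∂gaussianReal 0 v)
        ≤ (m ^ 2) ^ (n - l) * (n.choose l * (6 * n * v) ^ l) := by
          exact mul_le_mul_of_nonneg_left (choose_mul_integral_pow_le v hl') (by positivity)
      _ = _ := by ring
  have hI : Integrable (fun z : ℝ => (m + z) ^ (2 * n)) (gaussianReal 0 v) := by
    simp_rw [hexp]
    exact integrable_finsetSum _ fun k _ => hi k
  have hen : ∀ z : ℝ, ‖z‖ₑ ^ (2 * n) = ENNReal.ofReal (z ^ (2 * n)) := by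
    intro z
    rw [← enorm_pow, Real.enorm_of_nonneg (by rw [pow_mul]; positivity)]
  simp_rw [hen]
  have hnn : ∀ z : ℝ, 0 ≤ (m + z) ^ (2 * n) := fun z => by rw [pow_mul]; positivity
  rw [← ofReal_integral_eq_lintegral_ofReal hI (ae_of_all _ hnn)]
  refine (ENNReal.ofReal_le_ofReal hint).trans_eq ?_
  rw [ENNReal.ofReal_pow (by positivity), ENNReal.ofReal_add (by positivity) (by positivity),
    ENNReal.ofReal_mul (by positivity), ENNReal.ofReal_mul (by positivity)]
  congr 2
  · rw [← enorm_pow, Real.enorm_of_nonneg (by positivity)]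
  · simp

theorem lintegral_exp_gaussianReal (v : ℝ≥0) (c : ℝ) :
    ∫⁻ z, ENNReal.ofReal (Real.exp (c * z)) ∂gaussianReal 0 v =
      ENNReal.ofReal (Real.exp (c ^ 2 * v / 2)) := by
  rw [← ofReal_integral_eq_lintegral_ofReal (integrable_exp_mul_gaussianReal c)
    (ae_of_all _ fun z => (Real.exp_pos _).le)]
  have := congrFun (mgf_fun_id_gaussianReal (μ := 0) (v := v)) c
  simp only [mgf] at this
  rw [this]
  congr 2
  ring

end

section

/-! ### A rational majorant of the heat kernel -/

/-- The function `√t / (t + |x|²)` on the torus. -/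
def gk (t : ℝ) (x : Torus) : ℝ := √t / (t + ‖x‖ ^ 2)

theorem gk_nonneg {t : ℝ} (ht : 0 ≤ t) (x : Torus) : 0 ≤ gk t x := by
  unfold gk; positivity

theorem measurable_gk (t : ℝ) : Measurable (gk t) := by
  unfold gk
  exact measurable_const.div (measurable_const.add (measurable_norm.pow_const 2))

theorem gk_le {t : ℝ} (ht : 0 < t) (x : Torus) : gk t x ≤ 1 / √t := by
  unfold gk
  have h : √t * √t = t := Real.mul_self_sqrt ht.le
  have := Real.sqrt_pos.2 ht
  rw [div_le_div_iff₀ (by positivity) this, h]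
  nlinarith [sq_nonneg ‖x‖]

/-- Division-free form of the kernel. At `t = 0` both sides vanish because `√0 = 0`. -/
theorem gk_sq {t : ℝ} (ht : 0 ≤ t) (x : Torus) : (t + ‖x‖ ^ 2) ^ 2 * gk t x ^ 2 = t := by
  rcases eq_or_lt_of_le ht with rfl | ht
  · simp [gk]
  · unfold gk
    have h : √t ^ 2 = t := Real.sq_sqrt ht.le
    rw [div_pow, h]
    field_simp

theorem Torus.exists_rep (x : Torus) : ∃ r : ℝ, (r : Torus) = x ∧ |r| ≤ 1 ∧ ‖x‖ = |r| := by
  have h := (AddCircle.equivIoc (2 : ℝ) (-1) x).2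
  have hc : ((AddCircle.equivIoc (2 : ℝ) (-1) x : ℝ) : Torus) = x := AddCircle.coe_equivIoc
  refine ⟨(AddCircle.equivIoc (2 : ℝ) (-1) x : ℝ), hc, ?_⟩
  have h1 : |((AddCircle.equivIoc (2 : ℝ) (-1) x : ℝ))| ≤ 1 := by
    rw [abs_le]; constructor <;> linarith [h.1, h.2]
  refine ⟨h1, ?_⟩
  conv_lhs => rw [← hc]
  rw [AddCircle.norm_coe_eq_abs_iff _ two_ne_zero]
  simpa using h1

theorem lintegral_gk_le {t : ℝ} (ht : 0 < t) : ∫⁻ x, ENNReal.ofReal (gk t x) ≤ 4 := by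
  have hst := Real.sqrt_pos.2 ht
  have hint : Integrable (fun x : ℝ => 1 / √t * (1 + (x / √t) ^ 2)⁻¹) :=
    (integrable_inv_one_add_sq.comp_div hst.ne').const_mul _
  rw [← AddCircle.lintegral_preimage 2 (-1)]
  calc ∫⁻ a in Set.Ioc (-1 : ℝ) (-1 + 2), ENNReal.ofReal (gk t a)
      = ∫⁻ a in Set.Ioc (-1 : ℝ) (-1 + 2), ENNReal.ofReal (1 / √t * (1 + (a / √t) ^ 2)⁻¹) := by
        refine setLIntegral_congr_fun measurableSet_Ioc fun a ha => ?_
        have hn : ‖(a : Torus)‖ = |a| := by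
          rw [AddCircle.norm_coe_eq_abs_iff _ two_ne_zero, abs_two]
          rw [abs_le]; constructor <;> linarith [ha.1, ha.2]
        congr 1
        rw [gk, hn, sq_abs, div_pow, Real.sq_sqrt ht.le]
        have h : √t * √t = t := Real.mul_self_sqrt ht.le
        field_simp
        nlinarith
    _ ≤ ∫⁻ a : ℝ, ENNReal.ofReal (1 / √t * (1 + (a / √t) ^ 2)⁻¹) := setLIntegral_le_lintegral _ _
    _ = ENNReal.ofReal (∫ a : ℝ, 1 / √t * (1 + (a / √t) ^ 2)⁻¹) :=
        (ofReal_integral_eq_lintegral_ofReal hint (ae_of_all _ fun x => by positivity)).symm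
    _ = ENNReal.ofReal Real.pi := by
        rw [integral_const_mul, Measure.integral_comp_div (fun x => (1 + x ^ 2)⁻¹),
          integral_univ_inv_one_add_sq, abs_of_pos hst, smul_eq_mul]
        congr 1; field_simp
    _ ≤ ENNReal.ofReal 4 := ENNReal.ofReal_le_ofReal Real.pi_le_four
    _ = 4 := by simp

theorem lintegral_gk_sq_le {t : ℝ} (ht : 0 < t) :
    ∫⁻ x, ENNReal.ofReal (gk t x) ^ 2 ≤ 4 * ENNReal.ofReal (1 / √t) := by
  calc ∫⁻ x, ENNReal.ofReal (gk t x) ^ 2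
      ≤ ∫⁻ x, ENNReal.ofReal (gk t x) * ENNReal.ofReal (1 / √t) := by
        refine lintegral_mono fun x => ?_
        rw [sq]; gcongr; exact gk_le ht x
    _ ≤ _ := by
        rw [lintegral_mul_const' _ _ ENNReal.ofReal_ne_top]
        gcongr; exact lintegral_gk_le ht

/-- The majorants are almost stable under `L²` convolution. -/
theorem gk_mul_gk_le {a b : ℝ} (ha : 0 < a) (hb : 0 < b) (x y : Torus) :
    gk a (x - y) ^ 2 * gk b y ^ 2 ≤
      8 * (gk b y * (1 / √b) + gk a (x - y) * (1 / √a)) * gk (a + b) x ^ 2 := by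
  set p := ‖x - y‖ with hp
  set q := ‖y‖ with hq
  have hpq : ‖x‖ ≤ p + q := by simpa using norm_add_le (x - y) y
  have h0 : (0 : ℝ) ≤ ‖x‖ := norm_nonneg x
  have hp0 : 0 ≤ p := norm_nonneg _
  have hq0 : 0 ≤ q := norm_nonneg _
  have hA := gk_sq ha.le (x - y)
  have hB := gk_sq hb.le y
  rw [← hp] at hA; rw [← hq] at hB
  have hS := gk_sq (add_pos ha hb).le x
  set A := gk a (x - y)
  set B := gk b y
  set S := gk (a + b) x
  have hA0 : 0 ≤ A := gk_nonneg ha.le _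
  have hB0 : 0 ≤ B := gk_nonneg hb.le _
  have hA1 : A ^ 2 ≤ A * (1 / √a) := by rw [sq]; gcongr; exact gk_le ha _
  have hB1 : B ^ 2 ≤ B * (1 / √b) := by rw [sq]; gcongr; exact gk_le hb _
  -- Since `‖x‖² ≤ 2(p² + q²)`, at least one of the two denominators is comparable with that of `gk
  -- (a + b) x`.
  have hX : (a + b + ‖x‖ ^ 2) ^ 2 ≤ 8 * ((a + p ^ 2) ^ 2 + (b + q ^ 2) ^ 2) := by
    have h1 : a + b + ‖x‖ ^ 2 ≤ 2 * ((a + p ^ 2) + (b + q ^ 2)) := by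
      nlinarith [sq_nonneg (p - q), mul_self_le_mul_self h0 hpq]
    calc (a + b + ‖x‖ ^ 2) ^ 2 ≤ (2 * ((a + p ^ 2) + (b + q ^ 2))) ^ 2 := by gcongr
      _ ≤ _ := by nlinarith [sq_nonneg ((a + p ^ 2) - (b + q ^ 2))]
  have hXpos : 0 < (a + b + ‖x‖ ^ 2) ^ 2 := by positivity
  refine le_of_mul_le_mul_left ?_ hXpos
  have hab : 0 < a + b := add_pos ha hb
  calc (a + b + ‖x‖ ^ 2) ^ 2 * (A ^ 2 * B ^ 2)
      ≤ 8 * ((a + p ^ 2) ^ 2 + (b + q ^ 2) ^ 2) * (A ^ 2 * B ^ 2) := by gcongr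
    _ = 8 * (((a + p ^ 2) ^ 2 * A ^ 2) * B ^ 2 + ((b + q ^ 2) ^ 2 * B ^ 2) * A ^ 2) := by ring
    _ = 8 * (a * B ^ 2 + b * A ^ 2) := by rw [hA, hB]
    _ ≤ 8 * ((a + b) * (B * (1 / √b)) + (a + b) * (A * (1 / √a))) := by gcongr <;> linarith
    _ = 8 * (B * (1 / √b) + A * (1 / √a)) * (a + b) := by ring
    _ = 8 * (B * (1 / √b) + A * (1 / √a)) * ((a + b + ‖x‖ ^ 2) ^ 2 * S ^ 2) := by rw [hS]
    _ = _ := by ring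

/-- The pointwise bound leaves only first powers of the kernels, each of mass at most 4. For fixed
`a + b` the factor `1/√a + 1/√b` is an integrable singularity at both ends, which is what lets the
Duhamel iteration close. -/
theorem lintegral_gk_sq_mul_gk_sq_le {a b : ℝ} (ha : 0 < a) (hb : 0 < b) (x : Torus) :
    ∫⁻ y, ENNReal.ofReal (gk a (x - y)) ^ 2 * ENNReal.ofReal (gk b y) ^ 2 ≤
      32 * ENNReal.ofReal (1 / √a + 1 / √b) * ENNReal.ofReal (gk (a + b) x) ^ 2 := by
  have hS0 := gk_nonneg (add_pos ha hb).le x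
  have hsa := Real.sqrt_pos.2 ha
  have hsb := Real.sqrt_pos.2 hb
  have h1 : ∀ y, ENNReal.ofReal (gk a (x - y)) ^ 2 * ENNReal.ofReal (gk b y) ^ 2 ≤
      (ENNReal.ofReal (gk b y) * ENNReal.ofReal (1 / √b) +
        ENNReal.ofReal (gk a (x - y)) * ENNReal.ofReal (1 / √a)) *
      (8 * ENNReal.ofReal (gk (a + b) x) ^ 2) := by
    intro y
    have hA0 := gk_nonneg ha.le (x - y)
    have hB0 := gk_nonneg hb.le y
    have := ENNReal.ofReal_le_ofReal (gk_mul_gk_le ha hb x y)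
    rw [ENNReal.ofReal_mul (by positivity), ENNReal.ofReal_mul (by positivity),
      ENNReal.ofReal_mul (by positivity), ENNReal.ofReal_add (by positivity) (by positivity),
      ENNReal.ofReal_mul (by positivity), ENNReal.ofReal_mul (by positivity),
      ENNReal.ofReal_pow hA0, ENNReal.ofReal_pow hB0, ENNReal.ofReal_pow hS0] at this
    refine this.trans_eq ?_
    rw [show ENNReal.ofReal 8 = 8 by simp]
    ring
  have hmB : Measurable fun y => ENNReal.ofReal (gk b y) := (measurable_gk b).ennreal_ofReal
  have hmA : Measurable fun y => ENNReal.ofReal (gk a y) := (measurable_gk a).ennreal_ofReal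
  have hfin : 8 * ENNReal.ofReal (gk (a + b) x) ^ 2 ≠ ∞ :=
    ENNReal.mul_ne_top (by simp) (ENNReal.pow_ne_top ENNReal.ofReal_ne_top)
  calc _ ≤ _ := lintegral_mono h1
    _ = ((∫⁻ y, ENNReal.ofReal (gk b y)) * ENNReal.ofReal (1 / √b) +
        (∫⁻ y, ENNReal.ofReal (gk a (x - y))) * ENNReal.ofReal (1 / √a)) *
        (8 * ENNReal.ofReal (gk (a + b) x) ^ 2) := by
        rw [lintegral_mul_const' _ _ hfin, lintegral_add_left (hmB.mul_const _),
          lintegral_mul_const' _ _ ENNReal.ofReal_ne_top,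
          lintegral_mul_const' _ _ ENNReal.ofReal_ne_top]
    _ ≤ (4 * ENNReal.ofReal (1 / √b) + 4 * ENNReal.ofReal (1 / √a)) *
        (8 * ENNReal.ofReal (gk (a + b) x) ^ 2) := by
        gcongr
        · exact lintegral_gk_le hb
        · rw [lintegral_sub_left_eq_self (μ := volume) (fun y => ENNReal.ofReal (gk a y)) x]
          exact lintegral_gk_le ha
    _ = _ := by
        rw [ENNReal.ofReal_add (by positivity) (by positivity)]
        ring

/-- Smoothing of a nonnegative function by the majorant. -/
def smooth (f : Torus → ℝ≥0∞) (t : ℝ) (x : Torus) : ℝ≥0∞ :=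
  ∫⁻ z, f z * ENNReal.ofReal (gk t (x - z))

theorem measurable_gk_sub (t : ℝ) :
    Measurable fun p : Torus × Torus => ENNReal.ofReal (gk t (p.1 - p.2)) :=
  ((measurable_gk t).comp (measurable_fst.sub measurable_snd)).ennreal_ofReal

theorem measurable_smooth {f : Torus → ℝ≥0∞} (hf : Measurable f) (t : ℝ) :
    Measurable (smooth f t) :=
  Measurable.lintegral_prod_right' (f := fun p : Torus × Torus =>
      f p.2 * ENNReal.ofReal (gk t (p.1 - p.2)))
    ((hf.comp measurable_snd).mul (measurable_gk_sub t))

/-- The kernel at time 0 is identically 0 and not a point mass. This suits the noise part, which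
vanishes at time 0. -/
theorem smooth_zero (f : Torus → ℝ≥0∞) (x : Torus) : smooth f 0 x = 0 := by
  simp [smooth, gk]

theorem lintegral_smooth_le {f : Torus → ℝ≥0∞} (hf : Measurable f) {t : ℝ} (ht : 0 ≤ t) :
    ∫⁻ x, smooth f t x ≤ 4 * ∫⁻ z, f z := by
  rcases eq_or_lt_of_le ht with rfl | ht
  · simp [smooth_zero]
  unfold smooth
  rw [lintegral_lintegral_swap
    ((hf.comp measurable_snd).mul (measurable_gk_sub t)).aemeasurable]
  calc ∫⁻ z, ∫⁻ x, f z * ENNReal.ofReal (gk t (x - z))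
      = ∫⁻ z, f z * ∫⁻ x, ENNReal.ofReal (gk t x) := by
        refine lintegral_congr fun z => ?_
        have hm : Measurable fun x => ENNReal.ofReal (gk t (x - z)) :=
          ((measurable_gk t).comp (measurable_id.sub_const z)).ennreal_ofReal
        rw [lintegral_const_mul _ hm,
          lintegral_sub_right_eq_self (fun x => ENNReal.ofReal (gk t x)) z]
    _ = (∫⁻ z, f z) * ∫⁻ x, ENNReal.ofReal (gk t x) := lintegral_mul_const _ hf
    _ ≤ (∫⁻ z, f z) * 4 := by gcongr; exact lintegral_gk_le ht
    _ = _ := mul_comm _ _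

/-- Minkowski's inequality in `L²(w dν)`: an `L²` estimate for each single source passes to their
superposition. -/
theorem lintegral_mul_lintegral_sq_le {α β : Type*} [MeasurableSpace α] [MeasurableSpace β]
    {μ : Measure α} [IsFiniteMeasure μ] {ν : Measure β} [SFinite ν] {w : β → ℝ≥0∞}
    (hw : Measurable w) {g : α → β → ℝ≥0∞} (hg : Measurable (Function.uncurry g)) {k : α → ℝ≥0∞}
    {K : ℝ≥0∞} (hK : K ≠ ∞) (h : ∀ a, ∫⁻ b, w b * g a b ^ 2 ∂ν ≤ K * k a ^ 2) :
    ∫⁻ b, w b * (∫⁻ a, g a b ∂μ) ^ 2 ∂ν ≤ K * (∫⁻ a, k a ∂μ) ^ 2 := by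
  have hsq : ∀ c : ℝ≥0∞, (c ^ (1 / 2 : ℝ)) ^ 2 = c := fun c => by
    rw [← ENNReal.rpow_two, ← ENNReal.rpow_mul]; norm_num
  have hsq' : ∀ c : ℝ≥0∞, (c ^ 2) ^ (1 / 2 : ℝ) = c := fun c => by
    rw [← ENNReal.rpow_two, ← ENNReal.rpow_mul]; norm_num
  have hm : Measurable (Function.uncurry fun a b => w b ^ (1 / 2 : ℝ) * g a b) :=
    ((hw.pow_const _).comp measurable_snd).mul hg
  have hM := lintegral_minkowski (μ := μ) (ν := ν) hm one_le_two
  have hsqw : ∀ b c, (w b ^ (1 / 2 : ℝ) * c) ^ (2 : ℝ) = w b * c ^ 2 := fun b c => by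
    rw [ENNReal.rpow_two, mul_pow, hsq]
  have hr : ∫⁻ a, (∫⁻ b, (w b ^ (1 / 2 : ℝ) * g a b) ^ (2 : ℝ) ∂ν) ^ (1 / 2 : ℝ) ∂μ ≤
      K ^ (1 / 2 : ℝ) * ∫⁻ a, k a ∂μ := by
    rw [← lintegral_const_mul' _ _ (ENNReal.rpow_ne_top_of_nonneg (by norm_num) hK)]
    refine lintegral_mono fun a => ?_
    simp only [hsqw]
    refine (ENNReal.rpow_le_rpow (h a) (by norm_num)).trans_eq ?_
    rw [ENNReal.mul_rpow_of_nonneg _ _ (by norm_num), hsq']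
  have hl : ∀ b, (∫⁻ a, w b ^ (1 / 2 : ℝ) * g a b ∂μ) ^ (2 : ℝ) = w b * (∫⁻ a, g a b ∂μ) ^ 2 := by
    intro b
    have hgb : Measurable fun a => g a b := hg.comp (measurable_id.prodMk measurable_const)
    rw [lintegral_const_mul _ hgb, hsqw]
  simp only [hl] at hM
  have h3 := pow_le_pow_left' (hM.trans hr) 2
  rwa [hsq, mul_pow, hsq] at h3

/-- By translation each source point `z` satisfies the convolution estimate, and superposing the
sources keeps the same constant. Thus the squared profile at time `b` is carried to the one at time
`a + b`. -/
theorem lintegral_gk_sq_mul_smooth_sq_le {f : Torus → ℝ≥0∞} (hf : Measurable f) {a b : ℝ}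
    (ha : 0 < a) (hb : 0 < b) (x : Torus) :
    ∫⁻ y, ENNReal.ofReal (gk a (x - y)) ^ 2 * smooth f b y ^ 2 ≤
      32 * ENNReal.ofReal (1 / √a + 1 / √b) * smooth f (a + b) x ^ 2 := by
  obtain ⟨K, hKdef⟩ : ∃ K, K = 32 * ENNReal.ofReal (1 / √a + 1 / √b) := ⟨_, rfl⟩
  rw [← hKdef]
  have hma : Measurable fun y => ENNReal.ofReal (gk a (x - y)) ^ 2 :=
    ((measurable_gk a).comp (measurable_const.sub measurable_id)).ennreal_ofReal.pow_const 2
  have hm' : Measurable fun p : Torus × Torus => f p.1 * ENNReal.ofReal (gk b (p.2 - p.1)) :=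
    (hf.comp measurable_fst).mul
      (((measurable_gk b).comp (measurable_snd.sub measurable_fst)).ennreal_ofReal)
  have hm : Measurable (Function.uncurry fun z y => f z * ENNReal.ofReal (gk b (y - z))) := hm'
  have hz : ∀ z, ∫⁻ y, ENNReal.ofReal (gk a (x - y)) ^ 2 *
      (f z * ENNReal.ofReal (gk b (y - z))) ^ 2 ≤
      K * (f z * ENNReal.ofReal (gk (a + b) (x - z))) ^ 2 := by
    intro z
    have hma' : Measurable fun y => ENNReal.ofReal (gk a ((x - z) - y)) ^ 2 :=
      ((measurable_gk a).comp (measurable_const.sub measurable_id)).ennreal_ofReal.pow_const 2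
    have hmb' : Measurable fun y => ENNReal.ofReal (gk b y) ^ 2 :=
      (measurable_gk b).ennreal_ofReal.pow_const 2
    calc ∫⁻ y, ENNReal.ofReal (gk a (x - y)) ^ 2 * (f z * ENNReal.ofReal (gk b (y - z))) ^ 2
        = ∫⁻ y, f z ^ 2 * (ENNReal.ofReal (gk a ((x - z) - (y - z))) ^ 2 *
            ENNReal.ofReal (gk b (y - z)) ^ 2) := by
          refine lintegral_congr fun y => ?_
          rw [sub_sub_sub_cancel_right]; ring
      _ = ∫⁻ y, f z ^ 2 * (ENNReal.ofReal (gk a ((x - z) - y)) ^ 2 *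
            ENNReal.ofReal (gk b y) ^ 2) :=
          lintegral_sub_right_eq_self (fun y => f z ^ 2 *
            (ENNReal.ofReal (gk a ((x - z) - y)) ^ 2 * ENNReal.ofReal (gk b y) ^ 2)) z
      _ = f z ^ 2 * ∫⁻ y, (ENNReal.ofReal (gk a ((x - z) - y)) ^ 2 *
            ENNReal.ofReal (gk b y) ^ 2) := lintegral_const_mul _ (hma'.mul hmb')
      _ ≤ f z ^ 2 * (K * ENNReal.ofReal (gk (a + b) (x - z)) ^ 2) := by
          gcongr; rw [hKdef]; exact lintegral_gk_sq_mul_gk_sq_le ha hb (x - z)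
      _ = _ := by ring
  have hK : K ≠ ∞ := hKdef ▸ ENNReal.mul_ne_top (by simp) ENNReal.ofReal_ne_top
  exact lintegral_mul_lintegral_sq_le (μ := volume) (ν := volume)
    (w := fun y => ENNReal.ofReal (gk a (x - y)) ^ 2)
    (g := fun z y => f z * ENNReal.ofReal (gk b (y - z)))
    (k := fun z => f z * ENNReal.ofReal (gk (a + b) (x - z))) hma hm hK hz

/-! ### Bounds for the heat kernel -/

theorem hasSum_one_div_int_sq : HasSum (fun n : ℤ => 1 / (n : ℝ) ^ 2) (Real.pi ^ 2 / 3) := by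
  have h := hasSum_zeta_two
  have h' : HasSum (fun n : ℕ => 1 / (((n : ℕ) + 1 : ℕ) : ℝ) ^ 2) (Real.pi ^ 2 / 6) := by
    have := (hasSum_nat_add_iff' 1).2 h
    simpa using this
  have := HasSum.of_nat_of_neg_add_one (f := fun n : ℤ => 1 / (n : ℝ) ^ 2)
    (m := Real.pi ^ 2 / 6) (m' := Real.pi ^ 2 / 6) (by simpa using h) (by
      convert h' using 2 with n
      push_cast
      congr 1; ring)
  convert this using 1
  ring

/-- Comparison of a periodized function with the majorant. -/
theorem tsum_le_of_le_gk {t x A : ℝ} (ht : 0 < t) (ht1 : t ≤ 1) (hx : |x| ≤ 1) (hA : 0 ≤ A)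
    {f : ℤ → ℝ} (hf0 : ∀ n, 0 ≤ f n) (hf : ∀ n, f n ≤ A * (t / (t + (x + 2 * n) ^ 2))) :
    Summable f ∧ ∑' n, f n ≤ 9 * A * (√t * gk t x) := by
  have hx2 : x ^ 2 ≤ 1 := by rw [← sq_abs]; nlinarith [abs_nonneg x]
  have hnorm : ‖(x : Torus)‖ = |x| := by
    rw [AddCircle.norm_coe_eq_abs_iff _ two_ne_zero, abs_two]; linarith
  have hg : √t * gk t x = t / (t + x ^ 2) := by
    rw [gk, hnorm, sq_abs, ← mul_div_assoc, Real.mul_self_sqrt ht.le]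
  rw [hg]
  -- The term `n = 0` is kept. For `n ≠ 0` one has `|x + 2n| ≥ |n|`, so the rest is at most `A t ∑
  -- 1/n² = A t π²/3 ≤ 4 A t`. As `t + x² ≤ 2`, also `t ≤ 2t/(t + x²)`, and the total factor is `1 +
  -- 8`.
  set B : ℤ → ℝ := fun n => (if n = 0 then A * (t / (t + x ^ 2)) else 0) +
    A * t * (1 / (n : ℝ) ^ 2) with hB
  have hBs : HasSum B (A * (t / (t + x ^ 2)) + A * t * (Real.pi ^ 2 / 3)) :=
    (hasSum_ite_eq 0 _).add (hasSum_one_div_int_sq.mul_left _)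
  have hfB : ∀ n, f n ≤ B n := by
    intro n
    refine (hf n).trans ?_
    by_cases hn : n = 0
    · simp [hB, hn]
    · simp only [hB, hn, if_false, zero_add]
      rw [mul_assoc, mul_one_div]
      have h1 : (1 : ℝ) ≤ |(n : ℝ)| := by
        rw [← Int.cast_abs]; exact_mod_cast Int.one_le_abs hn
      have h2 : |(n : ℝ)| ≤ |x + 2 * n| := by
        have := abs_sub_abs_le_abs_sub (2 * (n : ℝ)) (-x)
        rw [abs_mul, abs_two, abs_neg, sub_neg_eq_add, add_comm (2 * (n : ℝ))] at this
        linarith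
      have h3 : (n : ℝ) ^ 2 ≤ t + (x + 2 * n) ^ 2 := by
        rw [← sq_abs, ← sq_abs (x + 2 * n)]
        nlinarith [abs_nonneg (n : ℝ)]
      have h4 : (0 : ℝ) < (n : ℝ) ^ 2 := by positivity
      gcongr
  have hs : Summable f := Summable.of_nonneg_of_le hf0 hfB hBs.summable
  refine ⟨hs, ?_⟩
  refine (hs.tsum_le_tsum hfB hBs.summable).trans ?_
  rw [hBs.tsum_eq]
  have hpi : Real.pi ^ 2 / 3 ≤ 4 := by
    nlinarith [Real.pi_lt_d2, Real.pi_pos]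
  have h5 : t ≤ 2 * (t / (t + x ^ 2)) := by
    rw [← mul_div_assoc, le_div_iff₀ (by positivity)]
    nlinarith
  have : A * t * (Real.pi ^ 2 / 3) ≤ A * (2 * (t / (t + x ^ 2))) * 4 := by gcongr
  linarith

/-- The sum `∑ exp(-(x + 2n)²/(4t))`. -/
def expSum (t x : ℝ) : ℝ := ∑' n : ℤ, Real.exp (-((x + 2 * n) ^ 2) / (4 * t))

/-- The inequality `exp(-w) ≤ 1/(1 + w)` with `w = v/(4t)` makes each Gaussian term rational, at the
cost of a factor 4. -/
theorem expSum_bound {t x : ℝ} (ht : 0 < t) (ht1 : t ≤ 1) (hx : |x| ≤ 1) :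
    Summable (fun n : ℤ => Real.exp (-((x + 2 * n) ^ 2) / (4 * t))) ∧
      expSum t x ≤ 36 * (√t * gk t x) := by
  have := tsum_le_of_le_gk ht ht1 hx (A := 4) (by norm_num)
    (f := fun n : ℤ => Real.exp (-((x + 2 * n) ^ 2) / (4 * t))) (fun n => (Real.exp_pos _).le) ?_
  · refine ⟨this.1, this.2.trans_eq (by ring)⟩
  · intro n
    set v := (x + 2 * (n : ℝ)) ^ 2
    have hv : 0 ≤ v := sq_nonneg _
    rw [neg_div, Real.exp_neg, ← mul_div_assoc, ← one_div,
      div_le_div_iff₀ (Real.exp_pos _) (by positivity)]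
    have := Real.add_one_le_exp (v / (4 * t))
    have h2 : t + v ≤ 4 * t * (v / (4 * t) + 1) := by
      field_simp; linarith
    nlinarith

theorem expSum_nonneg (t x : ℝ) : 0 ≤ expSum t x := tsum_nonneg fun _ => (Real.exp_pos _).le

theorem heatKernelReal_eq (t x : ℝ) : heatKernelReal t x = 1 / √(4 * Real.pi * t) * expSum t x :=
  rfl

theorem heatKernel_coe (t x : ℝ) : heatKernel t (x : Torus) = heatKernelReal t x := rfl

theorem heatKernel_nonneg (t : ℝ) (x : Torus) : 0 ≤ heatKernel t x := by
  obtain ⟨r, rfl, -⟩ := Torus.exists_rep x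
  rw [heatKernel_coe, heatKernelReal_eq]
  have := expSum_nonneg t r
  positivity

theorem sqrt_four_pi_mul {t : ℝ} : 2 * √t ≤ √(4 * Real.pi * t) := by
  rw [show (2 : ℝ) * √t = √(4 * t) by
    rw [Real.sqrt_mul (by norm_num), show (4 : ℝ) = 2 ^ 2 by norm_num, Real.sqrt_sq zero_le_two]]
  rcases le_or_gt 0 t with ht | ht
  · apply Real.sqrt_le_sqrt
    nlinarith [Real.pi_gt_three]
  · rw [Real.sqrt_eq_zero_of_nonpos (by linarith)]; positivity

theorem one_div_sqrt_mul_le {t A g : ℝ} (ht : 0 < t) (hA : 0 ≤ A) (hg : 0 ≤ g) :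
    1 / √(4 * Real.pi * t) * (A * (√t * g)) ≤ A / 2 * g := by
  have hst := Real.sqrt_pos.2 ht
  have h := sqrt_four_pi_mul (t := t)
  have : 1 / √(4 * Real.pi * t) ≤ 1 / (2 * √t) := by gcongr
  calc _ ≤ 1 / (2 * √t) * (A * (√t * g)) := by gcongr
    _ = _ := by field_simp

theorem heatKernel_le {t : ℝ} (ht : 0 < t) (ht1 : t ≤ 1) (x : Torus) :
    heatKernel t x ≤ 18 * gk t x := by
  obtain ⟨r, rfl, hr, -⟩ := Torus.exists_rep x
  rw [heatKernel_coe, heatKernelReal_eq]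
  calc _ ≤ 1 / √(4 * Real.pi * t) * (36 * (√t * gk t r)) := by
        gcongr; exact (expSum_bound ht ht1 hr).2
    _ ≤ 36 / 2 * gk t r := one_div_sqrt_mul_le ht (by norm_num) (gk_nonneg ht.le _)
    _ = _ := by ring

/-- With `w = v/(4b)` and `δ = (b-a)/a` the exponent at time `a` is `-w(1 + δ)`. Each difference of
exponentials is therefore at most `δ w exp(-w)`, and `w exp(-w) ≤ 2/(1 + w)` gives rational decay
again. -/
theorem expSum_sub_le {a b x : ℝ} (ha : 0 < a) (hab : a ≤ b) (hb1 : b ≤ 1) (hx : |x| ≤ 1) :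
    0 ≤ expSum b x - expSum a x ∧
      expSum b x - expSum a x ≤ 72 * ((b - a) / a) * (√b * gk b x) := by
  have hb : 0 < b := ha.trans_le hab
  have hsa := (expSum_bound ha (hab.trans hb1) hx).1
  have hsb := (expSum_bound hb hb1 hx).1
  have heq : expSum b x - expSum a x = ∑' n : ℤ, (Real.exp (-((x + 2 * n) ^ 2) / (4 * b)) -
      Real.exp (-((x + 2 * n) ^ 2) / (4 * a))) := (hsb.tsum_sub hsa).symm
  have h0 : ∀ n : ℤ, 0 ≤ Real.exp (-((x + 2 * n) ^ 2) / (4 * b)) -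
      Real.exp (-((x + 2 * n) ^ 2) / (4 * a)) := by
    intro n
    rw [sub_nonneg]
    apply Real.exp_le_exp.2
    rw [neg_div, neg_div, neg_le_neg_iff]
    gcongr
  rw [heq]
  refine ⟨tsum_nonneg h0, ?_⟩
  have hba : 0 ≤ (b - a) / a := div_nonneg (by linarith) ha.le
  refine (tsum_le_of_le_gk hb hb1 hx (A := 8 * ((b - a) / a)) (by positivity) h0 ?_).2.trans_eq
    (by ring)
  intro n
  set v := (x + 2 * (n : ℝ)) ^ 2
  have hv : 0 ≤ v := sq_nonneg _
  set w := v / (4 * b) with hw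
  have hw0 : 0 ≤ w := by positivity
  have e1 : -v / (4 * a) = -w - w * ((b - a) / a) := by
    rw [hw]; field_simp; ring
  have e2 : -v / (4 * b) = -w := by rw [hw]; ring
  rw [e1, e2]
  have h1 : Real.exp (-w) - Real.exp (-w - w * ((b - a) / a)) ≤
      Real.exp (-w) * (w * ((b - a) / a)) := by
    rw [sub_eq_add_neg (-w), Real.exp_add]
    have := Real.add_one_le_exp (-(w * ((b - a) / a)))
    nlinarith [Real.exp_pos (-w)]
  have h2 : Real.exp (-w) * w ≤ 2 * (1 / (1 + w)) := by
    rw [Real.exp_neg, mul_one_div, inv_mul_eq_div, div_le_div_iff₀ (Real.exp_pos _) (by positivity)]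
    nlinarith [Real.quadratic_le_exp_of_nonneg hw0]
  have h3 : 1 / (1 + w) ≤ 4 * (b / (b + v)) := by
    rw [hw, ← mul_div_assoc, div_le_div_iff₀ (by positivity) (by positivity)]
    field_simp
    nlinarith
  calc _ ≤ Real.exp (-w) * (w * ((b - a) / a)) := h1
    _ = (Real.exp (-w) * w) * ((b - a) / a) := by ring
    _ ≤ (2 * (4 * (b / (b + v)))) * ((b - a) / a) := 
        mul_le_mul_of_nonneg_right (h2.trans (by gcongr)) hba
    _ = _ := by ring

/-- The exponential sum increases in time while the prefactor decreases. The two contributions have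
opposite signs, and each is controlled by the relative time change: the prefactor produces the `gk
a` term and the sum the `gk b` term. -/
theorem abs_heatKernel_sub_le {a b : ℝ} (ha : 0 < a) (hab : a ≤ b) (hb1 : b ≤ 1) (x : Torus) :
    |heatKernel b x - heatKernel a x| ≤ 36 * ((b - a) / a) * (gk a x + gk b x) := by
  obtain ⟨r, rfl, hr, -⟩ := Torus.exists_rep x
  have hb : 0 < b := ha.trans_le hab
  have hE := expSum_sub_le ha hab hb1 hr
  have hba : 0 ≤ (b - a) / a := div_nonneg (by linarith) ha.le
  have hga := gk_nonneg ha.le (r : Torus)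
  have hgb := gk_nonneg hb.le (r : Torus)
  have hpa := heatKernel_le ha (hab.trans hb1) (r : Torus)
  have hpa0 := heatKernel_nonneg a (r : Torus)
  set ca := 1 / √(4 * Real.pi * a) with hca
  set cb := 1 / √(4 * Real.pi * b) with hcb
  have hca0 : 0 ≤ ca := by positivity
  have hcb0 : 0 ≤ cb := by positivity
  have hc : cb ≤ ca := by rw [hca, hcb]; gcongr
  have hc2 : ca - cb ≤ ca * ((b - a) / a) := by
    have h1 : ca * (a / b) ≤ cb := by
      have h2 : cb = ca * √(a / b) := by
        rw [hca, hcb, Real.sqrt_mul (by positivity) a, Real.sqrt_mul (by positivity) b,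
          Real.sqrt_div ha.le]
        have := Real.sqrt_pos.2 ha
        field_simp
      rw [h2]
      gcongr
      have h01 : a / b ≤ 1 := (div_le_one hb).2 hab
      have h00 : 0 ≤ a / b := by positivity
      exact Real.le_sqrt_of_sq_le (by nlinarith)
    have h3 : 1 - a / b ≤ (b - a) / a := by
      rw [one_sub_div hb.ne']
      gcongr
    calc ca - cb ≤ ca - ca * (a / b) := by linarith
      _ = ca * (1 - a / b) := by ring
      _ ≤ _ := by gcongr
  rw [heatKernel_coe] at *
  rw [heatKernel_coe] at *
  rw [heatKernelReal_eq] at *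
  rw [heatKernelReal_eq]
  rw [← hca] at *
  rw [← hcb]
  have e0 := expSum_nonneg a r
  have k1 : 0 ≤ cb * (expSum b r - expSum a r) := mul_nonneg hcb0 hE.1
  have k2 : cb * (expSum b r - expSum a r) ≤ 36 * ((b - a) / a) * gk b r := by
    calc _ ≤ cb * (72 * ((b - a) / a) * (√b * gk b r)) := by gcongr; exact hE.2
      _ ≤ 72 * ((b - a) / a) / 2 * gk b r := one_div_sqrt_mul_le hb (by positivity) hgb
      _ = _ := by ring
  have k3 : 0 ≤ (ca - cb) * expSum a r := mul_nonneg (by linarith) e0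
  have k4 : (ca - cb) * expSum a r ≤ 36 * ((b - a) / a) * gk a r := by
    calc _ ≤ ca * ((b - a) / a) * expSum a r := by gcongr
      _ = ((b - a) / a) * (ca * expSum a r) := by ring
      _ ≤ ((b - a) / a) * (18 * gk a r) := by gcongr
      _ ≤ ((b - a) / a) * (36 * gk a r) := by gcongr; norm_num
      _ = _ := by ring
  have hsplit : cb * expSum b r - ca * expSum a r =
      cb * (expSum b r - expSum a r) - (ca - cb) * expSum a r := by ring
  rw [hsplit, abs_le]
  constructor
  · have : 0 ≤ 36 * ((b - a) / a) * gk b r := by positivity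
    linarith
  · have : 0 ≤ 36 * ((b - a) / a) * gk a r := by positivity
    linarith

theorem Torus.exists_measurable_rep : ∃ g : Torus → ℝ, Measurable g ∧ ∀ x, (g x : Torus) = x :=
  ⟨fun x => AddCircle.measurableEquivIoc (2 : ℝ) (-1) x,
    measurable_subtype_coe.comp (MeasurableEquiv.measurable _), fun _ => AddCircle.coe_equivIoc⟩

theorem measurable_heatKernel_uncurry : Measurable fun p : ℝ × Torus => heatKernel p.1 p.2 := by
  obtain ⟨g, hg, hgx⟩ := Torus.exists_measurable_rep
  have h : (fun p : ℝ × Torus => heatKernel p.1 p.2) =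
      (fun q : ℝ × ℝ => heatKernelReal q.1 q.2) ∘ fun p : ℝ × Torus => (p.1, g p.2) := by
    ext p
    simp only [Function.comp]
    rw [← heatKernel_coe, hgx]
  have hm : Measurable fun p : ℝ × ℝ => heatKernelReal p.1 p.2 := by
    unfold heatKernelReal
    refine Measurable.mul (by fun_prop) (Measurable.tsum fun n => ?_)
    fun_prop
  rw [h]
  exact hm.comp (measurable_fst.prodMk (hg.comp measurable_snd))

theorem measurable_heatKernel (t : ℝ) : Measurable (heatKernel t) :=
  measurable_heatKernel_uncurry.comp (measurable_const.prodMk measurable_id)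

/-- Unfolding: one period of the periodized function integrates to the whole-line Gaussian of
variance `2t`. The restriction `t ≤ 1` serves only the summability statement in `expSum_bound`. -/
theorem lintegral_heatKernel {t : ℝ} (ht : 0 < t) (ht1 : t ≤ 1) :
    ∫⁻ x, ENNReal.ofReal (heatKernel t x) = 1 := by
  set g : ℝ → ℝ := fun x => 1 / √(4 * Real.pi * t) * Real.exp (-x ^ 2 / (4 * t)) with hg
  have hg0 : ∀ x, 0 ≤ g x := fun x => by positivity
  have hgm : Measurable g := by fun_prop
  have h1 : ∫⁻ x, ENNReal.ofReal (g x) = 1 := by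
    have := lintegral_gaussianPDFReal_eq_one 0 (v := (2 * t).toNNReal) (by simpa using ht)
    convert this using 4 with x
    rw [gaussianPDFReal, Real.coe_toNNReal _ (by positivity), hg]
    simp only [one_div, sub_zero]
    ring_nf
  rw [← AddCircle.lintegral_preimage 2 (-1)]
  have h2 : ∀ a ∈ Set.Ioc (-1 : ℝ) (-1 + 2), ENNReal.ofReal (heatKernel t (a : Torus)) =
      ∑' n : ℤ, ENNReal.ofReal (g (a + 2 * n)) := by
    intro a ha
    have ha1 : |a| ≤ 1 := by rw [abs_le]; constructor <;> linarith [ha.1, ha.2]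
    rw [heatKernel_coe, heatKernelReal_eq, expSum, ← tsum_mul_left,
      ENNReal.ofReal_tsum_of_nonneg (fun n => by positivity)
        ((expSum_bound ht ht1 ha1).1.mul_left _)]
  have hgn : ∀ n : ℤ, Measurable fun a : ℝ => ENNReal.ofReal (g (a + 2 * n)) := fun n =>
    (hgm.comp (measurable_id.add_const _)).ennreal_ofReal
  rw [setLIntegral_congr_fun measurableSet_Ioc h2, lintegral_tsum
    (fun n => (hgn n).aemeasurable), ← h1,
    ← setLIntegral_univ, ← iUnion_Ioc_add_zsmul (two_pos : (0 : ℝ) < 2) (-1),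
    lintegral_iUnion (fun _ => measurableSet_Ioc) (Set.pairwise_disjoint_Ioc_add_zsmul _ _)]
  refine tsum_congr fun n => ?_
  rw [← lintegral_indicator measurableSet_Ioc, ← lintegral_indicator measurableSet_Ioc]
  refine Eq.trans ?_ (lintegral_add_right_eq_self (μ := volume) _ (2 * (n : ℝ)))
  refine lintegral_congr fun a => ?_
  simp only [Set.indicator_apply, Set.mem_Ioc, zsmul_eq_mul, Int.cast_add, Int.cast_one]
  refine if_congr ?_ rfl rfl
  constructor <;> rintro ⟨h3, h4⟩ <;> constructor <;> linarith

end

section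

variable {Ω : Type*} {mΩ : MeasurableSpace Ω} {P : Measure Ω}

/-! ### Squared moment norms -/

/-- `mom n X = ‖X‖²` in `L^{2n}(P)`. -/
def mom (P : Measure Ω) (n : ℕ) (X : Ω → ℝ) : ℝ≥0∞ :=
  (∫⁻ ω, ‖X ω‖ₑ ^ (2 * n) ∂P) ^ (1 / (n : ℝ))

theorem mom_mono_ae {n : ℕ} {X Y : Ω → ℝ} (h : ∀ᵐ ω ∂P, ‖X ω‖ₑ ≤ ‖Y ω‖ₑ) :
    mom P n X ≤ mom P n Y := by
  unfold mom
  refine ENNReal.rpow_le_rpow (lintegral_mono_ae ?_) (by positivity)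
  filter_upwards [h] with ω hω
  gcongr

theorem mom_zero {n : ℕ} (hn : n ≠ 0) : mom P n (fun _ => 0) = 0 := by
  simp [mom, hn, Nat.pos_of_ne_zero hn]

theorem mom_one (X : Ω → ℝ) : mom P 1 X = ∫⁻ ω, ‖X ω‖ₑ ^ 2 ∂P := by
  simp [mom]

theorem mom_pow {n : ℕ} (hn : n ≠ 0) (X : Ω → ℝ) :
    mom P n X ^ n = ∫⁻ ω, ‖X ω‖ₑ ^ (2 * n) ∂P := by
  unfold mom
  rw [← ENNReal.rpow_natCast, ← ENNReal.rpow_mul, one_div_mul_cancel (by exact_mod_cast hn),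
    ENNReal.rpow_one]

theorem lintegral_pow_rpow_add_le {n : ℕ} (hn : n ≠ 0) {f g : Ω → ℝ≥0∞}
    (hf : AEMeasurable f P) (hg : AEMeasurable g P) :
    (∫⁻ ω, (f ω + g ω) ^ n ∂P) ^ (1 / (n : ℝ)) ≤
      (∫⁻ ω, f ω ^ n ∂P) ^ (1 / (n : ℝ)) + (∫⁻ ω, g ω ^ n ∂P) ^ (1 / (n : ℝ)) := by
  have h1 : (1 : ℝ) ≤ n := by exact_mod_cast Nat.one_le_iff_ne_zero.2 hn
  simpa [ENNReal.rpow_natCast] using ENNReal.lintegral_Lp_add_le hf hg h1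

theorem lintegral_const_mul_pow_rpow {n : ℕ} (hn : n ≠ 0) {c : ℝ≥0∞} (hc : c ≠ ∞)
    (f : Ω → ℝ≥0∞) :
    (∫⁻ ω, (c * f ω) ^ n ∂P) ^ (1 / (n : ℝ)) = c * (∫⁻ ω, f ω ^ n ∂P) ^ (1 / (n : ℝ)) := by
  simp_rw [mul_pow]
  rw [lintegral_const_mul' _ _ (ENNReal.pow_ne_top hc), ENNReal.mul_rpow_of_nonneg _ _
    (by positivity), ← ENNReal.rpow_natCast, ← ENNReal.rpow_mul, mul_one_div_cancel (by positivity),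
    ENNReal.rpow_one]

theorem mom_const_mul {n : ℕ} (hn : n ≠ 0) (c : ℝ) (X : Ω → ℝ) :
    mom P n (fun ω => c * X ω) = ‖c‖ₑ ^ 2 * mom P n X := by
  have h := lintegral_const_mul_pow_rpow (P := P) hn (c := ‖c‖ₑ ^ 2)
    (ENNReal.pow_ne_top enorm_ne_top) fun ω => ‖X ω‖ₑ ^ 2
  unfold mom
  simp_rw [enorm_mul, pow_mul, mul_pow _ _ 2]
  exact h

/-- The factors 2 are the price of squared norms: `(x + y)² ≤ 2x² + 2y²` is used before the triangle
inequality in `Lⁿ`. -/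
theorem mom_add_le {n : ℕ} (hn : n ≠ 0) {X Y : Ω → ℝ} (hX : AEMeasurable X P)
    (hY : AEMeasurable Y P) :
    mom P n (fun ω => X ω + Y ω) ≤ 2 * mom P n X + 2 * mom P n Y := by
  unfold mom
  calc (∫⁻ ω, ‖X ω + Y ω‖ₑ ^ (2 * n) ∂P) ^ (1 / (n : ℝ))
      ≤ (∫⁻ ω, (2 * ‖X ω‖ₑ ^ 2 + 2 * ‖Y ω‖ₑ ^ 2) ^ n ∂P) ^ (1 / (n : ℝ)) := by
        refine ENNReal.rpow_le_rpow (lintegral_mono fun ω => ?_) (by positivity)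
        rw [pow_mul]
        refine pow_le_pow_left' ?_ n
        have h := ENNReal.ofReal_le_ofReal (add_sq_le (a := X ω) (b := Y ω))
        have e : ∀ x : ℝ, ‖x‖ₑ ^ 2 = ENNReal.ofReal (x ^ 2) := fun x => by
          rw [← enorm_pow, Real.enorm_of_nonneg (sq_nonneg x)]
        rw [e, e, e]
        rw [ENNReal.ofReal_mul zero_le_two, ENNReal.ofReal_add (sq_nonneg _) (sq_nonneg _)] at h
        refine h.trans_eq ?_
        rw [mul_add]; simp
    _ ≤ _ := lintegral_pow_rpow_add_le hn ((hX.enorm.pow_const 2).const_mul 2)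
        ((hY.enorm.pow_const 2).const_mul 2)
    _ = _ := by
        rw [lintegral_const_mul_pow_rpow hn (by simp), lintegral_const_mul_pow_rpow hn (by simp)]
        simp_rw [pow_mul]

theorem mom_eq_eLpNorm {n : ℕ} (hn : n ≠ 0) (X : Ω → ℝ) :
    mom P n X = eLpNorm X ((2 * n : ℕ) : ℝ≥0∞) P ^ 2 := by
  rw [eLpNorm_eq_lintegral_rpow_enorm_toReal (by simpa using hn) (ENNReal.natCast_ne_top _),
    ← ENNReal.rpow_natCast,
    ← ENNReal.rpow_mul]
  unfold mom
  simp only [ENNReal.toReal_natCast, ENNReal.rpow_natCast]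
  congr 1
  have : (n : ℝ) ≠ 0 := by positivity
  push_cast
  field_simp

theorem mom_one_le [IsProbabilityMeasure P] {n : ℕ} (hn : n ≠ 0) {X : Ω → ℝ}
    (hX : AEMeasurable X P) : mom P 1 X ≤ mom P n X := by
  rw [mom_eq_eLpNorm one_ne_zero, mom_eq_eLpNorm hn]
  gcongr
  refine eLpNorm_le_eLpNorm_of_exponent_le ?_ hX.aestronglyMeasurable
  have : 2 * 1 ≤ 2 * n := by omega
  exact_mod_cast this

theorem mom_le_of_bounded [IsProbabilityMeasure P] {n : ℕ} (hn : n ≠ 0) {X : Ω → ℝ} {K : ℝ≥0∞}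
    (h : ∀ᵐ ω ∂P, ‖X ω‖ₑ ≤ K) : mom P n X ≤ K ^ 2 := by
  unfold mom
  calc _ ≤ (∫⁻ _, (K ^ 2) ^ n ∂P) ^ (1 / (n : ℝ)) := by
        refine ENNReal.rpow_le_rpow (lintegral_mono_ae ?_) (by positivity)
        filter_upwards [h] with ω hω
        rw [pow_mul]; gcongr
    _ = _ := by
        rw [lintegral_const, measure_univ, mul_one, ← ENNReal.rpow_natCast, ← ENNReal.rpow_mul,
          mul_one_div_cancel (by positivity), ENNReal.rpow_one]

theorem measurable_mom {α : Type*} [MeasurableSpace α] [SFinite P] {n : ℕ} {f : α → Ω → ℝ}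
    (hf : Measurable (Function.uncurry f)) : Measurable fun a => mom P n (f a) :=
  (Measurable.lintegral_prod_right' (f := fun p : α × Ω => ‖f p.1 p.2‖ₑ ^ (2 * n))
    (hf.enorm.pow_const _)).pow_const _

/-- Minkowski's inequality for the squared moment norms. -/
theorem lintegral_lintegral_sq_pow_le {α : Type*} [MeasurableSpace α] {μ : Measure α}
    [IsFiniteMeasure μ] [SFinite P] {n : ℕ} (hn : n ≠ 0) {f : α → Ω → ℝ}
    (hf : Measurable (Function.uncurry f)) :
    (∫⁻ ω, (∫⁻ a, ‖f a ω‖ₑ ^ 2 ∂μ) ^ n ∂P) ^ (1 / (n : ℝ)) ≤ ∫⁻ a, mom P n (f a) ∂μ := by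
  have h1 : (1 : ℝ) ≤ n := by exact_mod_cast Nat.one_le_iff_ne_zero.2 hn
  have := lintegral_minkowski (μ := μ) (ν := P) (f := fun a ω => ‖f a ω‖ₑ ^ 2)
    (hf.enorm.pow_const 2) h1
  simp only [ENNReal.rpow_natCast, ← pow_mul] at this
  exact this

/-! ### The measure on the time axis -/

theorem lintegral_timeMeasure {f : ℝ≥0 → ℝ≥0∞} (hf : Measurable f) :
    ∫⁻ s, f s ∂timeMeasure = ∫⁻ s in Set.Ici (0 : ℝ), f s.toNNReal := by
  unfold timeMeasure
  rw [lintegral_map hf measurable_real_toNNReal]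

theorem timeMeasure_Ioc (s t : ℝ≥0) : timeMeasure (Set.Ioc s t) = (t - s : ℝ≥0) := by
  unfold timeMeasure
  rw [Measure.map_apply measurable_real_toNNReal measurableSet_Ioc,
    Measure.restrict_apply (measurable_real_toNNReal measurableSet_Ioc)]
  have : Real.toNNReal ⁻¹' Set.Ioc s t ∩ Set.Ici 0 = Set.Ioc (s : ℝ) t := by
    ext x
    simp only [Set.mem_inter_iff, Set.mem_preimage, Set.mem_Ioc, Set.mem_Ici]
    constructor
    · rintro ⟨⟨h1, h2⟩, h3⟩
      exact ⟨(Real.lt_toNNReal_iff_coe_lt).1 h1, (Real.toNNReal_le_iff_le_coe).1 h2⟩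
    · rintro ⟨h1, h2⟩
      exact ⟨⟨(Real.lt_toNNReal_iff_coe_lt).2 h1, (Real.toNNReal_le_iff_le_coe).2 h2⟩,
        s.2.trans h1.le⟩
  rw [this, Real.volume_Ioc, ENNReal.ofReal, NNReal.sub_def]

theorem spaceTimeMeasure_Ioc_prod (s t : ℝ≥0) (A : Set Torus) :
    spaceTimeMeasure (Set.Ioc s t ×ˢ A) = (t - s : ℝ≥0) * volume A := by
  rw [spaceTimeMeasure, Measure.prod_prod, timeMeasure_Ioc]

theorem spaceTimeMeasure_Ioc_prod_ne_top (s t : ℝ≥0) (A : Set Torus) :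
    spaceTimeMeasure (Set.Ioc s t ×ˢ A) ≠ ∞ := by
  rw [spaceTimeMeasure_Ioc_prod]
  exact ENNReal.mul_ne_top ENNReal.coe_ne_top (measure_ne_top _ _)

/-! ### White noise -/

namespace IsWhiteNoise

variable {𝓕 : Filtration ℝ≥0 mΩ} {W : Set (ℝ≥0 × Torus) → Ω → ℝ}

theorem memLp (hW : IsWhiteNoise 𝓕 P W) {A : Set (ℝ≥0 × Torus)} (hA : MeasurableSet A)
    (hA' : spaceTimeMeasure A ≠ ∞) : MemLp (W A) 2 P :=
  (hW.gaussian.hasGaussianLaw_eval ⟨A, hA, hA'⟩).memLp_two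

theorem integrable_mul (hW : IsWhiteNoise 𝓕 P W) {A B : Set (ℝ≥0 × Torus)}
    (hA : MeasurableSet A) (hA' : spaceTimeMeasure A ≠ ∞) (hB : MeasurableSet B)
    (hB' : spaceTimeMeasure B ≠ ∞) : Integrable (fun ω => W A ω * W B ω) P :=
  (hW.memLp hA hA').integrable_mul (hW.memLp hB hB')

theorem empty_ae (hW : IsWhiteNoise 𝓕 P W) : W ∅ =ᵐ[P] 0 := by
  have h := hW.covariance ∅ ∅ .empty (by simp) .empty (by simp)
  have hi := hW.integrable_mul .empty (by simp) .empty (by simp)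
  simp only [Set.inter_self, measure_empty, ENNReal.toReal_zero] at h
  rw [integral_eq_zero_iff_of_nonneg (fun ω => mul_self_nonneg _) hi] at h
  filter_upwards [h] with ω hω
  exact mul_self_eq_zero.1 hω

/-- Only the covariances of the noise are prescribed, so additivity has to be derived: the second
moment of `W (A ∪ B) - W A - W B` expands into covariances that cancel. -/
theorem union_ae (hW : IsWhiteNoise 𝓕 P W) {A B : Set (ℝ≥0 × Torus)}
    (hA : MeasurableSet A) (hA' : spaceTimeMeasure A ≠ ∞) (hB : MeasurableSet B)
    (hB' : spaceTimeMeasure B ≠ ∞) (hd : Disjoint A B) :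
    W (A ∪ B) =ᵐ[P] fun ω => W A ω + W B ω := by
  have hC := hA.union hB
  have hC' : spaceTimeMeasure (A ∪ B) ≠ ∞ := measure_union_ne_top hA' hB'
  have i1 := hW.integrable_mul hC hC' hC hC'
  have i2 := hW.integrable_mul hC hC' hA hA'
  have i3 := hW.integrable_mul hC hC' hB hB'
  have i4 := hW.integrable_mul hA hA' hA hA'
  have i5 := hW.integrable_mul hA hA' hB hB'
  have i6 := hW.integrable_mul hB hB' hB hB'
  have e1 := hW.covariance _ _ hC hC' hC hC'
  have e2 := hW.covariance _ _ hC hC' hA hA'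
  have e3 := hW.covariance _ _ hC hC' hB hB'
  have e4 := hW.covariance _ _ hA hA' hA hA'
  have e5 := hW.covariance _ _ hA hA' hB hB'
  have e6 := hW.covariance _ _ hB hB' hB hB'
  have s2 : (A ∪ B) ∩ A = A := by rw [Set.inter_eq_right]; exact Set.subset_union_left
  have s3 : (A ∪ B) ∩ B = B := by rw [Set.inter_eq_right]; exact Set.subset_union_right
  rw [Set.inter_self, measure_union hd hB, ENNReal.toReal_add hA' hB'] at e1
  rw [s2] at e2; rw [s3] at e3
  rw [Set.inter_self] at e4 e6
  rw [hd.inter_eq, measure_empty, ENNReal.toReal_zero] at e5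
  have hexp : ∀ ω, (W (A ∪ B) ω - (W A ω + W B ω)) ^ 2 =
      W (A ∪ B) ω * W (A ∪ B) ω - 2 * (W (A ∪ B) ω * W A ω) - 2 * (W (A ∪ B) ω * W B ω) +
      W A ω * W A ω + 2 * (W A ω * W B ω) + W B ω * W B ω := fun ω => by ring
  have j1 : Integrable (fun ω => W (A ∪ B) ω * W (A ∪ B) ω - 2 * (W (A ∪ B) ω * W A ω)) P :=
    i1.sub (i2.const_mul 2)
  have j2 : Integrable (fun ω => W (A ∪ B) ω * W (A ∪ B) ω - 2 * (W (A ∪ B) ω * W A ω) -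
      2 * (W (A ∪ B) ω * W B ω)) P := j1.sub (i3.const_mul 2)
  have j3 : Integrable (fun ω => W (A ∪ B) ω * W (A ∪ B) ω - 2 * (W (A ∪ B) ω * W A ω) -
      2 * (W (A ∪ B) ω * W B ω) + W A ω * W A ω) P := j2.add i4
  have j4 : Integrable (fun ω => W (A ∪ B) ω * W (A ∪ B) ω - 2 * (W (A ∪ B) ω * W A ω) -
      2 * (W (A ∪ B) ω * W B ω) + W A ω * W A ω + 2 * (W A ω * W B ω)) P :=
    j3.add (i5.const_mul 2)
  have hI : Integrable (fun ω => (W (A ∪ B) ω - (W A ω + W B ω)) ^ 2) P := by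
    simp_rw [hexp]; exact j4.add i6
  have h0 : ∫ ω, (W (A ∪ B) ω - (W A ω + W B ω)) ^ 2 ∂P = 0 := by
    simp_rw [hexp]
    rw [integral_add j4 i6, integral_add j3 (i5.const_mul 2), integral_add j2 i4,
      integral_sub j1 (i3.const_mul 2), integral_sub i1 (i2.const_mul 2),
      integral_const_mul, integral_const_mul, integral_const_mul, e1, e2, e3, e4, e5, e6]
    ring
  rw [integral_eq_zero_iff_of_nonneg (fun ω => sq_nonneg _) hI] at h0
  filter_upwards [h0] with ω hω
  have : W (A ∪ B) ω - (W A ω + W B ω) = 0 := by simpa using hω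
  linarith

end IsWhiteNoise

end

section

variable {Ω : Type*} {mΩ : MeasurableSpace Ω} {P : Measure Ω}
variable {𝓕 : Filtration ℝ≥0 mΩ} {W : Set (ℝ≥0 × Torus) → Ω → ℝ}

/-! ### Increments of the noise over a time slab -/

/-- The variance of `∑ xᵢ W((s, t] × Aᵢ)`. -/
def slabVar {ι : Type*} [Fintype ι] (s t : ℝ≥0) (A : ι → Set Torus) (x : ι → ℝ) : ℝ≥0 :=
  (t - s) * Real.toNNReal (∫ y, (∑ i, (A i).indicator (fun _ => x i) y) ^ 2)

section Slab

theorem integrable_indicator_mul_indicator {ι : Type*} {A : ι → Set Torus} (hA : ∀ i, MeasurableSet (A i)) (x : ι → ℝ) (i j : ι) :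
    Integrable (fun y => (A i).indicator (fun _ => x i) y * (A j).indicator (fun _ => x j) y)
      (volume : Measure Torus) := by
  have : (fun y => (A i).indicator (fun _ => x i) y * (A j).indicator (fun _ => x j) y) =
      (A i ∩ A j).indicator fun _ => x i * x j := by
    ext y
    by_cases h1 : y ∈ A i <;> by_cases h2 : y ∈ A j <;> simp [h1, h2]
  rw [this]
  exact (integrable_const _).indicator ((hA i).inter (hA j))

variable {ι : Type*} [Fintype ι] {A : ι → Set Torus}

theorem integral_sum_indicator_sq (hA : ∀ i, MeasurableSet (A i)) (x : ι → ℝ) :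
    ∫ y, (∑ i, (A i).indicator (fun _ => x i) y) ^ 2 =
      ∑ i, ∑ j, x i * x j * volume.real (A i ∩ A j) := by
  simp_rw [sq, Finset.sum_mul_sum]
  rw [integral_finsetSum _ fun i _ => integrable_finsetSum _ fun j _ =>
    integrable_indicator_mul_indicator hA x i j]
  refine Finset.sum_congr rfl fun i _ => ?_
  rw [integral_finsetSum _ fun j _ => integrable_indicator_mul_indicator hA x i j]
  refine Finset.sum_congr rfl fun j _ => ?_
  have : (fun y => (A i).indicator (fun _ => x i) y * (A j).indicator (fun _ => x j) y) =
      (A i ∩ A j).indicator fun _ => x i * x j := by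
    ext y
    by_cases h1 : y ∈ A i <;> by_cases h2 : y ∈ A j <;> simp [h1, h2]
  rw [this, integral_indicator_const _ ((hA i).inter (hA j)), smul_eq_mul, mul_comm]

theorem coe_slabVar (hA : ∀ i, MeasurableSet (A i)) (s t : ℝ≥0) (x : ι → ℝ) :
    (slabVar s t A x : ℝ≥0∞) = (t - s : ℝ≥0) *
      ∫⁻ y, ‖∑ i, (A i).indicator (fun _ => x i) y‖ₑ ^ 2 := by
  rw [slabVar, ENNReal.coe_mul]
  congr 1
  rw [← ENNReal.ofReal, ofReal_integral_eq_lintegral_ofReal _ (ae_of_all _ fun y => sq_nonneg _)]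
  · refine lintegral_congr fun y => ?_
    rw [← enorm_pow, Real.enorm_of_nonneg (sq_nonneg _)]
  · simp_rw [sq, Finset.sum_mul_sum]
    exact integrable_finsetSum _ fun i _ => integrable_finsetSum _ fun j _ =>
      integrable_indicator_mul_indicator hA x i j

theorem measurable_slabVar (hA : ∀ i, MeasurableSet (A i)) (s t : ℝ≥0) :
    Measurable (slabVar s t A) := by
  unfold slabVar
  simp_rw [integral_sum_indicator_sq hA]
  fun_prop

theorem map_sum_noise [IsProbabilityMeasure P] (hW : IsWhiteNoise 𝓕 P W)
    (hA : ∀ i, MeasurableSet (A i)) (s t : ℝ≥0) (x : ι → ℝ) :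
    P.map (fun ω => ∑ i, x i * W (Set.Ioc s t ×ˢ A i) ω) = gaussianReal 0 (slabVar s t A x) := by
  have hR : ∀ i, MeasurableSet (Set.Ioc s t ×ˢ A i) := fun i => measurableSet_Ioc.prod (hA i)
  have hf : ∀ i, spaceTimeMeasure (Set.Ioc s t ×ˢ A i) ≠ ∞ := fun i =>
    spaceTimeMeasure_Ioc_prod_ne_top s t (A i)
  have hG : HasGaussianLaw (fun ω => ∑ i, x i * W (Set.Ioc s t ×ˢ A i) ω) P :=
    ((hW.gaussian.comp_right fun i : ι => ⟨Set.Ioc s t ×ˢ A i, hR i, hf i⟩).smul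
      x).hasGaussianLaw_fun_sum (I := Finset.univ)
  rw [hG.map_eq_gaussianReal]
  have hmean : ∫ ω, ∑ i, x i * W (Set.Ioc s t ×ˢ A i) ω ∂P = 0 := by
    rw [integral_finsetSum _ fun i _ =>
      (((hW.memLp (hR i) (hf i)).integrable one_le_two).const_mul _)]
    refine Finset.sum_eq_zero fun i _ => ?_
    rw [integral_const_mul, hW.mean_zero _ (hR i) (hf i), mul_zero]
  rw [hmean]
  congr 1
  rw [variance_of_integral_eq_zero hG.aemeasurable hmean]
  have hij : ∀ i j, Integrable (fun ω => x i * W (Set.Ioc s t ×ˢ A i) ω *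
      (x j * W (Set.Ioc s t ×ˢ A j) ω)) P := fun i j => by
    refine ((hW.integrable_mul (hR i) (hf i) (hR j) (hf j)).const_mul (x i * x j)).congr
      (ae_of_all _ fun ω => ?_)
    dsimp only
    ring
  have hvar : ∫ ω, (∑ i, x i * W (Set.Ioc s t ×ˢ A i) ω) ^ 2 ∂P =
      (t - s : ℝ≥0) * ∫ y, (∑ i, (A i).indicator (fun _ => x i) y) ^ 2 := by
    rw [integral_sum_indicator_sq hA]
    simp_rw [sq, Finset.sum_mul_sum]
    rw [integral_finsetSum _ fun i _ => integrable_finsetSum _ fun j _ => hij i j, Finset.mul_sum]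
    refine Finset.sum_congr rfl fun i _ => ?_
    rw [integral_finsetSum _ fun j _ => hij i j, Finset.mul_sum]
    refine Finset.sum_congr rfl fun j _ => ?_
    have : ∀ ω, x i * W (Set.Ioc s t ×ˢ A i) ω * (x j * W (Set.Ioc s t ×ˢ A j) ω) =
        x i * x j * (W (Set.Ioc s t ×ˢ A i) ω * W (Set.Ioc s t ×ˢ A j) ω) := fun ω => by ring
    simp_rw [this]
    rw [integral_const_mul, hW.covariance _ _ (hR i) (hf i) (hR j) (hf j), Set.prod_inter_prod,
      Set.inter_self, spaceTimeMeasure_Ioc_prod, ENNReal.toReal_mul, ENNReal.coe_toReal]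
    simp only [Measure.real]
    ring
  rw [hvar, slabVar, Real.toNNReal_mul (NNReal.coe_nonneg _), Real.toNNReal_coe]

/-- Conditionally on `𝓕 s`, the increment of a stochastic integral is Gaussian. -/
theorem lintegral_slab [IsProbabilityMeasure P] (hW : IsWhiteNoise 𝓕 P W)
    (hA : ∀ i, MeasurableSet (A i)) {s t : ℝ≥0} {E : Type*} [MeasurableSpace E] {S : Ω → E}
    (hS : Measurable[𝓕 s] S) {X : ι → Ω → ℝ} (hX : ∀ i, Measurable[𝓕 s] (X i))
    {f : E × ℝ → ℝ≥0∞} (hf : Measurable f) :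
    ∫⁻ ω, f (S ω, ∑ i, X i ω * W (Set.Ioc s t ×ˢ A i) ω) ∂P =
      ∫⁻ ω, ∫⁻ z, f (S ω, z) ∂gaussianReal 0 (slabVar s t A fun i => X i ω) ∂P := by
  have hR : ∀ i, MeasurableSet (Set.Ioc s t ×ˢ A i) := fun i => measurableSet_Ioc.prod (hA i)
  have hfin : ∀ i, spaceTimeMeasure (Set.Ioc s t ×ˢ A i) ≠ ∞ := fun i =>
    spaceTimeMeasure_Ioc_prod_ne_top s t (A i)
  set G : Ω → ι → ℝ := fun ω i => W (Set.Ioc s t ×ˢ A i) ω with hGdef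
  have hGm : Measurable G := measurable_pi_lambda _ fun i => hW.measurable _ (hR i) (hfin i)
  have hXm : Measurable[𝓕 s] fun ω i => X i ω := @measurable_pi_lambda _ _ _ (𝓕 s) _ _ hX
  have hTm : Measurable[𝓕 s] fun ω => (S ω, fun i => X i ω) := hS.prodMk hXm
  have hTm' : Measurable fun ω => (S ω, fun i => X i ω) := hTm.mono (𝓕.le s) le_rfl
  -- The pair `(S, X)` is known at time `s`, while `G` is built from noise after `s`. The joint law
  -- is therefore a product, and the coefficients can be frozen in the Gaussian integral.
  have hind : IndepFun (fun ω => (S ω, fun i => X i ω)) G P := by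
    rw [IndepFun_iff_Indep]
    refine indep_of_indep_of_le (hW.indep s) hTm.comap_le ?_
    rw [← measurable_iff_comap_le]
    refine @measurable_pi_lambda _ _ _ (_) _ _ fun i => ?_
    rw [measurable_iff_comap_le]
    refine le_iSup₂_of_le (f := fun (B : Set (ℝ≥0 × Torus)) (_ : B ∈ {B : Set (ℝ≥0 × Torus) |
        MeasurableSet B ∧ spaceTimeMeasure B ≠ ∞ ∧ B ⊆ Set.Ioi s ×ˢ Set.univ}) =>
      MeasurableSpace.comap (W B) inferInstance) (Set.Ioc s t ×ˢ A i) ⟨hR i, hfin i, ?_⟩ le_rfl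
    exact Set.prod_mono Set.Ioc_subset_Ioi_self (Set.subset_univ _)
  have hmap := (indepFun_iff_map_prod_eq_prod_map_map hTm'.aemeasurable hGm.aemeasurable).1 hind
  set h : (E × (ι → ℝ)) × (ι → ℝ) → ℝ≥0∞ := fun q => f (q.1.1, ∑ i, q.1.2 i * q.2 i) with hh
  have hhm : Measurable h := by
    refine hf.comp ((measurable_fst.comp measurable_fst).prodMk ?_)
    fun_prop
  calc ∫⁻ ω, f (S ω, ∑ i, X i ω * W (Set.Ioc s t ×ˢ A i) ω) ∂P
      = ∫⁻ q, h q ∂P.map fun ω => ((S ω, fun i => X i ω), G ω) := by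
        rw [lintegral_map hhm (hTm'.prodMk hGm)]
    _ = ∫⁻ ω, ∫⁻ ω', h ((S ω, fun i => X i ω), G ω') ∂P ∂P := by
        rw [hmap, lintegral_prod _ hhm.aemeasurable, lintegral_map hhm.lintegral_prod_right' hTm']
        refine lintegral_congr fun ω => ?_
        exact lintegral_map (f := fun y => h ((S ω, fun i => X i ω), y))
          (hhm.comp measurable_prodMk_left) hGm
    _ = _ := by
        refine lintegral_congr fun ω => ?_
        have hWm := fun i => hW.measurable _ (hR i) (hfin i)
        rw [← map_sum_noise hW hA s t fun i => X i ω]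
        exact (lintegral_map (f := fun z => f (S ω, z)) (hf.comp measurable_prodMk_left)
          (Finset.measurable_sum _ fun i _ => (hWm i).const_mul _)).symm

end Slab

/-! ### Integrals of elementary fields -/

-- Induction along a finite time grid, with no grid point strictly inside a step. It is strong
-- induction on the number of grid points in `(0, t)`, stepping from the last of them.
@[elab_as_elim]
theorem induction_on_grid (F : Finset ℝ≥0) {Q : ℝ≥0 → Prop} (h0 : Q 0)
    (hstep : ∀ s t, s < t → (∀ x ∈ F, x ≤ s ∨ t ≤ x) → Q s → Q t) (t : ℝ≥0) : Q t := by
  classical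
  induction hk : (F.filter fun x => 0 < x ∧ x < t).card using Nat.strong_induction_on generalizing t
    with
  | _ k ih =>
  subst hk
  rcases eq_or_ne t 0 with rfl | ht
  · exact h0
  have ht0 : 0 < t := pos_iff_ne_zero.2 ht
  by_cases hne : (F.filter fun x => 0 < x ∧ x < t).Nonempty
  · set m := (F.filter fun x => 0 < x ∧ x < t).max' hne with hm
    have hmem := Finset.max'_mem _ hne
    rw [← hm, Finset.mem_filter] at hmem
    refine hstep m t hmem.2.2 (fun x hx => ?_) (ih _ ?_ m rfl)
    · by_contra! hc
      have : x ≤ m := Finset.le_max' _ x (Finset.mem_filter.2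
        ⟨hx, hmem.2.1.trans hc.1, hc.2⟩)
      exact absurd hc.1 (not_lt.2 this)
    · refine Finset.card_lt_card ⟨fun x hx => ?_, fun hsub => ?_⟩
      · rw [Finset.mem_filter] at hx ⊢
        exact ⟨hx.1, hx.2.1, hx.2.2.trans hmem.2.2⟩
      · have := hsub (Finset.mem_filter.2 hmem)
        rw [Finset.mem_filter] at this
        exact lt_irrefl _ this.2.2
  · refine hstep 0 t ht0 (fun x hx => ?_) h0
    by_contra! hc
    exact hne ⟨x, Finset.mem_filter.2 ⟨hx, hc⟩⟩

section Elementary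

variable {ι : Type*}

/-- The coefficients of the fields that are switched on during `(s, t]`. -/
def activeCoeff (e : ι → ElementaryField 𝓕) (s t : ℝ≥0) (i : ι) (ω : Ω) : ℝ :=
  if (e i).a ≤ s ∧ t ≤ (e i).b then (e i).X ω else 0

theorem measurable_activeCoeff (e : ι → ElementaryField 𝓕) (s t : ℝ≥0) (i : ι) :
    Measurable[𝓕 s] (activeCoeff e s t i) := by
  unfold activeCoeff
  split_ifs with h
  · exact (e i).measurable_X.mono (𝓕.mono h.1) le_rfl
  · exact measurable_const

variable [Fintype ι]

/-- The sum of finitely many elementary fields. -/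
def sumField (e : ι → ElementaryField 𝓕) (s : ℝ≥0) (y : Torus) (ω : Ω) : ℝ :=
  ∑ i, (e i).toFun s y ω

/-- The stochastic integral over `(0, t]` of a sum of elementary fields. -/
def partialInt (W : Set (ℝ≥0 × Torus) → Ω → ℝ) (e : ι → ElementaryField 𝓕) (t : ℝ≥0) (ω : Ω) : ℝ :=
  ∑ i, if (e i).a < t then (e i).X ω * W (Set.Ioc (e i).a (min (e i).b t) ×ˢ (e i).A) ω else 0

/-- The guard `a < t` in the definition is essential here: the coefficient `X` is `𝓕 a`-measurable,
hence known at time `t` only if `a ≤ t`. -/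
theorem measurable_partialInt (hW : IsWhiteNoise 𝓕 P W) (e : ι → ElementaryField 𝓕) (t : ℝ≥0) :
    Measurable[𝓕 t] (partialInt W e t) := by
  unfold partialInt
  refine @Finset.measurable_sum _ _ _ _ _ _ (𝓕 t) _ _ fun i _ => ?_
  split_ifs with h
  · refine ((e i).measurable_X.mono (𝓕.mono h.le) le_rfl).mul
      (hW.adapted t _ (measurableSet_Ioc.prod (e i).measurableSet_A) ?_)
    exact Set.prod_mono (fun r hr => hr.2.trans (min_le_right _ _)) (Set.subset_univ _)
  · exact measurable_const

theorem sumField_eq_of_mem_slab (e : ι → ElementaryField 𝓕) {s t r : ℝ≥0}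
    (hgrid : ∀ i, ((e i).a ≤ s ∨ t ≤ (e i).a) ∧ ((e i).b ≤ s ∨ t ≤ (e i).b))
    (hr : r ∈ Set.Ioc s t) (y : Torus) (ω : Ω) :
    sumField e r y ω = ∑ i, ((e i).A).indicator (fun _ => activeCoeff e s t i ω) y := by
  refine Finset.sum_congr rfl fun i _ => ?_
  have hiff : r ∈ Set.Ioc (e i).a (e i).b ↔ (e i).a ≤ s ∧ t ≤ (e i).b := by
    constructor
    · rintro ⟨h1, h2⟩
      refine ⟨(hgrid i).1.resolve_right fun h => ?_, (hgrid i).2.resolve_left fun h => ?_⟩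
      · exact absurd (h.trans_lt h1) (not_lt.2 hr.2)
      · exact absurd (h2.trans h) (not_le.2 hr.1)
    · rintro ⟨h1, h2⟩
      exact ⟨h1.trans_lt hr.1, hr.2.trans h2⟩
  unfold ElementaryField.toFun activeCoeff
  by_cases hy : y ∈ (e i).A <;> by_cases hc : (e i).a ≤ s ∧ t ≤ (e i).b <;>
    simp [Set.mem_prod, hiff, hy, hc]

theorem partialInt_step (hW : IsWhiteNoise 𝓕 P W) (e : ι → ElementaryField 𝓕) {s t : ℝ≥0}
    (hst : s < t) (hgrid : ∀ i, ((e i).a ≤ s ∨ t ≤ (e i).a) ∧ ((e i).b ≤ s ∨ t ≤ (e i).b)) :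
    partialInt W e t =ᵐ[P] fun ω => partialInt W e s ω +
      ∑ i, activeCoeff e s t i ω * W (Set.Ioc s t ×ˢ (e i).A) ω := by
  have hterm : ∀ i, ∀ᵐ ω ∂P,
      (if (e i).a < t then (e i).X ω * W (Set.Ioc (e i).a (min (e i).b t) ×ˢ (e i).A) ω else 0) =
      (if (e i).a < s then (e i).X ω * W (Set.Ioc (e i).a (min (e i).b s) ×ˢ (e i).A) ω else 0) +
        activeCoeff e s t i ω * W (Set.Ioc s t ×ˢ (e i).A) ω := by
    intro i
    rcases (hgrid i).1 with ha | ha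
    · rcases (hgrid i).2 with hb | hb
      · have hact : ¬((e i).a ≤ s ∧ t ≤ (e i).b) := fun h => absurd (h.2.trans hb) (not_le.2 hst)
        rcases eq_or_lt_of_le ha with has | has
        -- Here the field starts at `s` and has ended by `s`. The new summand involves `W ∅`, which
        -- vanishes only almost surely.
        · have hemp : Set.Ioc (e i).a (min (e i).b t) ×ˢ (e i).A = ∅ := by
            rw [Set.Ioc_eq_empty (not_lt.2 ((min_le_left _ _).trans (hb.trans has.ge))),
              Set.empty_prod]
          filter_upwards [hW.empty_ae] with ω hω
          rw [hemp, hω]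
          simp only [activeCoeff, if_neg hact]
          simp [has]
        · refine ae_of_all _ fun ω => ?_
          rw [min_eq_left hb, min_eq_left (hb.trans hst.le)]
          simp only [activeCoeff, if_neg hact]
          simp [has, has.trans hst]
      · have hact : (e i).a ≤ s ∧ t ≤ (e i).b := ⟨ha, hb⟩
        rcases eq_or_lt_of_le ha with has | has
        · refine ae_of_all _ fun ω => ?_
          rw [min_eq_right hb]
          simp [activeCoeff, hb, has, hst]
        · have hun : Set.Ioc (e i).a t ×ˢ (e i).A =
              (Set.Ioc (e i).a s ×ˢ (e i).A) ∪ (Set.Ioc s t ×ˢ (e i).A) := by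
            rw [← Set.union_prod, Set.Ioc_union_Ioc_eq_Ioc ha hst.le]
          have hd : Disjoint (Set.Ioc (e i).a s ×ˢ (e i).A) (Set.Ioc s t ×ˢ (e i).A) :=
            Set.Disjoint.set_prod_left (Set.Ioc_disjoint_Ioc_of_le le_rfl) _ _
          filter_upwards [hW.union_ae (measurableSet_Ioc.prod (e i).measurableSet_A)
            (spaceTimeMeasure_Ioc_prod_ne_top _ _ _)
            (measurableSet_Ioc.prod (e i).measurableSet_A)
            (spaceTimeMeasure_Ioc_prod_ne_top _ _ _) hd] with ω hω
          rw [min_eq_right hb, min_eq_right (hst.le.trans hb), hun, hω]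
          simp [activeCoeff, hact, has, has.trans hst, mul_add]
    · have h1 : ¬(e i).a < t := not_lt.2 ha
      have h2 : ¬(e i).a < s := fun h => h1 (h.trans hst)
      have h3 : ¬((e i).a ≤ s ∧ t ≤ (e i).b) := fun h => h1 (h.1.trans_lt hst)
      refine ae_of_all _ fun ω => ?_
      simp [h1, h2, activeCoeff, h3]
  filter_upwards [ae_all_iff.2 hterm] with ω hω
  unfold partialInt
  rw [← Finset.sum_add_distrib]
  exact Finset.sum_congr rfl fun i _ => hω i

theorem partialInt_eq_integral (e : ι → ElementaryField 𝓕) {T : ℝ≥0}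
    (hT : ∀ i, (e i).a < T ∧ (e i).b ≤ T) (ω : Ω) :
    partialInt W e T ω = ∑ i, (e i).integral W ω := by
  refine Finset.sum_congr rfl fun i _ => ?_
  rw [if_pos (hT i).1, min_eq_left (hT i).2]
  rfl

theorem exists_time_bound (e : ι → ElementaryField 𝓕) :
    ∃ T : ℝ≥0, ∀ i, (e i).a < T ∧ (e i).b ≤ T := by
  refine ⟨∑ i, ((e i).a + (e i).b) + 1, fun i => ?_⟩
  have h := Finset.single_le_sum (f := fun i => (e i).a + (e i).b) (fun _ _ => zero_le)
    (Finset.mem_univ i)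
  refine ⟨lt_of_le_of_lt (le_self_add.trans h) (lt_add_one _),
    (le_add_self.trans h).trans le_self_add⟩

/-- The endpoints of a finite family of elementary fields. -/
theorem exists_endpoints (e : ι → ElementaryField 𝓕) :
    ∃ F : Finset ℝ≥0, ∀ i, (e i).a ∈ F ∧ (e i).b ∈ F := by
  classical
  refine ⟨Finset.univ.image (fun i => (e i).a) ∪ Finset.univ.image (fun i => (e i).b), fun i => ?_⟩
  constructor
  · exact Finset.mem_union_left _ (Finset.mem_image_of_mem _ (Finset.mem_univ i))
  · exact Finset.mem_union_right _ (Finset.mem_image_of_mem _ (Finset.mem_univ i))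

theorem lintegral_slab_const {s t : ℝ≥0} {g : ℝ≥0 → ℝ≥0∞} {c : ℝ≥0∞}
    (hg : ∀ r ∈ Set.Ioc s t, g r = c) :
    ∫⁻ r in Set.Ioc s t, g r ∂timeMeasure = (t - s : ℝ≥0) * c := by
  rw [setLIntegral_congr_fun measurableSet_Ioc hg, setLIntegral_const, timeMeasure_Ioc, mul_comm]

theorem lintegral_Ioc_add {s t : ℝ≥0} (hst : s ≤ t) (g : ℝ≥0 → ℝ≥0∞) :
    ∫⁻ r in Set.Ioc 0 t, g r ∂timeMeasure =
      ∫⁻ r in Set.Ioc 0 s, g r ∂timeMeasure + ∫⁻ r in Set.Ioc s t, g r ∂timeMeasure := by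
  rw [← Set.Ioc_union_Ioc_eq_Ioc zero_le hst,
    lintegral_union measurableSet_Ioc (Set.Ioc_disjoint_Ioc_of_le le_rfl)]

/-- Moment bound for elementary integrals. -/
theorem mom_sum_integral_le [IsProbabilityMeasure P] (hW : IsWhiteNoise 𝓕 P W)
    (e : ι → ElementaryField 𝓕) {n : ℕ} (hn : n ≠ 0) :
    mom P n (fun ω => ∑ i, (e i).integral W ω) ≤
      6 * n * ∫⁻ s, (∫⁻ y, mom P n (sumField e s y)) ∂timeMeasure := by
  obtain ⟨T, hT⟩ := exists_time_bound e
  obtain ⟨F, hF⟩ := exists_endpoints e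
  have key : ∀ t, mom P n (partialInt W e t) ≤
      6 * n * ∫⁻ s in Set.Ioc 0 t, (∫⁻ y, mom P n (sumField e s y)) ∂timeMeasure := by
    intro t
    induction t using induction_on_grid F with
    | h0 =>
      have : partialInt W e 0 = fun _ => 0 := by
        ext ω; simp [partialInt]
      rw [this, mom_zero hn]
      exact zero_le
    | hstep s t hst hgrid ih =>
      have hgrid' : ∀ i, ((e i).a ≤ s ∨ t ≤ (e i).a) ∧ ((e i).b ≤ s ∨ t ≤ (e i).b) := fun i =>
        ⟨hgrid _ (hF i).1, hgrid _ (hF i).2⟩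
      have hA : ∀ i, MeasurableSet (e i).A := fun i => (e i).measurableSet_A
      set c : ι → Ω → ℝ := activeCoeff e s t with hc
      have hcm : ∀ i, Measurable (c i) := fun i =>
        (measurable_activeCoeff e s t i).mono (𝓕.le s) le_rfl
      have hMm := (measurable_partialInt hW e s).mono (𝓕.le s) le_rfl
      set v : Ω → ℝ≥0 := fun ω => slabVar s t (fun i => (e i).A) fun i => c i ω with hv
      have hvm : Measurable v := (measurable_slabVar hA s t).comp (measurable_pi_lambda _ hcm)
      -- Given `𝓕 s`, the increment is Gaussian with variance `v`, so the shifted Gaussian moment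
      -- bound applies with `m = partialInt W e s ω`. After taking `1/n`-th powers the triangle
      -- inequality in `Lⁿ` makes the bound additive over slabs, so the constant `6n` does not
      -- accumulate.
      have h1 : ∫⁻ ω, ‖partialInt W e t ω‖ₑ ^ (2 * n) ∂P ≤
          ∫⁻ ω, (‖partialInt W e s ω‖ₑ ^ 2 + 6 * n * v ω) ^ n ∂P := by
        calc ∫⁻ ω, ‖partialInt W e t ω‖ₑ ^ (2 * n) ∂P
            = ∫⁻ ω, ‖partialInt W e s ω + ∑ i, c i ω * W (Set.Ioc s t ×ˢ (e i).A) ω‖ₑ ^ (2 * n)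
                ∂P := by
              refine lintegral_congr_ae ?_
              filter_upwards [partialInt_step hW e hst hgrid'] with ω hω
              rw [hω]
          _ = ∫⁻ ω, ∫⁻ z, ‖partialInt W e s ω + z‖ₑ ^ (2 * n) ∂gaussianReal 0 (v ω) ∂P :=
              lintegral_slab hW hA (f := fun q : ℝ × ℝ => ‖q.1 + q.2‖ₑ ^ (2 * n))
                (measurable_partialInt hW e s) (measurable_activeCoeff e s t) (by fun_prop)
          _ ≤ _ := lintegral_mono fun ω => lintegral_add_pow_gaussianReal_le _ _ _
      have h2 : mom P n (partialInt W e t) ≤ mom P n (partialInt W e s) +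
          6 * n * (∫⁻ ω, (v ω : ℝ≥0∞) ^ n ∂P) ^ (1 / (n : ℝ)) := by
        refine (ENNReal.rpow_le_rpow h1 (by positivity)).trans ?_
        refine (lintegral_pow_rpow_add_le hn (hMm.enorm.pow_const 2).aemeasurable
          (hvm.coe_nnreal_ennreal.const_mul _).aemeasurable).trans_eq ?_
        rw [lintegral_const_mul_pow_rpow hn (ENNReal.mul_ne_top (by simp) (by simp))]
        unfold mom
        simp_rw [pow_mul]
      have hφm : Measurable (Function.uncurry fun (y : Torus) ω =>
          ∑ i, ((e i).A).indicator (fun _ => c i ω) y) := by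
        refine Finset.measurable_sum _ fun i _ => ?_
        have : (Function.uncurry fun (y : Torus) ω => ((e i).A).indicator (fun _ => c i ω) y) =
            (Prod.fst ⁻¹' (e i).A).indicator fun p => c i p.2 := by
          ext p; rfl
        change Measurable (Function.uncurry fun (y : Torus) ω =>
          ((e i).A).indicator (fun _ => c i ω) y)
        rw [this]
        exact ((hcm i).comp measurable_snd).indicator (measurable_fst (hA i))
      have h3 : (∫⁻ ω, (v ω : ℝ≥0∞) ^ n ∂P) ^ (1 / (n : ℝ)) ≤
          ∫⁻ r in Set.Ioc s t, (∫⁻ y, mom P n (sumField e r y)) ∂timeMeasure := by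
        have hcoe : ∀ ω, (v ω : ℝ≥0∞) = (t - s : ℝ≥0) *
            ∫⁻ y, ‖∑ i, ((e i).A).indicator (fun _ => c i ω) y‖ₑ ^ 2 := fun ω =>
          coe_slabVar hA s t _
        simp_rw [hcoe]
        rw [lintegral_const_mul_pow_rpow hn ENNReal.coe_ne_top, lintegral_slab_const
          (c := ∫⁻ y, mom P n fun ω => ∑ i, ((e i).A).indicator (fun _ => c i ω) y)]
        · gcongr
          exact lintegral_lintegral_sq_pow_le hn hφm
        · intro r hr
          refine lintegral_congr fun y => ?_
          congr 1
          ext ω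
          exact sumField_eq_of_mem_slab e hgrid' hr y ω
      rw [lintegral_Ioc_add hst.le, mul_add]
      refine h2.trans ?_
      gcongr
  have hfun : (fun ω => ∑ i, (e i).integral W ω) = partialInt W e T := by
    ext ω; rw [partialInt_eq_integral e hT]
  rw [hfun]
  refine (key T).trans ?_
  gcongr
  exact Measure.restrict_le_self

/-- Exponential supermartingale bound for elementary integrals. -/
theorem lintegral_exp_sum_integral_le [IsProbabilityMeasure P] (hW : IsWhiteNoise 𝓕 P W)
    (e : ι → ElementaryField 𝓕) (c : ℝ) :
    ∃ V : Ω → ℝ≥0, Measurable V ∧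
      (∀ ω, (V ω : ℝ≥0∞) ≤ ∫⁻ s, (∫⁻ y, ‖sumField e s y ω‖ₑ ^ 2) ∂timeMeasure) ∧
      ∫⁻ ω, ENNReal.ofReal (Real.exp (c * ∑ i, (e i).integral W ω - c ^ 2 * V ω / 2)) ∂P ≤ 1 := by
  obtain ⟨T, hT⟩ := exists_time_bound e
  obtain ⟨F, hF⟩ := exists_endpoints e
  have key : ∀ t, ∃ V : Ω → ℝ≥0, Measurable[𝓕 t] V ∧
      (∀ ω, (V ω : ℝ≥0∞) = ∫⁻ s in Set.Ioc 0 t, (∫⁻ y, ‖sumField e s y ω‖ₑ ^ 2) ∂timeMeasure) ∧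
      ∫⁻ ω, ENNReal.ofReal (Real.exp (c * partialInt W e t ω - c ^ 2 * V ω / 2)) ∂P ≤ 1 := by
    intro t
    induction t using induction_on_grid F with
    | h0 =>
      refine ⟨fun _ => 0, measurable_const, fun ω => by simp, ?_⟩
      simp [partialInt]
    | hstep s t hst hgrid ih =>
      obtain ⟨V, hVm, hV, hE⟩ := ih
      have hgrid' : ∀ i, ((e i).a ≤ s ∨ t ≤ (e i).a) ∧ ((e i).b ≤ s ∨ t ≤ (e i).b) := fun i =>
        ⟨hgrid _ (hF i).1, hgrid _ (hF i).2⟩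
      have hA : ∀ i, MeasurableSet (e i).A := fun i => (e i).measurableSet_A
      set x : ι → Ω → ℝ := activeCoeff e s t with hx
      have hxm := measurable_activeCoeff e s t
      set v : Ω → ℝ≥0 := fun ω => slabVar s t (fun i => (e i).A) fun i => x i ω with hv
      have hvm : Measurable[𝓕 s] v :=
        (measurable_slabVar hA s t).comp (@measurable_pi_lambda _ _ _ (𝓕 s) _ _ hxm)
      have hVv : Measurable[𝓕 s] fun ω => V ω + v ω := hVm.add hvm
      refine ⟨fun ω => V ω + v ω, hVv.mono (𝓕.mono hst.le) le_rfl, fun ω => ?_, ?_⟩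
      · rw [ENNReal.coe_add, lintegral_Ioc_add hst.le, hV, lintegral_slab_const (s := s) (t := t)
          (c := ∫⁻ y, ‖∑ i, ((e i).A).indicator (fun _ => x i ω) y‖ₑ ^ 2)]
        · rw [← coe_slabVar hA]
        · intro r hr
          refine lintegral_congr fun y => ?_
          rw [sumField_eq_of_mem_slab e hgrid' hr y ω]
      · calc ∫⁻ ω, ENNReal.ofReal
              (Real.exp (c * partialInt W e t ω - c ^ 2 * ((V ω + v ω : ℝ≥0) : ℝ) / 2)) ∂P
            = ∫⁻ ω, ENNReal.ofReal (Real.exp (c * (partialInt W e s ω +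
                ∑ i, x i ω * W (Set.Ioc s t ×ˢ (e i).A) ω) -
                c ^ 2 * ((V ω + v ω : ℝ≥0) : ℝ) / 2)) ∂P := by
              refine lintegral_congr_ae ?_
              filter_upwards [partialInt_step hW e hst hgrid'] with ω hω
              rw [hω]
          _ = ∫⁻ ω, ∫⁻ z, ENNReal.ofReal (Real.exp (c * (partialInt W e s ω + z) -
                c ^ 2 * ((V ω + v ω : ℝ≥0) : ℝ) / 2)) ∂gaussianReal 0 (v ω) ∂P :=
              lintegral_slab hW hA (S := fun ω => (partialInt W e s ω, V ω + v ω))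
                (f := fun q : (ℝ × ℝ≥0) × ℝ => ENNReal.ofReal (Real.exp
                  (c * (q.1.1 + q.2) - c ^ 2 * (q.1.2 : ℝ) / 2)))
                ((measurable_partialInt hW e s).prodMk hVv) hxm (by fun_prop)
          -- The Gaussian exponential moment `exp(c² v / 2)` cancels the increment of the
          -- compensator exactly.
          _ = ∫⁻ ω, ENNReal.ofReal (Real.exp (c * partialInt W e s ω - c ^ 2 * V ω / 2)) ∂P := by
              refine lintegral_congr fun ω => ?_
              have : ∀ z : ℝ, ENNReal.ofReal (Real.exp (c * (partialInt W e s ω + z) -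
                  c ^ 2 * ((V ω + v ω : ℝ≥0) : ℝ) / 2)) =
                  ENNReal.ofReal (Real.exp (c * partialInt W e s ω -
                    c ^ 2 * ((V ω + v ω : ℝ≥0) : ℝ) / 2)) * ENNReal.ofReal (Real.exp (c * z)) := by
                intro z
                rw [← ENNReal.ofReal_mul (Real.exp_pos _).le, ← Real.exp_add]
                congr 2; ring
              simp_rw [this]
              rw [lintegral_const_mul' _ _ ENNReal.ofReal_ne_top, lintegral_exp_gaussianReal,
                ← ENNReal.ofReal_mul (Real.exp_pos _).le, ← Real.exp_add]
              congr 2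
              push_cast
              ring
          _ ≤ 1 := hE
  obtain ⟨V, hVm, hV, hE⟩ := key T
  refine ⟨V, hVm.mono (𝓕.le T) le_rfl, fun ω => ?_, ?_⟩
  · rw [hV]
    exact lintegral_mono' Measure.restrict_le_self le_rfl
  · simp_rw [← partialInt_eq_integral e hT]
    exact hE

end Elementary

end

section

variable {Ω : Type*} {mΩ : MeasurableSpace Ω} {P : Measure Ω}
variable {𝓕 : Filtration ℝ≥0 mΩ} {W : Set (ℝ≥0 × Torus) → Ω → ℝ}

/-! ### Moments of random fields integrated over space-time -/

/-- Joint measurability of a random field. -/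
def JointlyMeasurable {Ω : Type*} [MeasurableSpace Ω] (Φ : ℝ≥0 → Torus → Ω → ℝ) : Prop :=
  Measurable fun p : (ℝ≥0 × Torus) × Ω => Φ p.1.1 p.1.2 p.2

/-- `∫∫ ‖Φ(s, y)‖²_{L^{2n}(P)} ds dy`. -/
def mix (P : Measure Ω) (n : ℕ) (Φ : ℝ≥0 → Torus → Ω → ℝ) : ℝ≥0∞ :=
  ∫⁻ q, mom P n (Φ q.1 q.2) ∂spaceTimeMeasure

theorem predictable_le_prod : 𝓕.predictable ≤ Prod.instMeasurableSpace := by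
  refine MeasurableSpace.generateFrom_le ?_
  rintro s (⟨A, hA, rfl⟩ | ⟨i, A, hA, rfl⟩)
  · exact (measurableSet_singleton _).prod (𝓕.le _ _ hA)
  · exact measurableSet_Ioi.prod (𝓕.le _ _ hA)

theorem IsPredictableField.measurable {Φ : ℝ≥0 → Torus → Ω → ℝ} (h : IsPredictableField 𝓕 Φ) :
    Measurable fun p : (ℝ≥0 × Ω) × Torus => Φ p.1.1 p.2 p.1.2 :=
  Measurable.mono h (sup_le_sup_right (MeasurableSpace.comap_mono predictable_le_prod) _) le_rfl

theorem IsPredictableField.jointlyMeasurable {Φ : ℝ≥0 → Torus → Ω → ℝ}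
    (h : IsPredictableField 𝓕 Φ) : JointlyMeasurable Φ :=
  h.measurable.comp
    ((measurable_fst.fst.prodMk measurable_snd).prodMk measurable_fst.snd)

theorem JointlyMeasurable.measurable_mom [SFinite P] {Φ : ℝ≥0 → Torus → Ω → ℝ}
    (h : JointlyMeasurable Φ) (n : ℕ) :
    Measurable fun q : ℝ≥0 × Torus => mom P n (Φ q.1 q.2) :=
  SHE.measurable_mom (f := fun (q : ℝ≥0 × Torus) ω => Φ q.1 q.2 ω) h

theorem JointlyMeasurable.section {Φ : ℝ≥0 → Torus → Ω → ℝ}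
    (h : JointlyMeasurable Φ) (s : ℝ≥0) (y : Torus) : Measurable (Φ s y) :=
  Measurable.comp (f := fun ω => ((s, y), ω)) h (measurable_const.prodMk measurable_id)

theorem mix_eq [SFinite P] {Φ : ℝ≥0 → Torus → Ω → ℝ} (h : JointlyMeasurable Φ) (n : ℕ) :
    mix P n Φ = ∫⁻ s, (∫⁻ y, mom P n (Φ s y)) ∂timeMeasure :=
  lintegral_prod _ (h.measurable_mom n).aemeasurable

theorem eLpNorm_two_sq {α : Type*} [MeasurableSpace α] {μ : Measure α} (f : α → ℝ) :
    eLpNorm f 2 μ ^ 2 = ∫⁻ x, ‖f x‖ₑ ^ 2 ∂μ := by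
  rw [← mom_one, mom_eq_eLpNorm one_ne_zero]
  norm_num

theorem mix_one [SFinite P] {Φ : ℝ≥0 → Torus → Ω → ℝ} (h : JointlyMeasurable Φ) :
    mix P 1 Φ = eLpNorm (fun p : (ℝ≥0 × Ω) × Torus => Φ p.1.1 p.2 p.1.2) 2
      ((timeMeasure.prod P).prod volume) ^ 2 := by
  rw [eLpNorm_two_sq, mix_eq h]
  have h1 : Measurable fun p : (ℝ≥0 × Ω) × Torus => ‖Φ p.1.1 p.2 p.1.2‖ₑ ^ 2 := by
    refine Measurable.pow_const (Measurable.enorm ?_) 2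
    exact h.comp ((measurable_fst.fst.prodMk measurable_snd).prodMk measurable_fst.snd)
  rw [lintegral_prod _ h1.aemeasurable,
    lintegral_prod _ h1.lintegral_prod_right'.aemeasurable]
  refine lintegral_congr fun s => ?_
  simp_rw [mom_one]
  refine lintegral_lintegral_swap (f := fun y ω => ‖Φ s y ω‖ₑ ^ 2) ?_
  refine (Measurable.pow_const (Measurable.enorm ?_) 2).aemeasurable
  exact h.comp ((measurable_const.prodMk measurable_fst).prodMk measurable_snd)

theorem mix_add_le {n : ℕ} (hn : n ≠ 0) [SFinite P] {Φ Ψ : ℝ≥0 → Torus → Ω → ℝ}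
    (hΦ : JointlyMeasurable Φ) (hΨ : JointlyMeasurable Ψ) :
    mix P n (fun s y ω => Φ s y ω + Ψ s y ω) ≤ 2 * mix P n Φ + 2 * mix P n Ψ := by
  unfold mix
  rw [← lintegral_const_mul _ (hΦ.measurable_mom n), ← lintegral_const_mul _ (hΨ.measurable_mom n),
    ← lintegral_add_left ((hΦ.measurable_mom n).const_mul _)]
  exact lintegral_mono fun q =>
    mom_add_le hn (hΦ.section _ _).aemeasurable (hΨ.section _ _).aemeasurable

theorem mix_const_mul {n : ℕ} (hn : n ≠ 0) (c : ℝ) (Φ : ℝ≥0 → Torus → Ω → ℝ) :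
    mix P n (fun s y ω => c * Φ s y ω) = ‖c‖ₑ ^ 2 * mix P n Φ := by
  unfold mix
  rw [← lintegral_const_mul' _ _ (by finiteness)]
  exact lintegral_congr fun q => mom_const_mul hn c _

theorem mix_one_le [IsProbabilityMeasure P] {n : ℕ} (hn : n ≠ 0) {Φ : ℝ≥0 → Torus → Ω → ℝ}
    (h : JointlyMeasurable Φ) : mix P 1 Φ ≤ mix P n Φ :=
  lintegral_mono fun _ => mom_one_le hn (h.section _ _).aemeasurable

/-- Dominated convergence for `mix`. -/
theorem tendsto_mix_of_dominated [SFinite P] {n : ℕ} (hn : n ≠ 0)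
    {Φ : ℕ → ℝ≥0 → Torus → Ω → ℝ} {Ψ : ℝ≥0 → Torus → Ω → ℝ}
    (hΦ : ∀ k, JointlyMeasurable (Φ k)) (hΨ : JointlyMeasurable Ψ)
    (hle : ∀ k s y ω, |Φ k s y ω| ≤ |Ψ s y ω|) (hfin : mix P n Ψ ≠ ∞)
    (hlim : ∀ s y ω, Tendsto (fun k => Φ k s y ω) atTop (𝓝 0)) :
    Tendsto (fun k => mix P n (Φ k)) atTop (𝓝 0) := by
  have hle' : ∀ k s y ω, ‖Φ k s y ω‖ₑ ≤ ‖Ψ s y ω‖ₑ := fun k s y ω => by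
    rw [← ofReal_norm, ← ofReal_norm]
    exact ENNReal.ofReal_le_ofReal (hle _ _ _ _)
  have h0 : ∫⁻ _ : ℝ≥0 × Torus, (0 : ℝ≥0∞) ∂spaceTimeMeasure = 0 := lintegral_zero
  rw [← h0]
  refine tendsto_lintegral_of_dominated_convergence (fun q => mom P n (Ψ q.1 q.2))
    (fun k => (hΦ k).measurable_mom n) (fun k => ae_of_all _ fun q =>
      mom_mono_ae (ae_of_all _ fun ω => hle' _ _ _ _)) hfin ?_
  have hfin' : ∀ᵐ q ∂spaceTimeMeasure, mom P n (Ψ q.1 q.2) < ∞ :=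
    ae_lt_top (hΨ.measurable_mom n) hfin
  filter_upwards [hfin'] with q hq
  have hn' : (0 : ℝ) < 1 / n := by positivity
  have : (0 : ℝ≥0∞) = (∫⁻ _ : Ω, (0 : ℝ≥0∞) ∂P) ^ (1 / (n : ℝ)) := by
    rw [lintegral_zero, ENNReal.zero_rpow_of_pos hn']
  rw [this]
  refine (ENNReal.continuous_rpow_const.tendsto _).comp ?_
  refine tendsto_lintegral_of_dominated_convergence (fun ω => ‖Ψ q.1 q.2 ω‖ₑ ^ (2 * n))
    (fun k => (((hΦ k).section _ _).enorm.pow_const _)) (fun k => ae_of_all _ fun ω =>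
      pow_le_pow_left' (hle' _ _ _ _) _) ?_ (ae_of_all _ fun ω => ?_)
  · rw [← mom_pow hn]
    exact (ENNReal.pow_lt_top hq).ne
  · have h2 : Tendsto (fun k => ‖Φ k q.1 q.2 ω‖ₑ) atTop (𝓝 0) := by
      have := (hlim q.1 q.2 ω).enorm
      simpa using this
    have h3 := (ENNReal.continuous_pow (2 * n)).tendsto 0 |>.comp h2
    simpa [hn, Function.comp_def] using h3

/-! ### Lists of elementary fields -/

/-- The sum of a list of elementary fields. -/
def listField (L : List (ElementaryField 𝓕)) (s : ℝ≥0) (y : Torus) (ω : Ω) : ℝ :=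
  (L.map fun e => e.toFun s y ω).sum

/-- The stochastic integral of a sum of elementary fields. -/
def listInt (W : Set (ℝ≥0 × Torus) → Ω → ℝ) (L : List (ElementaryField 𝓕)) (ω : Ω) : ℝ :=
  (L.map fun e => e.integral W ω).sum

theorem listField_eq_sumField (L : List (ElementaryField 𝓕)) :
    listField L = sumField (fun i : Fin L.length => L[i]) := by
  ext s y ω
  simp only [listField, sumField]
  exact (Fin.sum_univ_fun_getElem L fun e => e.toFun s y ω).symm

theorem listInt_eq_sum (L : List (ElementaryField 𝓕)) :
    listInt W L = fun ω => ∑ i : Fin L.length, (L[i]).integral W ω := by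
  ext ω
  exact (Fin.sum_univ_fun_getElem L fun e => e.integral W ω).symm

theorem listField_append (L M : List (ElementaryField 𝓕)) (s : ℝ≥0) (y : Torus) (ω : Ω) :
    listField (L ++ M) s y ω = listField L s y ω + listField M s y ω := by
  simp [listField]

theorem listInt_append (L M : List (ElementaryField 𝓕)) (ω : Ω) :
    listInt W (L ++ M) ω = listInt W L ω + listInt W M ω := by
  simp [listInt]

/-- A scalar multiple of an elementary field. -/
def ElementaryField.smul (c : ℝ) (e : ElementaryField 𝓕) : ElementaryField 𝓕 where
  a := e.a
  b := e.b
  A := e.A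
  X ω := c * e.X ω
  measurableSet_A := e.measurableSet_A
  measurable_X := e.measurable_X.const_mul c
  bounded_X := by
    obtain ⟨C, hC⟩ := e.bounded_X
    refine ⟨|c| * C, fun ω => ?_⟩
    rw [abs_mul]
    exact mul_le_mul_of_nonneg_left (hC ω) (abs_nonneg c)

theorem listField_map_smul (c : ℝ) (L : List (ElementaryField 𝓕)) (s : ℝ≥0) (y : Torus) (ω : Ω) :
    listField (L.map (ElementaryField.smul c)) s y ω = c * listField L s y ω := by
  simp only [listField, List.map_map]
  rw [← List.sum_map_mul_left]
  congr 1
  refine List.map_congr_left fun e _ => ?_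
  change (Set.Ioc e.a e.b ×ˢ e.A).indicator (fun _ => c * e.X ω) (s, y) =
    c * (Set.Ioc e.a e.b ×ˢ e.A).indicator (fun _ => e.X ω) (s, y)
  rw [Set.indicator_const_mul]

theorem listInt_map_smul (c : ℝ) (L : List (ElementaryField 𝓕)) (ω : Ω) :
    listInt W (L.map (ElementaryField.smul c)) ω = c * listInt W L ω := by
  simp only [listInt, List.map_map]
  rw [← List.sum_map_mul_left]
  congr 1
  refine List.map_congr_left fun e _ => ?_
  simp only [Function.comp, ElementaryField.integral, ElementaryField.smul, mul_assoc]

theorem ElementaryField.jointlyMeasurable_toFun (e : ElementaryField 𝓕) :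
    JointlyMeasurable e.toFun := by
  have : (fun p : (ℝ≥0 × Torus) × Ω => e.toFun p.1.1 p.1.2 p.2) =
      (Prod.fst ⁻¹' (Set.Ioc e.a e.b ×ˢ e.A)).indicator fun p => e.X p.2 := by
    ext p; rfl
  unfold JointlyMeasurable
  rw [this]
  exact ((e.measurable_X.mono (𝓕.le _) le_rfl).comp measurable_snd).indicator
    (measurable_fst (measurableSet_Ioc.prod e.measurableSet_A))

theorem jointlyMeasurable_listField (L : List (ElementaryField 𝓕)) :
    JointlyMeasurable (listField L) := by
  induction L with
  | nil => exact measurable_const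
  | cons e L ih => exact e.jointlyMeasurable_toFun.add ih

theorem measurable_listInt (hW : IsWhiteNoise 𝓕 P W) (L : List (ElementaryField 𝓕)) :
    Measurable (listInt W L) := by
  induction L with
  | nil => exact measurable_const
  | cons e L ih =>
    refine Measurable.add (Measurable.mul (e.measurable_X.mono (𝓕.le _) le_rfl)
      (hW.measurable _ (measurableSet_Ioc.prod e.measurableSet_A)
        (spaceTimeMeasure_Ioc_prod_ne_top _ _ _))) ih

theorem mom_listInt_le [IsProbabilityMeasure P] (hW : IsWhiteNoise 𝓕 P W)
    (L : List (ElementaryField 𝓕)) {n : ℕ} (hn : n ≠ 0) :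
    mom P n (listInt W L) ≤ 6 * n * mix P n (listField L) := by
  rw [mix_eq (jointlyMeasurable_listField L), listInt_eq_sum, listField_eq_sumField]
  exact mom_sum_integral_le hW _ hn

theorem lintegral_rotate {α β γ : Type*} [MeasurableSpace α] [MeasurableSpace β]
    [MeasurableSpace γ] {μ : Measure α} {ν : Measure β} {ρ : Measure γ} [SFinite μ] [SFinite ν]
    [SFinite ρ] {f : α → β → γ → ℝ≥0∞} (hf : Measurable fun p : (α × β) × γ => f p.1.1 p.1.2 p.2) :
    ∫⁻ c, ∫⁻ a, ∫⁻ b, f a b c ∂ν ∂μ ∂ρ = ∫⁻ a, ∫⁻ b, ∫⁻ c, f a b c ∂ρ ∂ν ∂μ := by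
  have h1 : Measurable fun p : (γ × α) × β => f p.1.2 p.2 p.1.1 :=
    hf.comp ((measurable_fst.snd.prodMk measurable_snd).prodMk measurable_fst.fst)
  rw [lintegral_lintegral_swap
    (h1.lintegral_prod_right' (ν := ν)).aemeasurable]
  refine lintegral_congr fun a => lintegral_lintegral_swap ?_
  exact Measurable.aemeasurable
    (hf.comp ((measurable_const.prodMk measurable_snd).prodMk measurable_fst))

/-- Only the energy carried by `G` enters, although the integral is formed without restriction to
`G`. If `c² V ≥ 1`, Markov's inequality for `V` on `G` gives the first term. If `c² V < 1`, the
compensator costs less than a factor `e`, and Markov's inequality for the exponential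
supermartingale gives the second. -/
theorem measure_le_listInt [IsProbabilityMeasure P] (hW : IsWhiteNoise 𝓕 P W)
    (L : List (ElementaryField 𝓕)) {G : Set Ω} (hG : MeasurableSet G) {c ε : ℝ} (hc : 0 ≤ c) :
    P (G ∩ {ω | ε ≤ listInt W L ω}) ≤
      ENNReal.ofReal (c ^ 2) * (∫⁻ s, (∫⁻ y, (∫⁻ ω in G, ‖listField L s y ω‖ₑ ^ 2 ∂P)) ∂timeMeasure) +
        ENNReal.ofReal (Real.exp (1 - c * ε)) := by
  obtain ⟨V, hVm, hV, hE⟩ := lintegral_exp_sum_integral_le hW (fun i : Fin L.length => L[i]) c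
  rw [← listField_eq_sumField] at hV
  have hint : ∀ ω, ∑ i : Fin L.length, (L[i]).integral W ω = listInt W L ω := fun ω => by
    rw [listInt_eq_sum]
  simp_rw [hint] at hE
  have hcm : Measurable fun ω => ENNReal.ofReal (c ^ 2) * (V ω : ℝ≥0∞) :=
    (hVm.coe_nnreal_ennreal).const_mul _
  have hsub : G ∩ {ω | ε ≤ listInt W L ω} ⊆
      (G ∩ {ω | 1 ≤ ENNReal.ofReal (c ^ 2) * (V ω : ℝ≥0∞)}) ∪
      {ω | ENNReal.ofReal (Real.exp (c * ε - 1)) ≤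
        ENNReal.ofReal (Real.exp (c * listInt W L ω - c ^ 2 * V ω / 2))} := by
    rintro ω ⟨hω, hωε⟩
    by_cases h : 1 ≤ ENNReal.ofReal (c ^ 2) * (V ω : ℝ≥0∞)
    · exact Or.inl ⟨hω, h⟩
    · right
      refine ENNReal.ofReal_le_ofReal (Real.exp_le_exp.2 ?_)
      have h1 : c ^ 2 * V ω < 1 := by
        by_contra! hcon
        refine h ?_
        rw [← ENNReal.ofReal_coe_nnreal, ← ENNReal.ofReal_mul (sq_nonneg c)]
        exact ENNReal.one_le_ofReal.2 hcon
      have h2 := mul_le_mul_of_nonneg_left (show ε ≤ listInt W L ω from hωε) hc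
      linarith
  refine (measure_mono hsub).trans ((measure_union_le _ _).trans (add_le_add ?_ ?_))
  · have h1 := mul_meas_ge_le_lintegral (μ := P.restrict G) hcm 1
    rw [one_mul, lintegral_const_mul _ hVm.coe_nnreal_ennreal,
      Measure.restrict_apply' hG, Set.inter_comm] at h1
    refine h1.trans ?_
    gcongr
    refine (lintegral_mono fun ω => hV ω).trans_eq ?_
    have hm := (jointlyMeasurable_listField L).enorm.pow_const 2
    exact lintegral_rotate hm
  · have h1 := mul_meas_ge_le_lintegral₀ (μ := P) (f := fun ω => ENNReal.ofReal
      (Real.exp (c * listInt W L ω - c ^ 2 * V ω / 2)))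
      (by
        have := measurable_listInt hW L
        exact Measurable.aemeasurable (by fun_prop)) (ENNReal.ofReal (Real.exp (c * ε - 1)))
    have h2 := h1.trans hE
    rw [mul_comm] at h2
    have h3 := ENNReal.le_div_iff_mul_le (Or.inl (by simp [Real.exp_pos]))
      (Or.inl ENNReal.ofReal_ne_top) |>.2 h2
    refine h3.trans_eq ?_
    rw [one_div, ← ENNReal.ofReal_inv_of_pos (Real.exp_pos _), ← Real.exp_neg]
    congr 2; ring

end

section

variable {Ω : Type*} {mΩ : MeasurableSpace Ω} {P : Measure Ω}
variable {𝓕 : Filtration ℝ≥0 mΩ} {W : Set (ℝ≥0 × Torus) → Ω → ℝ}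

/-! ### Density of elementary fields -/

/-- The approximating simple functions satisfy `|F k| ≤ 2 |f|`, so properties stable under dominated
convergence can be proved from indicators and sums. -/
theorem measurable_induction_dominated {α : Type*} {m : MeasurableSpace α} {C : (α → ℝ) → Prop}
    (hind : ∀ c S, MeasurableSet S → C (S.indicator fun _ => c))
    (hadd : ∀ f g, Measurable f → Measurable g → C f → C g → C (f + g)) {f : α → ℝ}
    (hf : Measurable f)
    (hlim : ∀ F : ℕ → α → ℝ, (∀ k, Measurable (F k)) → (∀ k, C (F k)) →
      (∀ k x, |F k x| ≤ 2 * |f x|) → (∀ x, Tendsto (fun k => F k x) atTop (𝓝 (f x))) → C f) :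
    C f := by
  have hs : ∀ F : SimpleFunc α ℝ, C F := by
    intro F
    induction F using SimpleFunc.induction with
    | const c hS =>
      have := hind c _ hS
      convert this using 1
      ext x
      simp [Set.indicator, Set.piecewise]
    | add _ hf hg =>
      exact hadd _ _ (SimpleFunc.measurable _) (SimpleFunc.measurable _) hf hg
  refine hlim (fun k => SimpleFunc.approxOn f hf Set.univ 0 (Set.mem_univ _) k)
    (fun k => SimpleFunc.measurable _) (fun k => hs _) (fun k x => ?_) (fun x => ?_)
  · have := SimpleFunc.norm_approxOn_zero_le hf (Set.mem_univ (0 : ℝ)) x k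
    rw [two_mul]
    exact this
  · exact SimpleFunc.tendsto_approxOn hf _ (by simp)

/-- Approximability by sums of elementary fields in the `mix` distance. -/
def Approximable (𝓕 : Filtration ℝ≥0 mΩ) (P : Measure Ω) (n : ℕ) (Φ : ℝ≥0 → Torus → Ω → ℝ) :
    Prop :=
  ∀ ε : ℝ≥0∞, ε ≠ 0 → ∃ L : List (ElementaryField 𝓕),
    mix P n (fun s y ω => listField L s y ω - Φ s y ω) ≤ ε

theorem JointlyMeasurable.sub {Φ Ψ : ℝ≥0 → Torus → Ω → ℝ} (hΦ : JointlyMeasurable Φ)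
    (hΨ : JointlyMeasurable Ψ) : JointlyMeasurable fun s y ω => Φ s y ω - Ψ s y ω :=
  Measurable.sub (f := fun p : (ℝ≥0 × Torus) × Ω => Φ p.1.1 p.1.2 p.2) hΦ hΨ

theorem JointlyMeasurable.add {Φ Ψ : ℝ≥0 → Torus → Ω → ℝ} (hΦ : JointlyMeasurable Φ)
    (hΨ : JointlyMeasurable Ψ) : JointlyMeasurable fun s y ω => Φ s y ω + Ψ s y ω :=
  Measurable.add (f := fun p : (ℝ≥0 × Torus) × Ω => Φ p.1.1 p.1.2 p.2) hΦ hΨ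

theorem JointlyMeasurable.const_mul {Φ : ℝ≥0 → Torus → Ω → ℝ} (c : ℝ) (hΦ : JointlyMeasurable Φ) :
    JointlyMeasurable fun s y ω => c * Φ s y ω :=
  Measurable.const_mul (f := fun p : (ℝ≥0 × Torus) × Ω => Φ p.1.1 p.1.2 p.2) hΦ c

theorem Approximable.listField {n : ℕ} (hn : n ≠ 0) (L : List (ElementaryField 𝓕)) :
    Approximable 𝓕 P n (listField L) := by
  intro ε _
  refine ⟨L, ?_⟩
  simp [mix, mom_zero hn]

theorem Approximable.of_mix_le [SFinite P] {n : ℕ} (hn : n ≠ 0) {Φ : ℝ≥0 → Torus → Ω → ℝ}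
    (hΦ : JointlyMeasurable Φ)
    (h : ∀ ε : ℝ≥0∞, ε ≠ 0 → ∃ Ψ, JointlyMeasurable Ψ ∧ Approximable 𝓕 P n Ψ ∧
      mix P n (fun s y ω => Ψ s y ω - Φ s y ω) ≤ ε) : Approximable 𝓕 P n Φ := by
  intro ε hε
  have hε4 : ε / 4 ≠ 0 := by simp [hε]
  obtain ⟨Ψ, hΨ, hA, hle⟩ := h (ε / 4) hε4
  obtain ⟨L, hL⟩ := hA (ε / 4) hε4
  refine ⟨L, ?_⟩
  have h1 := mix_add_le (P := P) hn ((jointlyMeasurable_listField L).sub hΨ) (hΨ.sub hΦ)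
  simp only [sub_add_sub_cancel] at h1
  refine h1.trans ((add_le_add (mul_le_mul_right hL 2) (mul_le_mul_right hle 2)).trans_eq ?_)
  rw [← mul_add, ← two_mul, ← mul_assoc, show (2 : ℝ≥0∞) * 2 = 4 by norm_num]
  exact ENNReal.mul_div_cancel (by norm_num) (by norm_num)

theorem Approximable.add [SFinite P] {n : ℕ} (hn : n ≠ 0) {Φ Ψ : ℝ≥0 → Torus → Ω → ℝ}
    (hΦm : JointlyMeasurable Φ) (hΨm : JointlyMeasurable Ψ)
    (hΦ : Approximable 𝓕 P n Φ) (hΨ : Approximable 𝓕 P n Ψ) :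
    Approximable 𝓕 P n (fun s y ω => Φ s y ω + Ψ s y ω) := by
  intro ε hε
  have hε4 : ε / 4 ≠ 0 := by simp [hε]
  obtain ⟨L, hL⟩ := hΦ (ε / 4) hε4
  obtain ⟨M, hM⟩ := hΨ (ε / 4) hε4
  refine ⟨L ++ M, ?_⟩
  have h1 := mix_add_le (P := P) hn ((jointlyMeasurable_listField L).sub hΦm)
    ((jointlyMeasurable_listField M).sub hΨm)
  have h2 : (fun s y ω => SHE.listField (L ++ M) s y ω - (Φ s y ω + Ψ s y ω)) =
      fun s y ω => (SHE.listField L s y ω - Φ s y ω) + (SHE.listField M s y ω - Ψ s y ω) := by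
    ext s y ω
    rw [listField_append]; ring
  rw [h2]
  refine h1.trans ((add_le_add (mul_le_mul_right hL 2) (mul_le_mul_right hM 2)).trans_eq ?_)
  rw [← mul_add, ← two_mul, ← mul_assoc, show (2 : ℝ≥0∞) * 2 = 4 by norm_num]
  exact ENNReal.mul_div_cancel (by norm_num) (by norm_num)

theorem Approximable.const_mul {n : ℕ} (hn : n ≠ 0) {Φ : ℝ≥0 → Torus → Ω → ℝ}
    (hΦ : Approximable 𝓕 P n Φ) (c : ℝ) : Approximable 𝓕 P n (fun s y ω => c * Φ s y ω) := by
  intro ε hε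
  have hc : ‖c‖ₑ ^ 2 ≠ ∞ := by finiteness
  obtain ⟨L, hL⟩ := hΦ (ε / ‖c‖ₑ ^ 2) (by simp [hε, hc])
  refine ⟨L.map (ElementaryField.smul c), ?_⟩
  simp_rw [listField_map_smul, ← mul_sub]
  rw [mix_const_mul hn]
  exact (mul_le_mul_right hL _).trans ENNReal.mul_div_le

theorem Approximable.of_dominated [SFinite P] {n : ℕ} (hn : n ≠ 0)
    {F : ℕ → ℝ≥0 → Torus → Ω → ℝ} {Φ D : ℝ≥0 → Torus → Ω → ℝ}
    (hF : ∀ k, JointlyMeasurable (F k)) (hΦ : JointlyMeasurable Φ) (hD : JointlyMeasurable D)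
    (hA : ∀ k, Approximable 𝓕 P n (F k))
    (hle : ∀ k s y ω, |F k s y ω - Φ s y ω| ≤ |D s y ω|) (hfin : mix P n D ≠ ∞)
    (hlim : ∀ s y ω, Tendsto (fun k => F k s y ω) atTop (𝓝 (Φ s y ω))) :
    Approximable 𝓕 P n Φ := by
  refine Approximable.of_mix_le hn hΦ fun ε hε => ?_
  have := tendsto_mix_of_dominated (P := P) hn (fun k => (hF k).sub hΦ) hD hle hfin
    (fun s y ω => tendsto_sub_nhds_zero_iff.2 (hlim s y ω))
  obtain ⟨k, hk⟩ := ((ENNReal.tendsto_nhds_zero.1 this) ε (pos_iff_ne_zero.2 hε)).exists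
  exact ⟨F k, hF k, hA k, hk⟩

/-- The field `1_{(0, T]}(s) f(s, ω, y)`. -/
def cutField (T : ℝ≥0) (f : (ℝ≥0 × Ω) × Torus → ℝ) (s : ℝ≥0) (y : Torus) (ω : Ω) : ℝ :=
  (Set.Ioc 0 T).indicator (fun _ => f ((s, ω), y)) s

theorem jointlyMeasurable_cutField (T : ℝ≥0) {f : (ℝ≥0 × Ω) × Torus → ℝ} (hf : Measurable f) :
    JointlyMeasurable (cutField T f) := by
  have : (fun p : (ℝ≥0 × Torus) × Ω => cutField T f p.1.1 p.1.2 p.2) =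
      ((fun p : (ℝ≥0 × Torus) × Ω => p.1.1) ⁻¹' Set.Ioc 0 T).indicator
        fun p => f ((p.1.1, p.2), p.1.2) := by
    ext p; rfl
  unfold JointlyMeasurable
  rw [this]
  exact (hf.comp ((measurable_fst.fst.prodMk measurable_snd).prodMk measurable_fst.snd)).indicator
    (measurable_fst.fst measurableSet_Ioc)

/-- The σ-algebra of predictable random fields. -/
@[reducible]
def predictableField (𝓕 : Filtration ℝ≥0 mΩ) : MeasurableSpace ((ℝ≥0 × Ω) × Torus) :=
  𝓕.predictable.prod inferInstance

theorem predictableField_le : predictableField 𝓕 ≤ Prod.instMeasurableSpace :=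
  sup_le_sup_right (MeasurableSpace.comap_mono predictable_le_prod) _

/-- The generating π-system of the predictable σ-algebra. -/
def predictableRect (𝓕 : Filtration ℝ≥0 mΩ) : Set (Set (ℝ≥0 × Ω)) :=
  {s | ∃ A, MeasurableSet[𝓕 ⊥] A ∧ s = {⊥} ×ˢ A} ∪
    {s | ∃ i A, MeasurableSet[𝓕 i] A ∧ s = Set.Ioi i ×ˢ A}

theorem isPiSystem_predictableRect : IsPiSystem (predictableRect 𝓕) := by
  rintro _ (⟨A, hA, rfl⟩ | ⟨i, A, hA, rfl⟩) _ (⟨B, hB, rfl⟩ | ⟨j, B, hB, rfl⟩) hne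
  · left
    exact ⟨A ∩ B, hA.inter hB, by rw [Set.prod_inter_prod, Set.inter_self]⟩
  · obtain ⟨⟨t, ω⟩, h1, h2⟩ := hne
    have h3 : t = ⊥ := h1.1
    have h4 : j < t := h2.1
    simp [h3] at h4
  · obtain ⟨⟨t, ω⟩, h1, h2⟩ := hne
    have h3 : t = ⊥ := h2.1
    have h4 : i < t := h1.1
    simp [h3] at h4
  · right
    exact ⟨i ⊔ j, A ∩ B, (𝓕.mono le_sup_left _ hA).inter (𝓕.mono le_sup_right _ hB), by
      rw [Set.prod_inter_prod, Set.Ioi_inter_Ioi]⟩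

theorem isCountablySpanning_predictableRect : IsCountablySpanning (predictableRect 𝓕) := by
  refine ⟨fun k => if k = 0 then {⊥} ×ˢ Set.univ else Set.Ioi ⊥ ×ˢ Set.univ, fun k => ?_, ?_⟩
  · by_cases h : k = 0
    · simp only [h, if_true]
      exact Or.inl ⟨Set.univ, MeasurableSet.univ, rfl⟩
    · simp only [h, if_false]
      exact Or.inr ⟨⊥, Set.univ, MeasurableSet.univ, rfl⟩
  · refine Set.eq_univ_of_forall fun p => Set.mem_iUnion.2 ?_
    rcases eq_or_ne p.1 ⊥ with h | h
    · exact ⟨0, by simp [h]⟩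
    · exact ⟨1, by simpa using! bot_lt_iff_ne_bot.2 h⟩

theorem mix_cutField_const_ne_top [IsProbabilityMeasure P] {n : ℕ} (hn : n ≠ 0) (T : ℝ≥0) (c : ℝ) :
    mix P n (cutField T fun _ => c) ≠ ∞ := by
  rw [mix_eq (jointlyMeasurable_cutField T measurable_const)]
  have : ∀ s, ∫⁻ y : Torus, mom P n (cutField T (fun _ => c) s y) ≤
      (Set.Ioc 0 T).indicator (fun _ => 2 * ‖c‖ₑ ^ 2) s := by
    intro s
    by_cases hs : s ∈ Set.Ioc 0 T
    · rw [Set.indicator_of_mem hs]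
      calc ∫⁻ y : Torus, mom P n (cutField T (fun _ => c) s y)
          ≤ ∫⁻ _ : Torus, ‖c‖ₑ ^ 2 := lintegral_mono fun y =>
            mom_le_of_bounded hn (ae_of_all _ fun ω => by simp [cutField, hs])
        _ = _ := by
          rw [lintegral_const, mul_comm, AddCircle.measure_univ]
          norm_num
    · rw [Set.indicator_of_notMem hs]
      have : ∀ y, cutField T (fun _ => c) s y = fun _ : Ω => 0 := by
        intro y; ext ω; simp only [cutField, Set.indicator_of_notMem hs]
      simp [this, mom_zero hn]
  refine ne_top_of_le_ne_top ?_ (lintegral_mono this)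
  rw [lintegral_indicator measurableSet_Ioc, lintegral_const, Measure.restrict_apply_univ,
    timeMeasure_Ioc]
  finiteness

/-- A π-λ argument on products of predictable rectangles with Borel sets. Rectangles at time 0
disappear under the cut to `(0, T]`, and the others become a single elementary field. Complements
and disjoint unions follow from linearity and dominated convergence. -/
theorem approximable_cutField_indicator [IsProbabilityMeasure P] {n : ℕ} (hn : n ≠ 0) (T : ℝ≥0)
    {S : Set ((ℝ≥0 × Ω) × Torus)} (hS : MeasurableSet[predictableField 𝓕] S) :
    Approximable 𝓕 P n (cutField T (S.indicator fun _ => 1)) := by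
  have hm : ∀ S, MeasurableSet[predictableField 𝓕] S →
      JointlyMeasurable (cutField T (S.indicator fun _ => (1 : ℝ))) := fun S hS =>
    jointlyMeasurable_cutField T (measurable_const.indicator (predictableField_le _ hS))
  have hpred : predictableField 𝓕 = MeasurableSpace.generateFrom
      (Set.image2 (· ×ˢ ·) (predictableRect 𝓕) {B : Set Torus | MeasurableSet B}) := by
    rw [← generateFrom_prod_eq isCountablySpanning_predictableRect
      isCountablySpanning_measurableSet, MeasurableSpace.generateFrom_measurableSet]
    rfl
  have hempty : Approximable 𝓕 P n (cutField T ((∅ : Set ((ℝ≥0 × Ω) × Torus)).indicator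
      fun _ => 1)) := by
    have : cutField T ((∅ : Set ((ℝ≥0 × Ω) × Torus)).indicator fun _ => (1 : ℝ)) =
        listField ([] : List (ElementaryField 𝓕)) := by
      ext s y ω; simp [cutField, listField]
    rw [this]
    exact Approximable.listField hn _
  refine MeasurableSpace.induction_on_inter (m := predictableField 𝓕)
    (C := fun S _ => Approximable 𝓕 P n (cutField T (S.indicator fun _ => 1))) hpred
    (isPiSystem_predictableRect.prod MeasurableSpace.isPiSystem_measurableSet) hempty ?_ ?_ ?_ S hS
  · rintro _ ⟨R, hR, B, hB, rfl⟩
    rcases hR with ⟨A, hA, rfl⟩ | ⟨i, A, hA, rfl⟩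
    · have : cutField T (((({⊥} : Set ℝ≥0) ×ˢ A) ×ˢ B).indicator fun _ => (1 : ℝ)) =
          listField ([] : List (ElementaryField 𝓕)) := by
        ext s y ω
        by_cases hs : s ∈ Set.Ioc 0 T
        · simp [cutField, listField, Set.indicator_of_mem hs, hs.1.ne']
        · simp [cutField, listField, Set.indicator_of_notMem hs]
      change Approximable 𝓕 P n (cutField T (((({⊥} : Set ℝ≥0) ×ˢ A) ×ˢ B).indicator fun _ => 1))
      rw [this]
      exact Approximable.listField hn _
    · have : cutField T (((Set.Ioi i ×ˢ A) ×ˢ B).indicator fun _ => (1 : ℝ)) =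
          listField [(⟨i, T, B, A.indicator fun _ => 1, hB, measurable_const.indicator hA,
            ⟨1, fun ω => by by_cases h : ω ∈ A <;> simp [h]⟩⟩ : ElementaryField 𝓕)] := by
        ext s y ω
        simp only [cutField, listField, List.map_cons, List.map_nil, List.sum_cons, List.sum_nil,
          ElementaryField.toFun, Set.indicator_apply, Set.mem_Ioc,
          add_zero]
        by_cases h1 : i < s
        · have h0 : 0 < s := (zero_le (a := i)).trans_lt h1
          by_cases h2 : s ≤ T <;> by_cases h3 : ω ∈ A <;> by_cases h4 : y ∈ B <;>
            simp [h0, h1, h2, h3, h4]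
        · simp [h1]
      change Approximable 𝓕 P n (cutField T (((Set.Ioi i ×ˢ A) ×ˢ B).indicator fun _ => 1))
      rw [this]
      exact Approximable.listField hn _
  · intro S hS ih
    have huniv : cutField T (fun _ : (ℝ≥0 × Ω) × Torus => (1 : ℝ)) =
        listField [(⟨0, T, Set.univ, fun _ => 1, MeasurableSet.univ, measurable_const,
            ⟨1, fun ω => by simp⟩⟩ : ElementaryField 𝓕)] := by
      ext s y ω
      simp [cutField, listField, ElementaryField.toFun, Set.indicator_apply]
    have h1 : Approximable 𝓕 P n (cutField T (fun _ : (ℝ≥0 × Ω) × Torus => (1 : ℝ))) := by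
      rw [huniv]
      exact Approximable.listField hn _
    have h2 := Approximable.add hn (jointlyMeasurable_cutField T measurable_const)
      ((hm S hS).const_mul (-1)) h1 (ih.const_mul hn (-1))
    convert h2 using 1
    ext s y ω
    by_cases hs : s ∈ Set.Ioc 0 T
    · by_cases h : ((s, ω), y) ∈ S <;> simp [cutField, hs, h]
    · simp [cutField, Set.indicator_of_notMem hs]
  · intro f hd hfm ih
    have hpm : ∀ k, MeasurableSet[predictableField 𝓕] (⋃ i ∈ Finset.range k, f i) := fun k =>
      Finset.measurableSet_biUnion _ fun i _ => hfm i
    have hUm : MeasurableSet[predictableField 𝓕] (⋃ i, f i) := MeasurableSet.iUnion hfm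
    have hpart : ∀ k, Approximable 𝓕 P n
        (cutField T ((⋃ i ∈ Finset.range k, f i).indicator fun _ => 1)) := by
      intro k
      induction k with
      | zero => simpa using hempty
      | succ k ihk =>
        have := Approximable.add hn (hm _ (hpm k)) (hm _ (hfm k)) ihk (ih k)
        convert this using 1
        ext s y ω
        simp only [cutField]
        by_cases hs : s ∈ Set.Ioc 0 T
        · simp only [Set.indicator_of_mem hs]
          rw [Finset.range_add_one, Finset.set_biUnion_insert, Set.union_comm,
            Set.indicator_union_of_disjoint]
          rw [Set.disjoint_iUnion₂_left]
          intro i hi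
          exact hd (Finset.mem_range.1 hi).ne
        · simp [Set.indicator_of_notMem hs]
    refine Approximable.of_dominated hn (fun k => hm _ (hpm k)) (hm _ hUm)
      (jointlyMeasurable_cutField T measurable_const) hpart ?_
      (mix_cutField_const_ne_top hn T 1) ?_
    · intro k s y ω
      by_cases hs : s ∈ Set.Ioc 0 T
      · simp only [cutField, Set.indicator_of_mem hs]
        by_cases h1 : ((s, ω), y) ∈ ⋃ i ∈ Finset.range k, f i <;>
          by_cases h2 : ((s, ω), y) ∈ ⋃ i, f i <;>
          simp only [h1, h2, Set.indicator_of_mem, Set.indicator_of_notMem,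
            not_false_eq_true] <;> norm_num
      · simp [cutField, Set.indicator_of_notMem hs]
    · intro s y ω
      by_cases hs : s ∈ Set.Ioc 0 T
      · simp only [cutField, Set.indicator_of_mem hs]
        by_cases hU : ((s, ω), y) ∈ ⋃ i, f i
        · rw [Set.indicator_of_mem hU]
          obtain ⟨i, hi⟩ := Set.mem_iUnion.1 hU
          refine tendsto_const_nhds.congr' ?_
          filter_upwards [eventually_gt_atTop i] with k hk
          rw [Set.indicator_of_mem]
          exact Set.mem_biUnion (Finset.mem_coe.2 (Finset.mem_range.2 hk)) hi
        · rw [Set.indicator_of_notMem hU]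
          refine tendsto_const_nhds.congr fun k => ?_
          rw [Set.indicator_of_notMem]
          intro hk
          obtain ⟨i, _, hi⟩ := Set.mem_iUnion₂.1 hk
          exact hU (Set.mem_iUnion.2 ⟨i, hi⟩)
      · simp only [cutField, Set.indicator_of_notMem hs]
        exact tendsto_const_nhds

/-- The definition of the Walsh integral supplies approximations in `L²` only. This supplies them in
the stronger `mix P n`, as needed for moments of order `2n`. -/
theorem IsPredictableField.approximable [IsProbabilityMeasure P] {n : ℕ} (hn : n ≠ 0) {T : ℝ≥0}
    {Φ : ℝ≥0 → Torus → Ω → ℝ} (hΦ : IsPredictableField 𝓕 Φ)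
    (hT : ∀ s y ω, s ∉ Set.Ioc 0 T → Φ s y ω = 0) (hfin : mix P n Φ ≠ ∞) :
    Approximable 𝓕 P n Φ := by
  have hcut : cutField T (fun p => Φ p.1.1 p.2 p.1.2) = Φ := by
    ext s y ω
    by_cases hs : s ∈ Set.Ioc 0 T
    · simp [cutField, Set.indicator_of_mem hs]
    · simp only [cutField, Set.indicator_of_notMem hs, hT s y ω hs]
  have hjm : ∀ f : (ℝ≥0 × Ω) × Torus → ℝ, Measurable[predictableField 𝓕] f →
      JointlyMeasurable (cutField T f) := fun f hf =>
    jointlyMeasurable_cutField T (hf.mono predictableField_le le_rfl)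
  rw [← hcut]
  refine measurable_induction_dominated (m := predictableField 𝓕)
    (C := fun f => Approximable 𝓕 P n (cutField T f)) ?_ ?_ hΦ ?_
  · intro c S hS
    have := (approximable_cutField_indicator (P := P) hn T hS).const_mul hn c
    convert this using 1
    ext s y ω
    by_cases hs : s ∈ Set.Ioc 0 T
    · by_cases h : ((s, ω), y) ∈ S <;> simp [cutField, hs, h]
    · simp [cutField, Set.indicator_of_notMem hs]
  · intro f g hf hg hfA hgA
    have := Approximable.add hn (hjm f hf) (hjm g hg) hfA hgA
    convert this using 1
    ext s y ω
    by_cases hs : s ∈ Set.Ioc 0 T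
    · simp [cutField, Set.indicator_of_mem hs]
    · simp [cutField, Set.indicator_of_notMem hs]
  · intro F hF hA hle hlim
    refine Approximable.of_dominated hn (D := fun s y ω => 3 * Φ s y ω) (fun k => hjm _ (hF k))
      (hjm _ hΦ) (hΦ.jointlyMeasurable.const_mul 3) hA ?_ ?_ ?_
    · intro k s y ω
      by_cases hs : s ∈ Set.Ioc 0 T
      · simp only [cutField, Set.indicator_of_mem hs]
        have h1 := hle k ((s, ω), y)
        have h2 := abs_sub (F k ((s, ω), y)) (Φ s y ω)
        rw [abs_mul, abs_of_pos (three_pos : (0 : ℝ) < 3)]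
        simp only at h1
        linarith
      · simp only [cutField, Set.indicator_of_notMem hs]
        simp
    · rw [mix_const_mul hn]
      finiteness
    · intro s y ω
      by_cases hs : s ∈ Set.Ioc 0 T
      · simp only [cutField, Set.indicator_of_mem hs]
        exact hlim _
      · simp only [cutField, Set.indicator_of_notMem hs]
        exact tendsto_const_nhds

end

section

variable {Ω : Type*} {mΩ : MeasurableSpace Ω} {P : Measure Ω}
variable {𝓕 : Filtration ℝ≥0 mΩ} {W : Set (ℝ≥0 × Torus) → Ω → ℝ}

/-! ### Moments and locality of the Walsh integral -/

/-- Fatou's lemma for the `2n`-th moments. -/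
theorem mom_le_of_tendsto_ae {n : ℕ} (hn : n ≠ 0) {f : ℕ → Ω → ℝ} {g : Ω → ℝ}
    (hf : ∀ k, Measurable (f k)) (hlim : ∀ᵐ ω ∂P, Tendsto (fun k => f k ω) atTop (𝓝 (g ω)))
    {b : ℕ → ℝ≥0∞} {B : ℝ≥0∞} (hb : ∀ k, mom P n (f k) ≤ b k) (hB : Tendsto b atTop (𝓝 B)) :
    mom P n g ≤ B := by
  rw [← ENNReal.pow_le_pow_left_iff hn, mom_pow hn]
  calc ∫⁻ ω, ‖g ω‖ₑ ^ (2 * n) ∂P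
      = ∫⁻ ω, liminf (fun k => ‖f k ω‖ₑ ^ (2 * n)) atTop ∂P := by
        refine lintegral_congr_ae ?_
        filter_upwards [hlim] with ω hω
        have h3 := (ENNReal.continuous_pow (2 * n)).tendsto _ |>.comp hω.enorm
        exact h3.liminf_eq.symm
    _ ≤ liminf (fun k => ∫⁻ ω, ‖f k ω‖ₑ ^ (2 * n) ∂P) atTop :=
        lintegral_liminf_le fun k => (hf k).enorm.pow_const _
    _ ≤ liminf (fun k => b k ^ n) atTop := by
        refine liminf_le_liminf (Eventually.of_forall fun k => ?_)
        rw [← mom_pow hn]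
        exact pow_le_pow_left' (hb k) n
    _ = B ^ n := (((ENNReal.continuous_pow n).tendsto _).comp hB).liminf_eq

/-- In the tail bound `c` is chosen first, so large that `exp(1 - cε)` is small; then the energy on
`G` times `c²` tends to 0. -/
theorem tendsto_measure_listInt [IsProbabilityMeasure P] (hW : IsWhiteNoise 𝓕 P W)
    {N : ℕ → List (ElementaryField 𝓕)} {G : Set Ω} (hG : MeasurableSet G)
    (hA : Tendsto (fun k => ∫⁻ s, (∫⁻ y, (∫⁻ ω in G, ‖listField (N k) s y ω‖ₑ ^ 2 ∂P))
      ∂timeMeasure) atTop (𝓝 0)) {ε : ℝ} (hε : 0 < ε) :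
    Tendsto (fun k => P (G ∩ {ω | ε ≤ listInt W (N k) ω})) atTop (𝓝 0) := by
  rw [ENNReal.tendsto_nhds_zero]
  intro δ hδ
  have hδ2 : 0 < δ / 2 := ENNReal.half_pos hδ.ne'
  have h1 : Tendsto (fun c : ℝ => ENNReal.ofReal (Real.exp (1 - c * ε))) atTop (𝓝 0) := by
    rw [← ENNReal.ofReal_zero]
    refine ENNReal.tendsto_ofReal (Real.tendsto_exp_atBot.comp ?_)
    exact tendsto_atBot_add_const_left _ 1
      (tendsto_neg_atTop_atBot.comp (tendsto_id.atTop_mul_const hε))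
  obtain ⟨c, hc, hc0⟩ := ((ENNReal.tendsto_nhds_zero.1 h1 _ hδ2).and (eventually_ge_atTop 0)).exists
  have h2 := ENNReal.Tendsto.const_mul (a := ENNReal.ofReal (c ^ 2)) hA (Or.inr ENNReal.ofReal_ne_top)
  rw [mul_zero] at h2
  filter_upwards [ENNReal.tendsto_nhds_zero.1 h2 _ hδ2] with k hk
  refine (measure_le_listInt hW (N k) hG hc0).trans ((add_le_add hk hc).trans_eq ?_)
  exact ENNReal.add_halves δ

/-- Moment bound for a Walsh integral, localized to an event on which the integrand agrees with
another predictable field. -/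
theorem IsWalshIntegral.mom_indicator_le [IsProbabilityMeasure P] (hW : IsWhiteNoise 𝓕 P W)
    {Φ Ψ : ℝ≥0 → Torus → Ω → ℝ} {X : Ω → ℝ} (hX : IsWalshIntegral 𝓕 P W Φ X)
    (hΨ : IsPredictableField 𝓕 Ψ) {T : ℝ≥0} (hT : ∀ s y ω, s ∉ Set.Ioc 0 T → Ψ s y ω = 0)
    {G : Set Ω} (hG : MeasurableSet G) (h : ∀ ω ∈ G, ∀ s y, Ψ s y ω = Φ s y ω)
    {n : ℕ} (hn : n ≠ 0) : mom P n (G.indicator X) ≤ 12 * n * mix P n Ψ := by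
  by_cases hfin : mix P n Ψ = ∞
  · rw [hfin, ENNReal.mul_top (by simp [hn])]
    exact le_top
  obtain ⟨hΦ, hXL, M, hM1, hM2⟩ := hX
  have hΦm := hΦ.jointlyMeasurable
  have hΨm := hΨ.jointlyMeasurable
  -- Two sequences of elementary fields are in play: `M k` approximates `Φ` in `L²`, and `L k`
  -- approximates `Ψ` in `mix P n`. On `G` the two targets agree, so the energy of `M k - L k` on
  -- `G` tends to 0 and the two integrals become close there in probability.
  choose L hL using fun k : ℕ => hΨ.approximable (P := P) hn hT hfin ((k : ℝ≥0∞) + 1)⁻¹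
    (ENNReal.inv_ne_zero.2 (by finiteness))
  have hinv : Tendsto (fun k : ℕ => ((k : ℝ≥0∞) + 1)⁻¹) atTop (𝓝 0) := by
    have := (tendsto_add_atTop_iff_nat 1).2 ENNReal.tendsto_inv_nat_nhds_zero
    simpa using this
  have hMΦ : Tendsto (fun k => mix P 1 (fun s y ω => listField (M k) s y ω - Φ s y ω)) atTop
      (𝓝 0) := by
    have h1 := ((ENNReal.continuous_pow 2).tendsto 0).comp hM1
    have h2 : ∀ k, mix P 1 (fun s y ω => listField (M k) s y ω - Φ s y ω) = _ := fun k =>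
      mix_one (P := P) ((jointlyMeasurable_listField (M k)).sub hΦm)
    simp_rw [h2]
    simpa using! h1
  -- the comparison of the two approximating sequences on `G`
  have key : ∀ c : ℝ, c ^ 2 = 1 → ∀ ε : ℝ, 0 < ε → Tendsto (fun k => P (G ∩
      {ω | ε ≤ c * (listInt W (M k) ω - listInt W (L k) ω)})) atTop (𝓝 0) := by
    intro c hc ε hε
    set N : ℕ → List (ElementaryField 𝓕) := fun k =>
      (M k).map (ElementaryField.smul c) ++ (L k).map (ElementaryField.smul (-c)) with hN
    have hNI : ∀ k ω, listInt W (N k) ω = c * (listInt W (M k) ω - listInt W (L k) ω) := by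
      intro k ω
      rw [hN, listInt_append, listInt_map_smul, listInt_map_smul]
      ring
    simp_rw [← hNI]
    refine tendsto_measure_listInt hW hG ?_ hε
    have hc1 : ‖c‖ₑ ^ 2 = 1 := by
      rw [← enorm_pow, hc]; simp
    have hbound : ∀ k, ∫⁻ s, (∫⁻ y, (∫⁻ ω in G, ‖listField (N k) s y ω‖ₑ ^ 2 ∂P)) ∂timeMeasure ≤
        2 * mix P 1 (fun s y ω => listField (M k) s y ω - Φ s y ω) + 2 * ((k : ℝ≥0∞) + 1)⁻¹ := by
      intro k
      have hm1 := (jointlyMeasurable_listField (M k)).sub hΦm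
      have hm2 := (jointlyMeasurable_listField (L k)).sub hΨm
      have hm3 := (hm1.const_mul c).add (hm2.const_mul (-c))
      calc ∫⁻ s, (∫⁻ y, (∫⁻ ω in G, ‖listField (N k) s y ω‖ₑ ^ 2 ∂P)) ∂timeMeasure
          ≤ mix P 1 (fun s y ω => c * (listField (M k) s y ω - Φ s y ω) +
              (-c) * (listField (L k) s y ω - Ψ s y ω)) := by
            rw [mix_eq hm3]
            refine lintegral_mono fun s => lintegral_mono fun y => ?_
            simp only
            rw [mom_one]
            refine (setLIntegral_congr_fun hG fun ω hω => ?_).trans_le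
              (setLIntegral_le_lintegral G _)
            congr 2
            rw [hN, listField_append, listField_map_smul, listField_map_smul, h ω hω]
            ring
        _ ≤ _ := mix_add_le one_ne_zero (hm1.const_mul c) (hm2.const_mul (-c))
        _ ≤ _ := by
            rw [mix_const_mul one_ne_zero, mix_const_mul one_ne_zero, enorm_neg, hc1, one_mul,
              one_mul]
            gcongr
            exact (mix_one_le hn hm2).trans (hL k)
    refine tendsto_of_tendsto_of_tendsto_of_le_of_le tendsto_const_nhds ?_ (fun _ => zero_le) hbound
    have h1 := (ENNReal.Tendsto.const_mul (a := 2) hMΦ (Or.inr (by simp))).add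
      (ENNReal.Tendsto.const_mul (a := 2) hinv (Or.inr (by simp)))
    simpa using h1
  have hMX : TendstoInMeasure P (fun k => listInt W (M k)) atTop X := by
    refine tendstoInMeasure_of_tendsto_eLpNorm two_ne_zero
      (fun k => (measurable_listInt hW (M k)).aestronglyMeasurable) hXL.1 ?_
    exact hM2
  have hconv : TendstoInMeasure P (fun k => G.indicator (listInt W (L k))) atTop
      (G.indicator X) := by
    rw [tendstoInMeasure_iff_norm] at hMX ⊢
    intro ε hε
    have h1 := ((key 1 (by norm_num) (ε / 2) (half_pos hε)).add
      (key (-1) (by norm_num) (ε / 2) (half_pos hε))).add (hMX (ε / 2) (half_pos hε))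
    simp only [add_zero] at h1
    refine tendsto_of_tendsto_of_tendsto_of_le_of_le tendsto_const_nhds h1 (fun _ => zero_le)
      fun k => ?_
    refine (measure_mono ?_).trans ((measure_union_le _ _).trans
      (add_le_add_left (measure_union_le _ _) _))
    intro ω hω
    by_cases hωG : ω ∈ G
    · simp only [Set.mem_ofPred_eq, Set.indicator_of_mem hωG, Real.norm_eq_abs] at hω
      by_contra! hcon
      simp only [Set.mem_union, Set.mem_inter_iff, Set.mem_ofPred_eq, hωG, true_and, not_or,
        not_le, Real.norm_eq_abs] at hcon
      obtain ⟨⟨h1, h2⟩, h3⟩ := hcon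
      have h4 : |listInt W (L k) ω - listInt W (M k) ω| < ε / 2 := abs_lt.2 ⟨by linarith, by linarith⟩
      have h5 := abs_sub_le (listInt W (L k) ω) (listInt W (M k) ω) (X ω)
      linarith
    · simp only [Set.mem_ofPred_eq, Set.indicator_of_notMem hωG, sub_self, norm_zero] at hω
      exact absurd hω (not_le.2 hε)
  -- Fatou along an almost surely convergent subsequence. The factor `12n` is `6n` times the 2 lost
  -- in `mix (L k) ≤ 2 mix (L k - Ψ) + 2 mix Ψ`.
  obtain ⟨ns, hns, hae⟩ := hconv.exists_seq_tendsto_ae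
  refine mom_le_of_tendsto_ae hn (fun k => (measurable_listInt hW (L (ns k))).indicator hG) hae
    (b := fun k => 6 * n * (2 * ((ns k : ℝ≥0∞) + 1)⁻¹ + 2 * mix P n Ψ)) (fun k => ?_) ?_
  · have h1 : mom P n (G.indicator (listInt W (L (ns k)))) ≤ mom P n (listInt W (L (ns k))) := by
      refine mom_mono_ae (ae_of_all _ fun ω => ?_)
      by_cases hω : ω ∈ G <;> simp [hω]
    refine h1.trans ((mom_listInt_le hW _ hn).trans ?_)
    gcongr
    have hm := (jointlyMeasurable_listField (L (ns k))).sub hΨm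
    have h2 := mix_add_le (P := P) hn hm hΨm
    simp only [sub_add_cancel] at h2
    refine h2.trans ?_
    gcongr
    exact hL _
  · have h1 := hinv.comp hns.tendsto_atTop
    have h2 := ENNReal.Tendsto.const_mul (a := 6 * (n : ℝ≥0∞))
      ((ENNReal.Tendsto.const_mul (a := 2) h1 (Or.inr (by simp))).add_const (2 * mix P n Ψ))
      (Or.inr (by finiteness))
    rw [mul_zero, zero_add, ← mul_assoc] at h2
    have h3 : (6 : ℝ≥0∞) * n * 2 = 12 * n := by
      rw [mul_right_comm]; norm_num
    rw [h3] at h2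
    exact h2

end

section

/-! ### Time integrals of the kernels -/

theorem lintegral_rpow_Ioo {h : ℝ} (hh : 0 ≤ h) :
    ∫⁻ x in Set.Ioo 0 h, ENNReal.ofReal (x ^ (-(3 / 4) : ℝ)) =
      4 * ENNReal.ofReal (h ^ (1 / 4 : ℝ)) := by
  have hint : IntegrableOn (fun x : ℝ => x ^ (-(3 / 4) : ℝ)) (Set.Ioo 0 h) := by
    have := (intervalIntegral.intervalIntegrable_rpow' (a := 0) (b := h)
      (r := (-(3 / 4) : ℝ)) (by norm_num)).1
    exact this.mono_set Set.Ioo_subset_Ioc_self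
  rw [← ofReal_integral_eq_lintegral_ofReal hint
    ((ae_restrict_iff' measurableSet_Ioo).2 (ae_of_all _ fun x hx => Real.rpow_nonneg hx.1.le _)),
    ← integral_Ioc_eq_integral_Ioo, ← intervalIntegral.integral_of_le hh,
    integral_rpow (Or.inl (by norm_num)), Real.zero_rpow (by norm_num),
    show (4 : ℝ≥0∞) = ENNReal.ofReal 4 by simp, ← ENNReal.ofReal_mul (by norm_num)]
  congr 1
  norm_num
  ring

theorem lintegral_rpow_sub_Ioo {s t : ℝ} (h : s ≤ t) :
    ∫⁻ x in Set.Ioo s t, ENNReal.ofReal ((x - s) ^ (-(3 / 4) : ℝ)) =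
      4 * ENNReal.ofReal ((t - s) ^ (1 / 4 : ℝ)) := by
  rw [← lintegral_rpow_Ioo (sub_nonneg.2 h), ← lintegral_indicator measurableSet_Ioo,
    ← lintegral_indicator measurableSet_Ioo]
  refine Eq.trans (lintegral_congr fun x => ?_) (lintegral_sub_right_eq_self _ s)
  simp only [Set.indicator_apply, Set.mem_Ioo, sub_pos, sub_lt_sub_iff_right]

theorem lintegral_sub_rpow_Ioo {s t : ℝ} (h : s ≤ t) :
    ∫⁻ x in Set.Ioo s t, ENNReal.ofReal ((t - x) ^ (-(3 / 4) : ℝ)) =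
      4 * ENNReal.ofReal ((t - s) ^ (1 / 4 : ℝ)) := by
  rw [← lintegral_rpow_Ioo (sub_nonneg.2 h), ← lintegral_indicator measurableSet_Ioo,
    ← lintegral_indicator measurableSet_Ioo]
  refine Eq.trans (lintegral_congr fun x => ?_) (lintegral_sub_left_eq_self _ t)
  simp only [Set.indicator_apply, Set.mem_Ioo, sub_pos, sub_lt_sub_iff_left, and_comm]

/-- `(t - r)^{-3/4} + r^{-3/4}`. -/
def timeWeight (t r : ℝ) : ℝ := (t - r) ^ (-(3 / 4) : ℝ) + r ^ (-(3 / 4) : ℝ)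

theorem measurable_timeWeight (t : ℝ) : Measurable (timeWeight t) := by
  unfold timeWeight; fun_prop

/-- On `[s, t)` one has `r^{-3/4} ≤ (r - s)^{-3/4}`, so each of the two singularities contributes `4
(t - s)^{1/4}`. -/
theorem lintegral_timeWeight_le {s t : ℝ≥0} (h : s ≤ t) :
    ∫⁻ r in Set.Ico s t, ENNReal.ofReal (timeWeight t r) ∂timeMeasure ≤
      8 * ENNReal.ofReal (((t : ℝ) - s) ^ (1 / 4 : ℝ)) := by
  have hm := measurable_timeWeight t
  rw [← lintegral_indicator measurableSet_Ico, lintegral_timeMeasure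
    (Measurable.indicator (by fun_prop) measurableSet_Ico)]
  calc ∫⁻ x in Set.Ici (0 : ℝ), (Set.Ico s t).indicator
        (fun r : ℝ≥0 => ENNReal.ofReal (timeWeight t r)) x.toNNReal
      ≤ ∫⁻ x : ℝ, (Set.Ico (s : ℝ) t).indicator (fun x => ENNReal.ofReal (timeWeight t x)) x := by
        rw [← lintegral_indicator measurableSet_Ici]
        refine lintegral_mono fun x => ?_
        by_cases hx : x ∈ Set.Ici (0 : ℝ)
        · rw [Set.indicator_of_mem hx]
          lift x to ℝ≥0 using hx
          simp [Set.indicator_apply]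
        · rw [Set.indicator_of_notMem hx]
          exact zero_le
    _ = ∫⁻ x in Set.Ioo (s : ℝ) t, ENNReal.ofReal (timeWeight t x) := by
        rw [lintegral_indicator measurableSet_Ico, setLIntegral_congr Ioo_ae_eq_Ico]
    _ ≤ ∫⁻ x in Set.Ioo (s : ℝ) t, (ENNReal.ofReal ((t - x) ^ (-(3 / 4) : ℝ)) +
          ENNReal.ofReal ((x - s) ^ (-(3 / 4) : ℝ))) := by
        refine setLIntegral_mono' measurableSet_Ioo fun x hx => ?_
        unfold timeWeight
        refine ENNReal.ofReal_add_le.trans (add_le_add_right (ENNReal.ofReal_le_ofReal ?_) _)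
        exact Real.rpow_le_rpow_of_nonpos (sub_pos.2 hx.1)
          (sub_le_self x s.coe_nonneg) (by norm_num)
    _ = _ := by
        rw [lintegral_add_left (by fun_prop), lintegral_rpow_sub_Ioo (NNReal.coe_le_coe.2 h),
          lintegral_sub_rpow_Ioo (NNReal.coe_le_coe.2 h), ← add_mul]
        norm_num

/-- The mixed product `a^{-1/4} r^{-1/2}` is at most the larger of the pure powers `a^{-3/4}` and
`r^{-3/4}`. -/
theorem rpow_mul_inv_sqrt_add_le {a r : ℝ} (ha : 0 < a) (hr : 0 < r) :
    a ^ (-(1 / 4) : ℝ) * (1 / √a + 1 / √r) ≤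
      2 * (a ^ (-(3 / 4) : ℝ) + r ^ (-(3 / 4) : ℝ)) := by
  have e : ∀ x : ℝ, 0 < x → 1 / √x = x ^ (-(1 / 2) : ℝ) := fun x hx => by
    rw [Real.sqrt_eq_rpow, Real.rpow_neg hx.le, one_div]
  have e2 : ∀ x : ℝ, 0 < x → x ^ (-(3 / 4) : ℝ) = x ^ (-(1 / 4) : ℝ) * x ^ (-(1 / 2) : ℝ) :=
    fun x hx => by rw [← Real.rpow_add hx]; norm_num
  rw [e a ha, e r hr, e2 a ha, e2 r hr]
  have p1 := Real.rpow_pos_of_pos ha (-(1 / 4))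
  have p2 := Real.rpow_pos_of_pos ha (-(1 / 2))
  have p3 := Real.rpow_pos_of_pos hr (-(1 / 4))
  have p4 := Real.rpow_pos_of_pos hr (-(1 / 2))
  rcases le_total a r with h | h
  · have h1 : r ^ (-(1 / 2) : ℝ) ≤ a ^ (-(1 / 2) : ℝ) :=
      Real.rpow_le_rpow_of_nonpos ha h (by norm_num)
    nlinarith [mul_pos p3 p4, mul_le_mul_of_nonneg_left h1 p1.le]
  · have h1 : a ^ (-(1 / 4) : ℝ) ≤ r ^ (-(1 / 4) : ℝ) :=
      Real.rpow_le_rpow_of_nonpos hr h (by norm_num)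
    have h2 : a ^ (-(1 / 2) : ℝ) ≤ r ^ (-(1 / 2) : ℝ) :=
      Real.rpow_le_rpow_of_nonpos hr h (by norm_num)
    nlinarith [mul_le_mul_of_nonneg_right h1 p4.le, mul_pos p1 p2, mul_le_mul_of_nonneg_left h2 p1.le]

/-- Puts `a^{-1/2}` under the weight `a^{-3/4}` used for increments, with a gain of `T^{1/4}`. -/
theorem inv_sqrt_le {a T : ℝ} (ha : 0 < a) (h : a ≤ T) :
    1 / √a ≤ T ^ (1 / 4 : ℝ) * a ^ (-(3 / 4) : ℝ) := by
  have e : 1 / √a = a ^ (1 / 4 : ℝ) * a ^ (-(3 / 4) : ℝ) := by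
    rw [← Real.rpow_add ha, Real.sqrt_eq_rpow, one_div, ← Real.rpow_neg ha.le]; norm_num
  rw [e]
  exact mul_le_mul_of_nonneg_right (Real.rpow_le_rpow ha.le h (by norm_num))
    (Real.rpow_nonneg ha.le _)

theorem min_one_sq_le_rpow {x : ℝ} (hx : 0 ≤ x) : min 1 x ^ 2 ≤ x ^ (1 / 4 : ℝ) := by
  rcases le_total x 1 with h | h
  · rw [min_eq_right h]
    calc x ^ 2 = x ^ (2 : ℝ) := by norm_num
      _ ≤ x ^ (1 / 4 : ℝ) := Real.rpow_le_rpow_of_exponent_ge' hx h (by norm_num) (by norm_num)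
  · rw [min_eq_left h, one_pow]
    exact Real.one_le_rpow h (by norm_num)

/-- Interpolation between the crude bound by the sum of the kernels and the bound with `(b-a)/a`,
through `min(1, x)² ≤ x^{1/4}`. The small exponent leaves `a^{-1/4}`, which remains integrable in
time next to the `a^{-1/2}` of the convolution estimate. The constant is `2 · 36²`. -/
theorem heatKernel_sub_sq_le {a b : ℝ} (ha : 0 < a) (hab : a ≤ b) (hb : b ≤ 1) (x : Torus) :
    (heatKernel b x - heatKernel a x) ^ 2 ≤
      2592 * (b - a) ^ (1 / 4 : ℝ) * a ^ (-(1 / 4) : ℝ) * (gk a x ^ 2 + gk b x ^ 2) := by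
  have hga := gk_nonneg ha.le x
  have hgb := gk_nonneg (ha.le.trans hab) x
  have hba : 0 ≤ (b - a) / a := div_nonneg (sub_nonneg.2 hab) ha.le
  have h1 := abs_heatKernel_sub_le ha hab hb x
  have h2 : |heatKernel b x - heatKernel a x| ≤ 36 * (gk a x + gk b x) := by
    have := heatKernel_le ha (hab.trans hb) x
    have := heatKernel_le (ha.trans_le hab) hb x
    have := heatKernel_nonneg a x
    have := heatKernel_nonneg b x
    rw [abs_le]; constructor <;> linarith
  have h3 : |heatKernel b x - heatKernel a x| ≤ 36 * min 1 ((b - a) / a) * (gk a x + gk b x) := by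
    rcases le_total 1 ((b - a) / a) with h | h
    · rw [min_eq_left h, mul_one]; exact h2
    · rw [min_eq_right h]; exact h1
  have h4 : (heatKernel b x - heatKernel a x) ^ 2 ≤
      (36 * min 1 ((b - a) / a) * (gk a x + gk b x)) ^ 2 := by
    rw [← sq_abs]
    exact pow_le_pow_left₀ (abs_nonneg _) h3 2
  have h5 := min_one_sq_le_rpow hba
  have h6 : ((b - a) / a) ^ (1 / 4 : ℝ) = (b - a) ^ (1 / 4 : ℝ) * a ^ (-(1 / 4) : ℝ) := by
    rw [Real.div_rpow (sub_nonneg.2 hab) ha.le, Real.rpow_neg ha.le, div_eq_mul_inv]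
  rw [h6] at h5
  have h7 : (gk a x + gk b x) ^ 2 ≤ 2 * (gk a x ^ 2 + gk b x ^ 2) := by
    nlinarith [sq_nonneg (gk a x - gk b x)]
  calc _ ≤ _ := h4
    _ = 1296 * min 1 ((b - a) / a) ^ 2 * (gk a x + gk b x) ^ 2 := by ring
    _ ≤ 1296 * ((b - a) ^ (1 / 4 : ℝ) * a ^ (-(1 / 4) : ℝ)) * (2 * (gk a x ^ 2 + gk b x ^ 2)) := by
        gcongr
    _ = _ := by ring


/-! ### The Duhamel kernel acting on squared profiles. -/

/-- The kernel `1_{(0, t)}(r) p_{t - r}(x - y)` of the mild formulation. -/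
def duhamelKernel (t : ℝ≥0) (x : Torus) (r : ℝ≥0) (y : Torus) : ℝ :=
  (Set.Ioo 0 t).indicator (fun r : ℝ≥0 => heatKernel ((t : ℝ) - r) (x - y)) r

theorem lintegral_heatKernel_sq_mul_smooth_sq_le {f : Torus → ℝ≥0∞} (hf : Measurable f)
    {a r : ℝ} (ha : 0 < a) (ha1 : a ≤ 1) (hr : 0 < r) (x : Torus) :
    ∫⁻ y, ENNReal.ofReal (heatKernel a (x - y) ^ 2) * smooth f r y ^ 2 ≤
      10368 * ENNReal.ofReal (1 / √a + 1 / √r) * smooth f (a + r) x ^ 2 := by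
  have h1 : ∀ y, ENNReal.ofReal (heatKernel a (x - y) ^ 2) * smooth f r y ^ 2 ≤
      324 * (ENNReal.ofReal (gk a (x - y)) ^ 2 * smooth f r y ^ 2) := by
    intro y
    rw [← mul_assoc]
    gcongr
    rw [ENNReal.ofReal_pow (heatKernel_nonneg _ _)]
    refine (pow_le_pow_left' (ENNReal.ofReal_le_ofReal (heatKernel_le ha ha1 _)) 2).trans_eq ?_
    rw [ENNReal.ofReal_mul (by norm_num), mul_pow]
    norm_num
  refine (lintegral_mono h1).trans ?_
  rw [lintegral_const_mul' _ _ (by norm_num)]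
  refine (mul_le_mul_right (lintegral_gk_sq_mul_smooth_sq_le hf ha hr x) _).trans_eq ?_
  rw [← mul_assoc, ← mul_assoc]
  norm_num

theorem lintegral_heatKernel_sub_sq_mul_smooth_sq_le {f : Torus → ℝ≥0∞} (hf : Measurable f)
    {a b r : ℝ} (ha : 0 < a) (hab : a ≤ b) (hb : b ≤ 1) (hr : 0 < r) (x : Torus) :
    ∫⁻ y, ENNReal.ofReal ((heatKernel b (x - y) - heatKernel a (x - y)) ^ 2) * smooth f r y ^ 2 ≤
      165888 * ENNReal.ofReal ((b - a) ^ (1 / 4 : ℝ)) *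
        ENNReal.ofReal (a ^ (-(3 / 4) : ℝ) + r ^ (-(3 / 4) : ℝ)) *
        (smooth f (a + r) x ^ 2 + smooth f (b + r) x ^ 2) := by
  have hb0 := ha.trans_le hab
  obtain ⟨K, hK⟩ : ∃ K, K = 2592 * (b - a) ^ (1 / 4 : ℝ) * a ^ (-(1 / 4) : ℝ) := ⟨_, rfl⟩
  have hba := Real.rpow_nonneg (sub_nonneg.2 hab) (1 / 4)
  have hK0 : 0 ≤ K := by rw [hK]; positivity
  have h1 : ∀ y, ENNReal.ofReal ((heatKernel b (x - y) - heatKernel a (x - y)) ^ 2) *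
      smooth f r y ^ 2 ≤ ENNReal.ofReal K * (ENNReal.ofReal (gk a (x - y)) ^ 2 * smooth f r y ^ 2 +
        ENNReal.ofReal (gk b (x - y)) ^ 2 * smooth f r y ^ 2) := by
    intro y
    rw [← add_mul, ← mul_assoc, ← ENNReal.ofReal_pow (gk_nonneg ha.le _),
      ← ENNReal.ofReal_pow (gk_nonneg hb0.le _), ← ENNReal.ofReal_add (sq_nonneg _) (sq_nonneg _),
      ← ENNReal.ofReal_mul hK0]
    gcongr
    rw [hK]
    exact heatKernel_sub_sq_le ha hab hb _
  refine (lintegral_mono h1).trans ?_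
  have hmeas : Measurable fun y => ENNReal.ofReal (gk a (x - y)) ^ 2 * smooth f r y ^ 2 :=
    ((((measurable_gk a).comp (measurable_const.sub measurable_id)).ennreal_ofReal).pow_const 2).mul
      ((measurable_smooth hf r).pow_const 2)
  rw [lintegral_const_mul' _ _ ENNReal.ofReal_ne_top, lintegral_add_left hmeas]
  have h2 := lintegral_gk_sq_mul_smooth_sq_le hf ha hr x
  have h3 := lintegral_gk_sq_mul_smooth_sq_le hf hb0 hr x
  have h4 : ENNReal.ofReal (1 / √b + 1 / √r) ≤ ENNReal.ofReal (1 / √a + 1 / √r) := by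
    gcongr
  have h5 : ENNReal.ofReal K * (32 * ENNReal.ofReal (1 / √a + 1 / √r)) ≤
      165888 * ENNReal.ofReal ((b - a) ^ (1 / 4 : ℝ)) *
        ENNReal.ofReal (a ^ (-(3 / 4) : ℝ) + r ^ (-(3 / 4) : ℝ)) := by
    rw [show (32 : ℝ≥0∞) = ENNReal.ofReal 32 by simp,
      show (165888 : ℝ≥0∞) = ENNReal.ofReal 165888 by simp,
      ← ENNReal.ofReal_mul (by norm_num), ← ENNReal.ofReal_mul hK0,
      ← ENNReal.ofReal_mul (by norm_num), ← ENNReal.ofReal_mul (by positivity)]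
    refine ENNReal.ofReal_le_ofReal ?_
    rw [hK]
    have := mul_le_mul_of_nonneg_left (rpow_mul_inv_sqrt_add_le ha hr)
      (mul_nonneg (show (0 : ℝ) ≤ 82944 by norm_num) hba)
    linarith
  calc _ ≤ ENNReal.ofReal K * (32 * ENNReal.ofReal (1 / √a + 1 / √r) * smooth f (a + r) x ^ 2 +
        32 * ENNReal.ofReal (1 / √a + 1 / √r) * smooth f (b + r) x ^ 2) := by
        gcongr
        exact h3.trans (by gcongr)
    _ = ENNReal.ofReal K * (32 * ENNReal.ofReal (1 / √a + 1 / √r)) *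
        (smooth f (a + r) x ^ 2 + smooth f (b + r) x ^ 2) := by ring
    _ ≤ _ := by gcongr

/-- The time arguments `(s - r) + r` and `(t - r) + r` of the resulting profiles do not depend on
`r`, so the profiles leave the time integral. Times `r < s` see the difference of two heat kernels,
times `s ≤ r < t` only the later one. The constant is `8 · 165888 + 8 · 10368`. -/
theorem lintegral_duhamelKernel_sub_sq_le {f : Torus → ℝ≥0∞} (hf : Measurable f) {s t T : ℝ≥0}
    (hst : s ≤ t) (htT : t ≤ T) (hT : T ≤ 1) (x : Torus) :
    ∫⁻ r, (∫⁻ y, ENNReal.ofReal ((duhamelKernel t x r y - duhamelKernel s x r y) ^ 2) *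
        smooth f r y ^ 2) ∂timeMeasure ≤
      1410048 * ENNReal.ofReal (((t : ℝ) - s) ^ (1 / 4 : ℝ) * (T : ℝ) ^ (1 / 4 : ℝ)) *
        (smooth f t x ^ 2 + smooth f s x ^ 2) := by
  have hst' : (s : ℝ) ≤ t := hst
  have htT' : (t : ℝ) ≤ T := htT
  have hT' : (T : ℝ) ≤ 1 := hT
  have hts := Real.rpow_nonneg (sub_nonneg.2 hst') (1 / 4)
  have hTT := Real.rpow_nonneg T.coe_nonneg (1 / 4)
  obtain ⟨S, hS⟩ : ∃ S, S = smooth f t x ^ 2 + smooth f s x ^ 2 := ⟨_, rfl⟩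
  have hpt : ∀ r : ℝ≥0, ∫⁻ y, ENNReal.ofReal ((duhamelKernel t x r y - duhamelKernel s x r y) ^ 2) *
        smooth f r y ^ 2 ≤
      (Set.Ico 0 s).indicator (fun r : ℝ≥0 => 165888 * ENNReal.ofReal (((t : ℝ) - s) ^ (1 / 4 : ℝ)) *
        S * ENNReal.ofReal (timeWeight s r)) r +
      (Set.Ico s t).indicator (fun r : ℝ≥0 => 10368 * ENNReal.ofReal ((T : ℝ) ^ (1 / 4 : ℝ)) *
        S * ENNReal.ofReal (timeWeight t r)) r := by
    intro r
    rcases eq_or_ne r 0 with rfl | hr0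
    · simp [duhamelKernel]
    have hr : 0 < r := pos_iff_ne_zero.2 hr0
    have hr' : (0 : ℝ) < r := hr
    by_cases hrs : r < s
    · have hrs' : (r : ℝ) < s := hrs
      have e1 : ∀ y, duhamelKernel s x r y = heatKernel ((s : ℝ) - r) (x - y) := fun y =>
        Set.indicator_of_mem (show r ∈ Set.Ioo 0 s from ⟨hr, hrs⟩) _
      have e2 : ∀ y, duhamelKernel t x r y = heatKernel ((t : ℝ) - r) (x - y) := fun y =>
        Set.indicator_of_mem (show r ∈ Set.Ioo 0 t from ⟨hr, hrs.trans_le hst⟩) _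
      simp_rw [e1, e2]
      rw [Set.indicator_of_mem (show r ∈ Set.Ico 0 s from ⟨zero_le, hrs⟩)]
      refine le_add_right ?_
      refine (lintegral_heatKernel_sub_sq_mul_smooth_sq_le hf (sub_pos.2 hrs') (by linarith)
        (by linarith) hr' x).trans_eq ?_
      rw [hS, sub_add_cancel, sub_add_cancel, sub_sub_sub_cancel_right, timeWeight,
        add_comm (smooth f s x ^ 2)]
      ring
    · by_cases hrt : r < t
      · have hrt' : (r : ℝ) < t := hrt
        have e1 : ∀ y, duhamelKernel s x r y = 0 := fun y =>
          Set.indicator_of_notMem (fun h => hrs h.2) _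
        have e2 : ∀ y, duhamelKernel t x r y = heatKernel ((t : ℝ) - r) (x - y) := fun y =>
          Set.indicator_of_mem (show r ∈ Set.Ioo 0 t from ⟨hr, hrt⟩) _
        simp_rw [e1, e2, sub_zero]
        rw [Set.indicator_of_mem (show r ∈ Set.Ico s t from ⟨not_lt.1 hrs, hrt⟩)]
        refine le_add_left ?_
        refine (lintegral_heatKernel_sq_mul_smooth_sq_le hf (sub_pos.2 hrt')
          (by linarith) hr' x).trans ?_
        rw [sub_add_cancel]
        have h1 : ENNReal.ofReal (1 / √((t : ℝ) - r) + 1 / √(r : ℝ)) ≤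
            ENNReal.ofReal ((T : ℝ) ^ (1 / 4 : ℝ)) * ENNReal.ofReal (timeWeight t r) := by
          rw [← ENNReal.ofReal_mul hTT]
          refine ENNReal.ofReal_le_ofReal ?_
          rw [timeWeight, mul_add]
          exact add_le_add (inv_sqrt_le (sub_pos.2 hrt') (by linarith))
            (inv_sqrt_le hr' (by linarith))
        calc _ ≤ 10368 * (ENNReal.ofReal ((T : ℝ) ^ (1 / 4 : ℝ)) *
              ENNReal.ofReal (timeWeight t r)) * S := by
              gcongr
              rw [hS]; exact le_self_add
          _ = _ := by ring
      · have e1 : ∀ y, duhamelKernel s x r y = 0 := fun y =>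
          Set.indicator_of_notMem (fun h => hrs h.2) _
        have e2 : ∀ y, duhamelKernel t x r y = 0 := fun y =>
          Set.indicator_of_notMem (fun h => hrt h.2) _
        simp [e1, e2]
  have hm : ∀ u : ℝ, Measurable fun r : ℝ≥0 => ENNReal.ofReal (timeWeight u r) := fun u =>
    ((measurable_timeWeight u).comp measurable_coe_nnreal_real).ennreal_ofReal
  refine (lintegral_mono hpt).trans ?_
  rw [lintegral_add_left (((hm s).const_mul _).indicator measurableSet_Ico),
    lintegral_indicator measurableSet_Ico, lintegral_indicator measurableSet_Ico,
    lintegral_const_mul _ (hm s), lintegral_const_mul _ (hm t), ← hS]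
  have h1 := lintegral_timeWeight_le (zero_le (a := s))
  have h2 := lintegral_timeWeight_le hst
  have h3 : ENNReal.ofReal (((s : ℝ) - (0 : ℝ≥0)) ^ (1 / 4 : ℝ)) ≤
      ENNReal.ofReal ((T : ℝ) ^ (1 / 4 : ℝ)) := by
    refine ENNReal.ofReal_le_ofReal (Real.rpow_le_rpow ?_ ?_ (by norm_num))
    · simp
    · simpa using hst'.trans htT'
  obtain ⟨A, hA⟩ : ∃ A, A = ENNReal.ofReal (((t : ℝ) - s) ^ (1 / 4 : ℝ)) := ⟨_, rfl⟩
  obtain ⟨B, hB⟩ : ∃ B, B = ENNReal.ofReal ((T : ℝ) ^ (1 / 4 : ℝ)) := ⟨_, rfl⟩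
  rw [ENNReal.ofReal_mul hts, ← hA, ← hB]
  rw [← hB] at h3
  rw [← hA] at h2
  calc _ ≤ 165888 * A * S * (8 * B) + 10368 * B * S * (8 * A) := by
        gcongr
        exact h1.trans (by gcongr)
    _ = 1410048 * (A * B) * S := by ring

/-- The increment bound with `s = 0`, where both the kernel and the profile vanish. -/
theorem lintegral_duhamelKernel_sq_mul_smooth_sq_le {f : Torus → ℝ≥0∞} (hf : Measurable f)
    {t T : ℝ≥0} (htT : t ≤ T) (hT : T ≤ 1) (x : Torus) :
    ∫⁻ r, (∫⁻ y, ENNReal.ofReal (duhamelKernel t x r y ^ 2) * smooth f r y ^ 2) ∂timeMeasure ≤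
      1410048 * ENNReal.ofReal √T * smooth f t x ^ 2 := by
  have h := lintegral_duhamelKernel_sub_sq_le hf (zero_le (a := t)) htT hT x
  have e : ∀ r y, duhamelKernel 0 x r y = 0 := fun r y => by simp [duhamelKernel]
  simp only [e, sub_zero, NNReal.coe_zero, smooth_zero, ne_eq, OfNat.ofNat_ne_zero,
    not_false_eq_true, zero_pow, add_zero] at h
  refine h.trans ?_
  gcongr
  have : √(T : ℝ) = (T : ℝ) ^ (1 / 4 : ℝ) * (T : ℝ) ^ (1 / 4 : ℝ) := by
    rw [Real.sqrt_eq_rpow, ← Real.rpow_add_of_nonneg T.coe_nonneg (by norm_num) (by norm_num)]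
    norm_num
  rw [this]
  gcongr

/-- Controls the constant remainder in the iteration. The constant is enlarged from 10368 so that
one smallness condition serves this bound and the previous one. -/
theorem lintegral_duhamelKernel_sq_le {t T : ℝ≥0} (htT : t ≤ T) (hT : T ≤ 1) (x : Torus) :
    ∫⁻ r, (∫⁻ y, ENNReal.ofReal (duhamelKernel t x r y ^ 2)) ∂timeMeasure ≤
      1410048 * ENNReal.ofReal √T := by
  have htT' : (t : ℝ) ≤ T := htT
  have hT' : (T : ℝ) ≤ 1 := hT
  have hTT := Real.rpow_nonneg T.coe_nonneg (1 / 4)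
  have hpt : ∀ r : ℝ≥0, ∫⁻ y, ENNReal.ofReal (duhamelKernel t x r y ^ 2) ≤
      (Set.Ico 0 t).indicator (fun r : ℝ≥0 => 1296 * ENNReal.ofReal ((T : ℝ) ^ (1 / 4 : ℝ)) *
        ENNReal.ofReal (timeWeight t r)) r := by
    intro r
    by_cases hr : r ∈ Set.Ioo 0 t
    · have hrt : (r : ℝ) < t := hr.2
      have hr0 : (0 : ℝ) < r := hr.1
      rw [Set.indicator_of_mem (show r ∈ Set.Ico 0 t from ⟨zero_le, hr.2⟩)]
      have e : ∀ y, ENNReal.ofReal (duhamelKernel t x r y ^ 2) ≤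
          324 * ENNReal.ofReal (gk ((t : ℝ) - r) (x - y)) ^ 2 := by
        intro y
        rw [duhamelKernel, Set.indicator_of_mem hr, ENNReal.ofReal_pow (heatKernel_nonneg _ _)]
        refine (pow_le_pow_left' (ENNReal.ofReal_le_ofReal (heatKernel_le (sub_pos.2 hrt)
          (by linarith) _)) 2).trans_eq ?_
        rw [ENNReal.ofReal_mul (by norm_num), mul_pow]
        norm_num
      refine (lintegral_mono e).trans ?_
      rw [lintegral_const_mul' _ _ (by norm_num), lintegral_sub_left_eq_self
        (fun y => ENNReal.ofReal (gk ((t : ℝ) - r) y) ^ 2) x]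
      refine (mul_le_mul_right (lintegral_gk_sq_le (sub_pos.2 hrt)) _).trans ?_
      rw [mul_assoc 1296, ← ENNReal.ofReal_mul hTT, ← mul_assoc, show (324 : ℝ≥0∞) * 4 = 1296 by
        norm_num]
      gcongr
      refine (inv_sqrt_le (sub_pos.2 hrt) (show (t : ℝ) - r ≤ T by linarith)).trans ?_
      rw [timeWeight]
      gcongr
      exact le_add_of_nonneg_right (Real.rpow_nonneg hr0.le _)
    · simp [duhamelKernel, Set.indicator_of_notMem hr]
  refine (lintegral_mono hpt).trans ?_
  rw [lintegral_indicator measurableSet_Ico, lintegral_const_mul' _ _ (by finiteness)]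
  refine (mul_le_mul_right (lintegral_timeWeight_le zero_le) _).trans ?_
  have h3 : ENNReal.ofReal (((t : ℝ) - (0 : ℝ≥0)) ^ (1 / 4 : ℝ)) ≤
      ENNReal.ofReal ((T : ℝ) ^ (1 / 4 : ℝ)) := by
    refine ENNReal.ofReal_le_ofReal (Real.rpow_le_rpow ?_ ?_ (by norm_num))
    · simp
    · simpa using htT'
  have : √(T : ℝ) = (T : ℝ) ^ (1 / 4 : ℝ) * (T : ℝ) ^ (1 / 4 : ℝ) := by
    rw [Real.sqrt_eq_rpow, ← Real.rpow_add_of_nonneg T.coe_nonneg (by norm_num) (by norm_num)]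
    norm_num
  rw [this, ENNReal.ofReal_mul hTT]
  obtain ⟨B, hB⟩ : ∃ B, B = ENNReal.ofReal ((T : ℝ) ^ (1 / 4 : ℝ)) := ⟨_, rfl⟩
  rw [← hB] at h3 ⊢
  calc _ ≤ 1296 * B * (8 * B) := by gcongr
    _ = 10368 * (B * B) := by ring
    _ ≤ 1410048 * (B * B) := by gcongr; norm_num

end

section

variable {Ω : Type*} {mΩ : MeasurableSpace Ω} {P : Measure Ω}
variable {𝓕 : Filtration ℝ≥0 mΩ} {W : Set (ℝ≥0 × Torus) → Ω → ℝ}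

/-! ### Moments of the solution -/

theorem measurable_mk_predictable (r : ℝ≥0) :
    Measurable[𝓕 r, 𝓕.predictable] fun ω : Ω => (r, ω) := by
  refine @measurable_generateFrom _ _ (𝓕 r) _ _ ?_
  rintro s (⟨A, hA, rfl⟩ | ⟨i, A, hA, rfl⟩)
  · by_cases h : r = ⊥
    · have : (fun ω : Ω => (r, ω)) ⁻¹' ({⊥} ×ˢ A) = A := by ext; simp [h]
      rw [this]
      exact 𝓕.mono bot_le _ hA
    · have : (fun ω : Ω => (r, ω)) ⁻¹' ({⊥} ×ˢ A) = ∅ := by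
        ext ω
        simp only [Set.mem_preimage, Set.mem_prod, Set.mem_singleton_iff, Set.mem_empty_iff_false,
          iff_false]
        exact fun h' => h h'.1
      rw [this]
      exact @MeasurableSet.empty _ (𝓕 r)
  · by_cases h : i < r
    · have : (fun ω : Ω => (r, ω)) ⁻¹' (Set.Ioi i ×ˢ A) = A := by ext; simp [h]
      rw [this]
      exact 𝓕.mono h.le _ hA
    · have : (fun ω : Ω => (r, ω)) ⁻¹' (Set.Ioi i ×ˢ A) = ∅ := by ext; simp [h]
      rw [this]
      exact @MeasurableSet.empty _ (𝓕 r)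

theorem IsPredictableField.measurable_section {Φ : ℝ≥0 → Torus → Ω → ℝ}
    (h : IsPredictableField 𝓕 Φ) (r : ℝ≥0) (y : Torus) : Measurable[𝓕 r] (Φ r y) := by
  have h1 : @Measurable _ _ (𝓕 r) (predictableField 𝓕) fun ω : Ω => ((r, ω), y) :=
    Measurable.prodMk (m := 𝓕 r) (measurable_mk_predictable r)
      measurable_const
  exact Measurable.comp
    (g := fun p : (ℝ≥0 × Ω) × Torus => Φ p.1.1 p.2 p.1.2) h h1

theorem IsPredictableField.indicator {Φ : ℝ≥0 → Torus → Ω → ℝ} (h : IsPredictableField 𝓕 Φ)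
    {B : Set (ℝ≥0 × Ω)} (hB : MeasurableSet[𝓕.predictable] B) :
    IsPredictableField 𝓕 fun s y ω => B.indicator (fun _ => Φ s y ω) (s, ω) := by
  have h1 : MeasurableSet[predictableField 𝓕] (Prod.fst ⁻¹' B : Set ((ℝ≥0 × Ω) × Torus)) :=
    (@measurable_fst _ _ 𝓕.predictable _) hB
  exact Measurable.indicator (m := predictableField 𝓕)
    (f := fun p : (ℝ≥0 × Ω) × Torus => Φ p.1.1 p.2 p.1.2) h h1

theorem IsPredictableField.sub {Φ Ψ : ℝ≥0 → Torus → Ω → ℝ} (hΦ : IsPredictableField 𝓕 Φ)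
    (hΨ : IsPredictableField 𝓕 Ψ) : IsPredictableField 𝓕 fun s y ω => Φ s y ω - Ψ s y ω :=
  Measurable.sub (m := predictableField 𝓕)
    (f := fun p : (ℝ≥0 × Ω) × Torus => Φ p.1.1 p.2 p.1.2)
    (g := fun p : (ℝ≥0 × Ω) × Torus => Ψ p.1.1 p.2 p.1.2) hΦ hΨ

theorem IsWalshIntegral.sub {Φ Ψ : ℝ≥0 → Torus → Ω → ℝ} {X Y : Ω → ℝ} [SFinite P]
    (hW : IsWhiteNoise 𝓕 P W)
    (hΦ : IsWalshIntegral 𝓕 P W Φ X) (hΨ : IsWalshIntegral 𝓕 P W Ψ Y) :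
    IsWalshIntegral 𝓕 P W (fun s y ω => Φ s y ω - Ψ s y ω) (fun ω => X ω - Y ω) := by
  obtain ⟨h1, hX, L, hL1, hL2⟩ := hΦ
  obtain ⟨h2, hY, M, hM1, hM2⟩ := hΨ
  refine ⟨h1.sub h2, hX.sub hY, fun k => L k ++ (M k).map (ElementaryField.smul (-1)), ?_, ?_⟩
  · have h3 := hL1.add hM1
    rw [add_zero] at h3
    refine tendsto_of_tendsto_of_tendsto_of_le_of_le tendsto_const_nhds h3 (fun _ => zero_le)
      fun k => ?_
    have e : (fun p : (ℝ≥0 × Ω) × Torus => listField (L k ++ (M k).map (ElementaryField.smul (-1)))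
        p.1.1 p.2 p.1.2 - (Φ p.1.1 p.2 p.1.2 - Ψ p.1.1 p.2 p.1.2)) =
        (fun p : (ℝ≥0 × Ω) × Torus => listField (L k) p.1.1 p.2 p.1.2 - Φ p.1.1 p.2 p.1.2) -
        (fun p : (ℝ≥0 × Ω) × Torus => listField (M k) p.1.1 p.2 p.1.2 - Ψ p.1.1 p.2 p.1.2) := by
      ext p
      rw [listField_append, listField_map_smul, Pi.sub_apply]
      ring
    have hm : ∀ N : List (ElementaryField 𝓕), Measurable fun p : (ℝ≥0 × Ω) × Torus =>
        listField N p.1.1 p.2 p.1.2 := fun N => (jointlyMeasurable_listField N).comp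
      ((measurable_fst.fst.prodMk measurable_snd).prodMk measurable_fst.snd)
    change eLpNorm (fun p : (ℝ≥0 × Ω) × Torus => listField _ p.1.1 p.2 p.1.2 - _) 2 _ ≤ _
    rw [e]
    exact eLpNorm_sub_le ((hm _).sub h1.measurable).aestronglyMeasurable
      ((hm _).sub h2.measurable).aestronglyMeasurable (by norm_num)
  · have h3 := hL2.add hM2
    rw [add_zero] at h3
    refine tendsto_of_tendsto_of_tendsto_of_le_of_le tendsto_const_nhds h3 (fun _ => zero_le)
      fun k => ?_
    have e : (fun ω => listInt W (L k ++ (M k).map (ElementaryField.smul (-1))) ω - (X ω - Y ω)) =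
        (fun ω => listInt W (L k) ω - X ω) - (fun ω => listInt W (M k) ω - Y ω) := by
      ext ω
      rw [listInt_append, listInt_map_smul, Pi.sub_apply]
      ring
    change eLpNorm (fun ω => listInt W _ ω - _) 2 _ ≤ _
    rw [e]
    exact eLpNorm_sub_le ((measurable_listInt hW _).aestronglyMeasurable.sub hX.1)
      ((measurable_listInt hW _).aestronglyMeasurable.sub hY.1) (by norm_num)

theorem isWalshIntegral_zero :
    IsWalshIntegral 𝓕 P W (fun _ _ _ => 0) (fun _ => 0) := by
  refine ⟨@measurable_const _ _ _ (predictableField 𝓕) 0, MemLp.zero, fun _ => [], ?_, ?_⟩ <;> simp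

/-- The times before which a field is bounded by `K` on a countable dense set of space-time
points. -/
def boundedSet (u : ℝ≥0 → Torus → Ω → ℝ) (K : ℝ) : Set (ℝ≥0 × Ω) :=
  {p | ∀ i j : ℕ, TopologicalSpace.denseSeq ℝ≥0 i < p.1 →
    |u (TopologicalSpace.denseSeq ℝ≥0 i) (TopologicalSpace.denseSeq Torus j) p.2| ≤ K}

/-- Testing countably many points at strictly earlier times makes the complement a countable union
of predictable rectangles `(τ, ∞) × {K < |u(τ, x)|}`. -/
theorem measurableSet_boundedSet {u : ℝ≥0 → Torus → Ω → ℝ} (hu : IsPredictableField 𝓕 u) (K : ℝ) :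
    MeasurableSet[𝓕.predictable] (boundedSet u K) := by
  have h : boundedSet u K = (⋃ i : ℕ, ⋃ j : ℕ, Set.Ioi (TopologicalSpace.denseSeq ℝ≥0 i) ×ˢ
      {ω | K < |u (TopologicalSpace.denseSeq ℝ≥0 i) (TopologicalSpace.denseSeq Torus j) ω|})ᶜ := by
    ext p
    simp [boundedSet]
  rw [h]
  refine MeasurableSet.compl (m := 𝓕.predictable) (MeasurableSet.iUnion fun i =>
    MeasurableSet.iUnion fun j => measurableSet_predictable_Ioi_prod ?_)
  exact measurableSet_lt (mδ := 𝓕 _) measurable_const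
    (Measurable.comp continuous_abs.measurable (hu.measurable_section _ _))

theorem boundedSet_anti {u : ℝ≥0 → Torus → Ω → ℝ} {K : ℝ} {r s : ℝ≥0} {ω : Ω} (hrs : r ≤ s)
    (h : (s, ω) ∈ boundedSet u K) : (r, ω) ∈ boundedSet u K :=
  fun i j hi => h i j (lt_of_lt_of_le hi hrs)

/-- Continuity extends the bound from the dense points to all earlier times, then to `t` itself. At
`t = 0` the constraint is empty, hence the positivity of `t`. -/
theorem abs_le_of_mem_boundedSet {u : ℝ≥0 → Torus → Ω → ℝ} {K : ℝ} {t : ℝ≥0} {ω : Ω}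
    (hc : Continuous fun p : ℝ≥0 × Torus => u p.1 p.2 ω) (ht : 0 < t)
    (h : (t, ω) ∈ boundedSet u K) (x : Torus) : |u t x ω| ≤ K := by
  have h1 : IsClosed {p : ℝ≥0 × Torus | |u p.1 p.2 ω| ≤ K} :=
    isClosed_le hc.abs continuous_const
  have h2 : ∀ r < t, ∀ y, |u r y ω| ≤ K := by
    intro r hr y
    have hd : Dense (Set.range (TopologicalSpace.denseSeq ℝ≥0) ×ˢ
        Set.range (TopologicalSpace.denseSeq Torus)) :=
      (TopologicalSpace.denseRange_denseSeq _).prod (TopologicalSpace.denseRange_denseSeq _)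
    have ho : IsOpen (Set.Iio t ×ˢ (Set.univ : Set Torus)) := isOpen_Iio.prod isOpen_univ
    have hmem : (r, y) ∈ closure (Set.Iio t ×ˢ (Set.univ : Set Torus) ∩
        (Set.range (TopologicalSpace.denseSeq ℝ≥0) ×ˢ
        Set.range (TopologicalSpace.denseSeq Torus))) :=
      hd.open_subset_closure_inter ho ⟨hr, Set.mem_univ _⟩
    refine (closure_minimal ?_ h1) hmem
    rintro ⟨r', y'⟩ ⟨⟨hr', -⟩, ⟨i, hi⟩, ⟨j, hj⟩⟩
    simp only at hi hj
    subst hi hj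
    exact h i j hr'
  have hmem : t ∈ closure (Set.Iio t) := by
    rw [closure_Iio' (a := t) ⟨0, ht⟩]
    exact Set.self_mem_Iic
  have h3 : IsClosed {r : ℝ≥0 | |u r x ω| ≤ K} :=
    isClosed_le (hc.comp (continuous_id.prodMk continuous_const)).abs continuous_const
  exact (closure_minimal (fun r hr => h2 r hr x) h3) hmem

theorem exists_mem_boundedSet {u : ℝ≥0 → Torus → Ω → ℝ} {ω : Ω}
    (hc : Continuous fun p : ℝ≥0 × Torus => u p.1 p.2 ω) (t : ℝ≥0) :
    ∀ᶠ K : ℕ in atTop, (t, ω) ∈ boundedSet u K := by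
  have hcomp : IsCompact (Set.Icc 0 t ×ˢ (Set.univ : Set Torus)) := isCompact_Icc.prod isCompact_univ
  obtain ⟨C, hC⟩ := (hcomp.bddAbove_image (f := fun p : ℝ≥0 × Torus => |u p.1 p.2 ω|)
    hc.abs.continuousOn)
  obtain ⟨K, hK⟩ := exists_nat_ge C
  filter_upwards [eventually_ge_atTop K] with k hk i j hi
  have h1 := hC (Set.mem_image_of_mem _ (show (TopologicalSpace.denseSeq ℝ≥0 i,
    TopologicalSpace.denseSeq Torus j) ∈ Set.Icc 0 t ×ˢ (Set.univ : Set Torus) from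
    ⟨⟨zero_le, le_of_lt hi⟩, Set.mem_univ _⟩))
  exact h1.trans (hK.trans (by exact_mod_cast hk))

theorem enorm_heatSemigroup_le {u₀ : Torus → ℝ} (h0 : ∀ x, 0 ≤ u₀ x) {t : ℝ} (ht : 0 < t)
    (ht1 : t ≤ 1) (x : Torus) :
    ‖heatSemigroup t u₀ x‖ₑ ≤ 18 * smooth (fun y => ENNReal.ofReal (u₀ y)) t x := by
  unfold heatSemigroup smooth
  rw [← lintegral_const_mul' _ _ (by norm_num)]
  refine (enorm_integral_le_lintegral_enorm _).trans (lintegral_mono fun y => ?_)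
  rw [Real.enorm_of_nonneg (mul_nonneg (heatKernel_nonneg _ _) (h0 y)),
    ENNReal.ofReal_mul (heatKernel_nonneg _ _), mul_comm, mul_left_comm]
  gcongr
  refine (ENNReal.ofReal_le_ofReal (heatKernel_le ht ht1 _)).trans_eq ?_
  rw [ENNReal.ofReal_mul (by norm_num)]
  norm_num

theorem measurable_duhamelKernel (t : ℝ≥0) (x : Torus) :
    Measurable fun p : ℝ≥0 × Torus => duhamelKernel t x p.1 p.2 := by
  have : (fun p : ℝ≥0 × Torus => duhamelKernel t x p.1 p.2) =
      (Prod.fst ⁻¹' Set.Ioo 0 t).indicator fun p => heatKernel ((t : ℝ) - p.1) (x - p.2) := by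
    ext p; rfl
  rw [this]
  refine Measurable.indicator ?_ (measurable_fst measurableSet_Ioo)
  exact measurable_heatKernel_uncurry.comp
    ((measurable_const.sub measurable_fst.coe_nnreal_real).prodMk
      (measurable_const.sub measurable_snd))

section Solution

variable {σ : ℝ → ℝ} {ϖ : ℝ≥0} {u₀ : Torus → ℝ} {u : ℝ≥0 → Torus → Ω → ℝ} {T : ℝ≥0} {n : ℕ}

theorem mom_comp_le (hσ : LipschitzWith ϖ σ) (hσ0 : σ 0 = 0) (hn : n ≠ 0) (X : Ω → ℝ) :
    mom P n (fun ω => σ (X ω)) ≤ (ϖ : ℝ≥0∞) ^ 2 * mom P n X := by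
  have h : ((ϖ : ℝ≥0∞)) = ‖(ϖ : ℝ)‖ₑ := by simp
  rw [h, ← mom_const_mul hn]
  refine mom_mono_ae (ae_of_all _ fun ω => ?_)
  rw [enorm_mul, ← h]
  have := hσ (X ω) 0
  rwa [hσ0, edist_zero_right, edist_zero_right] at this

/-- The localized moment bound behind the a priori estimate. -/
theorem mom_boundedSet_le [IsProbabilityMeasure P] (hW : IsWhiteNoise 𝓕 P W)
    (hσ : LipschitzWith ϖ σ) (hσ0 : σ 0 = 0) (h0 : ∀ x, 0 ≤ u₀ x)
    (hu : IsMildSolution 𝓕 P W σ u₀ u) (hn : n ≠ 0) (K : ℝ) (hT : T ≤ 1) {t : ℝ≥0} (ht : 0 < t)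
    (htT : t ≤ T) (x : Torus) :
    mom P n ({ω | (t, ω) ∈ boundedSet u K}.indicator (u t x)) ≤
      648 * smooth (fun y => ENNReal.ofReal (u₀ y)) t x ^ 2 +
      24 * n * (ϖ : ℝ≥0∞) ^ 2 * ∫⁻ r, (∫⁻ y, ENNReal.ofReal (duhamelKernel t x r y ^ 2) *
        mom P n ({ω | (r, ω) ∈ boundedSet u K}.indicator (u r y))) ∂timeMeasure := by
  have hB := measurableSet_boundedSet hu.predictable K
  have hGm : ∀ r, MeasurableSet {ω | (r, ω) ∈ boundedSet u K} := fun r =>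
    𝓕.le r _ (measurable_mk_predictable r hB)
  have hmild := hu.mild t ht x
  obtain ⟨c, hc⟩ : ∃ c, c = heatSemigroup t u₀ x := ⟨_, rfl⟩
  have hsplit : {ω | (t, ω) ∈ boundedSet u K}.indicator (u t x) =
      fun ω => {ω | (t, ω) ∈ boundedSet u K}.indicator (fun _ => c) ω +
        {ω | (t, ω) ∈ boundedSet u K}.indicator (fun ω => u t x ω - heatSemigroup t u₀ x) ω := by
    ext ω
    by_cases h : (t, ω) ∈ boundedSet u K <;> simp [Set.indicator, h, hc]
  have hum : ∀ r y, Measurable (u r y) := fun r y =>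
    hu.predictable.jointlyMeasurable.section r y
  rw [hsplit]
  refine (mom_add_le hn (measurable_const.indicator (hGm t)).aemeasurable
    (((hum t x).sub measurable_const).indicator (hGm t)).aemeasurable).trans (add_le_add ?_ ?_)
  · have h1 : mom P n ({ω | (t, ω) ∈ boundedSet u K}.indicator (fun _ => c)) ≤ ‖c‖ₑ ^ 2 :=
      mom_le_of_bounded hn (ae_of_all _ fun ω => by
        by_cases h : (t, ω) ∈ boundedSet u K <;> simp [Set.indicator, h])
    have h2 := enorm_heatSemigroup_le h0 (t := t) ht (by exact_mod_cast htT.trans hT) x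
    rw [hc] at h1
    calc _ ≤ 2 * (18 * smooth (fun y => ENNReal.ofReal (u₀ y)) t x) ^ 2 := by
          gcongr
          rw [hc]
          exact h1.trans (by gcongr)
      _ = _ := by ring
  -- The sets `{ω | (s, ω) ∈ boundedSet u K}` decrease in `s`, so on the event at time `t` the cut
  -- integrand equals the true one at all earlier times, and locality applies. The constants of the
  -- statement are `648 = 2 · 18²` and `24n = 2 · 12n`.
  · have h1 := hmild.mom_indicator_le hW (hmild.1.indicator hB) (T := t) ?_ (hGm t) ?_ hn
    · have hJ := (hmild.1.indicator hB).jointlyMeasurable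
      refine (mul_le_mul_right h1 (2 : ℝ≥0∞)).trans ?_
      rw [mix_eq hJ]
      have hmul : ∀ I J : ℝ≥0∞, I ≤ (ϖ : ℝ≥0∞) ^ 2 * J →
          2 * (12 * n * I) ≤ 24 * n * (ϖ : ℝ≥0∞) ^ 2 * J := fun I J h => by
        calc 2 * (12 * n * I) ≤ 2 * (12 * n * ((ϖ : ℝ≥0∞) ^ 2 * J)) := by gcongr
          _ = _ := by ring
      refine hmul _ _ ?_
      rw [← lintegral_const_mul' _ _ (by finiteness)]
      refine lintegral_mono fun r => ?_
      simp only
      rw [← lintegral_const_mul' _ _ (by finiteness)]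
      refine lintegral_mono fun y => ?_
      have e : (fun ω => (boundedSet u K).indicator (fun _ => (Set.Ioo 0 t).indicator
          (fun r : ℝ≥0 => heatKernel ((t : ℝ) - r) (x - y) * σ (u r y ω)) r) (r, ω)) =
          fun ω => duhamelKernel t x r y *
            σ ({ω | (r, ω) ∈ boundedSet u K}.indicator (u r y) ω) := by
        ext ω
        by_cases h : (r, ω) ∈ boundedSet u K <;> by_cases hr : r ∈ Set.Ioo 0 t <;>
          simp [Set.indicator, h, hr, duhamelKernel, hσ0]
      rw [e, mom_const_mul hn]
      have hk : ‖duhamelKernel t x r y‖ₑ ^ 2 = ENNReal.ofReal (duhamelKernel t x r y ^ 2) := by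
        rw [← enorm_pow, Real.enorm_of_nonneg (sq_nonneg _)]
      rw [hk]
      refine (mul_le_mul_right (mom_comp_le hσ hσ0 hn _) _).trans_eq ?_
      ring
    · intro s y ω hs
      have : s ∉ Set.Ioo 0 t := fun h => hs ⟨h.1, h.2.le⟩
      simp [Set.indicator, this]
    · intro ω hω s y
      by_cases hs : s ∈ Set.Ioo 0 t
      · have : (s, ω) ∈ boundedSet u K := boundedSet_anti hs.2.le hω
        simp [Set.indicator, this]
      · simp [Set.indicator, hs]

/-- The iteration starts from the trivial bound `K²`. By the smallness condition each pass through
the Duhamel inequality halves the remainder, and `648 + 1296/2 = 1296` reproduces the profile term.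
-/
theorem mom_boundedSet_le_smooth [IsProbabilityMeasure P] (hW : IsWhiteNoise 𝓕 P W)
    (hσ : LipschitzWith ϖ σ) (hσ0 : σ 0 = 0) (h0 : ∀ x, 0 ≤ u₀ x) (hu₀ : Measurable u₀)
    (hu : IsMildSolution 𝓕 P W σ u₀ u) (hn : n ≠ 0) (K : ℕ) (hT : T ≤ 1)
    (hsmall : 24 * n * (ϖ : ℝ≥0∞) ^ 2 * (1410048 * ENNReal.ofReal √T) ≤ 1 / 2) (k : ℕ)
    {t : ℝ≥0} (ht : 0 < t) (htT : t ≤ T) (x : Torus) :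
    mom P n ({ω | (t, ω) ∈ boundedSet u K}.indicator (u t x)) ≤
      1296 * smooth (fun y => ENNReal.ofReal (u₀ y)) t x ^ 2 + (K : ℝ≥0∞) ^ 2 * (1 / 2) ^ k := by
  set f : Torus → ℝ≥0∞ := fun y => ENNReal.ofReal (u₀ y) with hf
  have hfm : Measurable f := hu₀.ennreal_ofReal
  induction k generalizing t x with
  | zero =>
    rw [pow_zero, mul_one]
    refine le_add_left (mom_le_of_bounded hn ?_)
    filter_upwards [hu.continuous] with ω hω
    by_cases h : (t, ω) ∈ boundedSet u K
    · have := abs_le_of_mem_boundedSet hω ht h x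
      simp only [Set.indicator, Set.mem_ofPred_eq, h, if_true]
      rw [← ofReal_norm, Real.norm_eq_abs]
      refine (ENNReal.ofReal_le_ofReal this).trans_eq (by simp)
    · simp [Set.indicator, h]
  | succ k ih =>
    refine (mom_boundedSet_le hW hσ hσ0 h0 hu hn K hT ht htT x).trans ?_
    have hκm := (measurable_duhamelKernel t x).pow_const 2 |>.ennreal_ofReal
    have h1 : ∫⁻ r, (∫⁻ y, ENNReal.ofReal (duhamelKernel t x r y ^ 2) *
        mom P n ({ω | (r, ω) ∈ boundedSet u K}.indicator (u r y))) ∂timeMeasure ≤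
        1296 * (1410048 * ENNReal.ofReal √T * smooth f t x ^ 2) +
          (K : ℝ≥0∞) ^ 2 * (1 / 2) ^ k * (1410048 * ENNReal.ofReal √T) := by
      calc _ ≤ ∫⁻ r, (∫⁻ y, (1296 * (ENNReal.ofReal (duhamelKernel t x r y ^ 2) *
              smooth f r y ^ 2) + (K : ℝ≥0∞) ^ 2 * (1 / 2) ^ k *
              ENNReal.ofReal (duhamelKernel t x r y ^ 2))) ∂timeMeasure := by
            refine lintegral_mono fun r => lintegral_mono fun y => ?_
            simp only
            by_cases hr : r ∈ Set.Ioo 0 t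
            · refine (mul_le_mul_right (ih hr.1 (hr.2.le.trans htT) y) _).trans_eq ?_
              ring
            · simp [duhamelKernel, Set.indicator, hr]
        _ = 1296 * (∫⁻ r, (∫⁻ y, ENNReal.ofReal (duhamelKernel t x r y ^ 2) *
              smooth f r y ^ 2) ∂timeMeasure) + (K : ℝ≥0∞) ^ 2 * (1 / 2) ^ k *
              (∫⁻ r, (∫⁻ y, ENNReal.ofReal (duhamelKernel t x r y ^ 2)) ∂timeMeasure) := by
            have hc : (K : ℝ≥0∞) ^ 2 * (1 / 2) ^ k ≠ ∞ := by finiteness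
            have hm2 : ∀ r, Measurable fun y => (K : ℝ≥0∞) ^ 2 * (1 / 2) ^ k *
                ENNReal.ofReal (duhamelKernel t x r y ^ 2) := fun r =>
              (hκm.comp (measurable_const.prodMk measurable_id)).const_mul _
            simp_rw [lintegral_add_right _ (hm2 _), lintegral_const_mul' _ _ hc]
            rw [lintegral_add_right _ (Measurable.const_mul hκm.lintegral_prod_right' _),
              lintegral_const_mul' _ _ hc]
            simp_rw [lintegral_const_mul' (1296 : ℝ≥0∞) _ (by norm_num)]
        _ ≤ _ := by
            gcongr
            · exact lintegral_duhamelKernel_sq_mul_smooth_sq_le hfm htT hT x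
            · exact lintegral_duhamelKernel_sq_le htT hT x
    refine (add_le_add_right (mul_le_mul_right h1 _) _).trans ?_
    obtain ⟨M, hM⟩ : ∃ M, M = 24 * n * (ϖ : ℝ≥0∞) ^ 2 * (1410048 * ENNReal.ofReal √T) := ⟨_, rfl⟩
    rw [← hM] at hsmall
    calc _ = 648 * smooth f t x ^ 2 + (M * 1296 * smooth f t x ^ 2 +
          M * ((K : ℝ≥0∞) ^ 2 * (1 / 2) ^ k)) := by rw [hM]; ring
      _ ≤ 648 * smooth f t x ^ 2 + (1 / 2 * 1296 * smooth f t x ^ 2 +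
          1 / 2 * ((K : ℝ≥0∞) ^ 2 * (1 / 2) ^ k)) := by gcongr
      _ = _ := by
        have : (1 / 2 : ℝ≥0∞) * 1296 = 648 := by
          rw [show (1296 : ℝ≥0∞) = 2 * 648 by norm_num, ← mul_assoc,
            ENNReal.div_mul_cancel (by norm_num) (by norm_num), one_mul]
        rw [this, pow_succ]
        ring

/-- First `k → ∞` removes the remainder for fixed `K`, then `K → ∞` removes the localization, since
continuous paths are bounded on `[0, t] × 𝕋`. -/
theorem mom_solution_le [IsProbabilityMeasure P] (hW : IsWhiteNoise 𝓕 P W)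
    (hσ : LipschitzWith ϖ σ) (hσ0 : σ 0 = 0) (h0 : ∀ x, 0 ≤ u₀ x) (hu₀ : Measurable u₀)
    (hu : IsMildSolution 𝓕 P W σ u₀ u) (hn : n ≠ 0) (hT : T ≤ 1)
    (hsmall : 24 * n * (ϖ : ℝ≥0∞) ^ 2 * (1410048 * ENNReal.ofReal √T) ≤ 1 / 2)
    {t : ℝ≥0} (ht : 0 < t) (htT : t ≤ T) (x : Torus) :
    mom P n (u t x) ≤ 1296 * smooth (fun y => ENNReal.ofReal (u₀ y)) t x ^ 2 := by
  have hGm : ∀ K : ℝ, MeasurableSet {ω | (t, ω) ∈ boundedSet u K} := fun K =>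
    𝓕.le t _ (measurable_mk_predictable t (measurableSet_boundedSet hu.predictable K))
  refine mom_le_of_tendsto_ae hn (f := fun K : ℕ => {ω | (t, ω) ∈ boundedSet u K}.indicator (u t x))
    (fun K => (hu.predictable.jointlyMeasurable.section t x).indicator (hGm K)) ?_
    (b := fun _ => 1296 * smooth (fun y => ENNReal.ofReal (u₀ y)) t x ^ 2) (fun K => ?_)
    tendsto_const_nhds
  · filter_upwards [hu.continuous] with ω hω
    refine tendsto_const_nhds.congr' ?_
    filter_upwards [exists_mem_boundedSet hω t] with K hK
    simp [Set.indicator, hK]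
  · have h1 : Tendsto (fun k : ℕ => 1296 * smooth (fun y => ENNReal.ofReal (u₀ y)) t x ^ 2 +
        (K : ℝ≥0∞) ^ 2 * (1 / 2) ^ k) atTop
        (𝓝 (1296 * smooth (fun y => ENNReal.ofReal (u₀ y)) t x ^ 2 + (K : ℝ≥0∞) ^ 2 * 0)) := by
      refine Tendsto.const_add _ (ENNReal.Tendsto.const_mul ?_ (Or.inr (by finiteness)))
      exact ENNReal.tendsto_pow_atTop_nhds_zero_of_lt_one (by simp)
    rw [mul_zero, add_zero] at h1
    exact ge_of_tendsto' h1 fun k =>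
      mom_boundedSet_le_smooth hW hσ hσ0 h0 hu₀ hu hn K hT hsmall k ht htT x

/-- The stochastic convolution part of the solution, set to `0` at time `0`. -/
def noisePart (u₀ : Torus → ℝ) (u : ℝ≥0 → Torus → Ω → ℝ) (t : ℝ≥0) (x : Torus) (ω : Ω) : ℝ :=
  if t = 0 then 0 else u t x ω - heatSemigroup t u₀ x

theorem isWalshIntegral_noisePart (hu : IsMildSolution 𝓕 P W σ u₀ u) (t : ℝ≥0) (x : Torus) :
    IsWalshIntegral 𝓕 P W (fun s y ω => duhamelKernel t x s y * σ (u s y ω))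
      (noisePart u₀ u t x) := by
  -- The mild formula covers positive times only, and `heatSemigroup 0 u₀` is 0 instead of `u₀`
  -- because `1 / √0 = 0`. The convention `noisePart = 0` at time 0 fits the vanishing Duhamel
  -- kernel.
  rcases eq_or_ne t 0 with rfl | ht
  · have h1 : (fun s y ω => duhamelKernel 0 x s y * σ (u s y ω)) =
        fun (_ : ℝ≥0) (_ : Torus) (_ : Ω) => (0 : ℝ) := by
      ext s y ω; simp [duhamelKernel]
    have h2 : noisePart u₀ u 0 x = fun _ => 0 := by ext ω; simp [noisePart]
    rw [h1, h2]
    exact isWalshIntegral_zero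
  · have h1 : (fun s y ω => duhamelKernel t x s y * σ (u s y ω)) = fun s y ω =>
        (Set.Ioo 0 t).indicator (fun r : ℝ≥0 => heatKernel ((t : ℝ) - r) (x - y) * σ (u r y ω)) s := by
      ext s y ω
      simp [duhamelKernel, Set.indicator]
    have h2 : noisePart u₀ u t x = fun ω => u t x ω - heatSemigroup t u₀ x := by
      ext ω; simp [noisePart, ht]
    rw [h1, h2]
    exact hu.mild t (pos_iff_ne_zero.2 ht) x

/-- The increment is itself a Walsh integral, with the difference of the kernels as integrand
factor. The moment bound is applied with `G` the whole space, and `mom_solution_le` replaces `u` by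
the profile. -/
theorem mom_noisePart_sub_le [IsProbabilityMeasure P] (hW : IsWhiteNoise 𝓕 P W)
    (hσ : LipschitzWith ϖ σ) (hσ0 : σ 0 = 0) (h0 : ∀ x, 0 ≤ u₀ x) (hu₀ : Measurable u₀)
    (hu : IsMildSolution 𝓕 P W σ u₀ u) (hn : n ≠ 0) (hT : T ≤ 1)
    (hsmall : 24 * n * (ϖ : ℝ≥0∞) ^ 2 * (1410048 * ENNReal.ofReal √T) ≤ 1 / 2)
    {s t : ℝ≥0} (hst : s ≤ t) (htT : t ≤ T) (x : Torus) :
    mom P n (fun ω => noisePart u₀ u t x ω - noisePart u₀ u s x ω) ≤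
      12 * n * (ϖ : ℝ≥0∞) ^ 2 * 1296 * 1410048 *
        ENNReal.ofReal (((t : ℝ) - s) ^ (1 / 4 : ℝ) * (T : ℝ) ^ (1 / 4 : ℝ)) *
        (smooth (fun y => ENNReal.ofReal (u₀ y)) t x ^ 2 +
          smooth (fun y => ENNReal.ofReal (u₀ y)) s x ^ 2) := by
  have hX := (isWalshIntegral_noisePart hu t x).sub hW (isWalshIntegral_noisePart hu s x)
  have h1 := hX.mom_indicator_le hW hX.1 (T := t) ?_ MeasurableSet.univ (fun _ _ _ _ => rfl) hn
  · rw [Set.indicator_univ] at h1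
    refine h1.trans ?_
    rw [mix_eq hX.1.jointlyMeasurable]
    have h2 : ∀ r y, mom P n (fun ω => duhamelKernel t x r y * σ (u r y ω) -
        duhamelKernel s x r y * σ (u r y ω)) ≤ (ϖ : ℝ≥0∞) ^ 2 * 1296 *
        (ENNReal.ofReal ((duhamelKernel t x r y - duhamelKernel s x r y) ^ 2) *
          smooth (fun y => ENNReal.ofReal (u₀ y)) r y ^ 2) := by
      intro r y
      simp_rw [← sub_mul]
      rw [mom_const_mul hn, ← enorm_pow, Real.enorm_of_nonneg (sq_nonneg _)]
      by_cases hr : r ∈ Set.Ioo 0 t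
      · refine (mul_le_mul_right ((mom_comp_le hσ hσ0 hn _).trans (mul_le_mul_right
          (mom_solution_le hW hσ hσ0 h0 hu₀ hu hn hT hsmall hr.1 (hr.2.le.trans htT) y) _)) _).trans_eq ?_
        ring
      · have hr' : r ∉ Set.Ioo 0 s := fun h => hr ⟨h.1, h.2.trans_le hst⟩
        simp [duhamelKernel, Set.indicator, hr, hr']
    have h3 := lintegral_duhamelKernel_sub_sq_le (f := fun y => ENNReal.ofReal (u₀ y))
      hu₀.ennreal_ofReal hst htT hT x
    have hc : (ϖ : ℝ≥0∞) ^ 2 * 1296 ≠ ∞ := by finiteness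
    calc _ ≤ 12 * n * ∫⁻ r, (∫⁻ y, (ϖ : ℝ≥0∞) ^ 2 * 1296 *
          (ENNReal.ofReal ((duhamelKernel t x r y - duhamelKernel s x r y) ^ 2) *
          smooth (fun y => ENNReal.ofReal (u₀ y)) r y ^ 2)) ∂timeMeasure := by
          gcongr with r y
          exact h2 r y
      _ = 12 * n * ((ϖ : ℝ≥0∞) ^ 2 * 1296 * ∫⁻ r, (∫⁻ y,
          (ENNReal.ofReal ((duhamelKernel t x r y - duhamelKernel s x r y) ^ 2) *
          smooth (fun y => ENNReal.ofReal (u₀ y)) r y ^ 2)) ∂timeMeasure) := by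
          simp_rw [lintegral_const_mul' _ _ hc]
      _ ≤ _ := by
          refine (mul_le_mul_right (mul_le_mul_right h3 _) _).trans_eq ?_
          ring
  · intro r y ω hr
    have h1 : r ∉ Set.Ioo 0 t := fun h => hr ⟨h.1, h.2.le⟩
    have h2 : r ∉ Set.Ioo 0 s := fun h => h1 ⟨h.1, h.2.trans_le hst⟩
    simp [duhamelKernel, Set.indicator, h1, h2]

end Solution

end

section

variable {Ω : Type*} {mΩ : MeasurableSpace Ω} {P : Measure Ω}
variable {𝓕 : Filtration ℝ≥0 mΩ} {W : Set (ℝ≥0 × Torus) → Ω → ℝ}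

/-! ### Mass of the heat semigroup -/

theorem heatSemigroup_eq_toReal_lintegral {u₀ : Torus → ℝ} (h0 : ∀ x, 0 ≤ u₀ x) (hu₀ : Measurable u₀) (t : ℝ)
    (x : Torus) : heatSemigroup t u₀ x =
      (∫⁻ y, ENNReal.ofReal (heatKernel t (x - y)) * ENNReal.ofReal (u₀ y)).toReal := by
  unfold heatSemigroup
  rw [integral_eq_lintegral_of_nonneg_ae
    (ae_of_all _ fun y => mul_nonneg (heatKernel_nonneg _ _) (h0 y))]
  · simp_rw [ENNReal.ofReal_mul (heatKernel_nonneg _ _)]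
  · exact (((measurable_heatKernel t).comp (measurable_const.sub measurable_id)).mul
      hu₀).aestronglyMeasurable

theorem measurable_heatKernel_sub_mul {f : Torus → ℝ≥0∞} (hf : Measurable f) (t : ℝ) :
    Measurable fun p : Torus × Torus => ENNReal.ofReal (heatKernel t (p.1 - p.2)) * f p.2 :=
  (((measurable_heatKernel t).comp (measurable_fst.sub measurable_snd)).ennreal_ofReal).mul
    (hf.comp measurable_snd)

theorem measurable_heatSemigroup {u₀ : Torus → ℝ} (h0 : ∀ x, 0 ≤ u₀ x) (hu₀ : Measurable u₀)
    (t : ℝ) : Measurable (heatSemigroup t u₀) := by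
  rw [funext (heatSemigroup_eq_toReal_lintegral h0 hu₀ t)]
  exact (measurable_heatKernel_sub_mul hu₀.ennreal_ofReal t).lintegral_prod_right'.ennreal_toReal

theorem lintegral_heatSemigroup {u₀ : Torus → ℝ} (h0 : ∀ x, 0 ≤ u₀ x) (hu₀ : Measurable u₀)
    (hfin : ∫⁻ y, ENNReal.ofReal (u₀ y) ≠ ∞) {t : ℝ} (ht : 0 < t) (ht1 : t ≤ 1) :
    ∫⁻ x, ‖heatSemigroup t u₀ x‖ₑ = ∫⁻ y, ENNReal.ofReal (u₀ y) := by
  have hm := measurable_heatKernel_sub_mul hu₀.ennreal_ofReal t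
  have h1 : ∫⁻ x, (∫⁻ y, ENNReal.ofReal (heatKernel t (x - y)) * ENNReal.ofReal (u₀ y)) =
      ∫⁻ y, ENNReal.ofReal (u₀ y) := by
    rw [lintegral_lintegral_swap hm.aemeasurable]
    refine lintegral_congr fun y => ?_
    rw [lintegral_mul_const' _ _ ENNReal.ofReal_ne_top,
      lintegral_sub_right_eq_self (fun x => ENNReal.ofReal (heatKernel t x)) y,
      lintegral_heatKernel ht ht1, one_mul]
  rw [← h1]
  refine lintegral_congr_ae ?_
  have h2 := ae_lt_top hm.lintegral_prod_right' (by rw [h1]; exact hfin)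
  filter_upwards [h2] with x hx
  rw [heatSemigroup_eq_toReal_lintegral h0 hu₀, Real.enorm_of_nonneg ENNReal.toReal_nonneg,
    ENNReal.ofReal_toReal hx.ne]

/-! ### Spatial `L¹` norms of increments and chaining -/

/-- Minkowski: the `L^{2n}(P)` norm of a spatial `L¹` norm is at most the integral of the pointwise
`L^{2n}(P)` norms. -/
theorem lintegral_lintegral_enorm_pow_le [SFinite P] {n : ℕ} (hn : n ≠ 0) {g : Torus → Ω → ℝ}
    (hg : Measurable (Function.uncurry g)) :
    ∫⁻ ω, (∫⁻ x, ‖g x ω‖ₑ) ^ (2 * n) ∂P ≤ (∫⁻ x, mom P n (g x) ^ (1 / 2 : ℝ)) ^ (2 * n) := by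
  have hn1 : (1 : ℝ) ≤ n := by exact_mod_cast Nat.one_le_iff_ne_zero.2 hn
  have hp : (1 : ℝ) ≤ (2 * n : ℕ) := by push_cast; linarith
  have hp0 : ((2 * n : ℕ) : ℝ) ≠ 0 := by positivity
  have h := lintegral_minkowski (μ := (volume : Measure Torus)) (ν := P)
    (f := fun x ω => ‖g x ω‖ₑ) hg.enorm hp
  have h2 : ∀ x, (∫⁻ ω, ‖g x ω‖ₑ ^ ((2 * n : ℕ) : ℝ) ∂P) ^ (1 / ((2 * n : ℕ) : ℝ)) =
      mom P n (g x) ^ (1 / 2 : ℝ) := by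
    intro x
    unfold mom
    rw [← ENNReal.rpow_mul]
    simp_rw [ENNReal.rpow_natCast]
    congr 1
    push_cast
    field_simp
  simp_rw [h2] at h
  calc ∫⁻ ω, (∫⁻ x, ‖g x ω‖ₑ) ^ (2 * n) ∂P
      = ((∫⁻ ω, (∫⁻ x, ‖g x ω‖ₑ) ^ ((2 * n : ℕ) : ℝ) ∂P) ^ (1 / ((2 * n : ℕ) : ℝ))) ^ (2 * n) := by
        rw [← ENNReal.rpow_natCast, ← ENNReal.rpow_mul, one_div_mul_cancel hp0, ENNReal.rpow_one]
        simp_rw [ENNReal.rpow_natCast]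
    _ ≤ _ := pow_le_pow_left' h _

/-! ### Dyadic chaining in time. -/

/-- The `k`-th dyadic point of level `m` in `[0, T]`. -/
def dyadicTime (T : ℝ≥0) (m k : ℕ) : ℝ≥0 := k * T / 2 ^ m

theorem dyadicTime_succ_two_mul (T : ℝ≥0) (m k : ℕ) :
    dyadicTime T (m + 1) (2 * k) = dyadicTime T m k := by
  unfold dyadicTime
  rw [pow_succ]
  push_cast
  field_simp

theorem dyadicTime_le (T : ℝ≥0) {m k : ℕ} (h : k ≤ 2 ^ m) : dyadicTime T m k ≤ T := by
  unfold dyadicTime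
  refine div_le_of_le_mul₀ zero_le zero_le ?_
  rw [mul_comm]
  gcongr
  exact_mod_cast h

theorem dyadicTime_mono (T : ℝ≥0) (m k : ℕ) : dyadicTime T m k ≤ dyadicTime T m (k + 1) := by
  unfold dyadicTime
  gcongr
  exact Nat.le_succ k

theorem dyadicTime_sub (T : ℝ≥0) (m k : ℕ) :
    (dyadicTime T m (k + 1) : ℝ) - dyadicTime T m k = T / 2 ^ m := by
  unfold dyadicTime
  push_cast
  ring

/-- A dyadic time is reached from 0 with at most one step per level: an even index already belongs
to the coarser level, and an odd one is a single step away from it. -/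
theorem dist_dyadicTime_le {d : ℝ≥0 → ℝ≥0 → ℝ≥0∞} (hd0 : d 0 0 = 0)
    (hd : ∀ s t, d 0 t ≤ d 0 s + d s t) {T : ℝ≥0} {ε : ℕ → ℝ≥0∞}
    (h : ∀ m k, k < 2 ^ m → d (dyadicTime T m k) (dyadicTime T m (k + 1)) ≤ ε m) (m : ℕ) {k : ℕ}
    (hk : k ≤ 2 ^ m) : d 0 (dyadicTime T m k) ≤ ∑ i ∈ Finset.range (m + 1), ε i := by
  induction m generalizing k with
  | zero =>
    have h0 : dyadicTime T 0 0 = 0 := by simp [dyadicTime]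
    rcases Nat.le_one_iff_eq_zero_or_eq_one.1 (by simpa using hk) with rfl | rfl
    · rw [h0, hd0]; exact zero_le
    · have := h 0 0 (by simp)
      rw [h0] at this
      simpa using this
  | succ m ih =>
    rw [Finset.sum_range_succ]
    have hk' : k / 2 ≤ 2 ^ m := by rw [pow_succ] at hk; omega
    rcases Nat.even_or_odd' k with ⟨i, rfl | rfl⟩
    · rw [dyadicTime_succ_two_mul]
      exact (ih (by omega)).trans le_self_add
    · refine (hd (dyadicTime T (m + 1) (2 * i)) _).trans (add_le_add ?_ (h _ _ (by omega)))
      rw [dyadicTime_succ_two_mul]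
      exact ih (by omega)

theorem tendsto_dyadicTime {T t : ℝ≥0} (ht : t ≤ T) (hT : 0 < T) :
    ∃ k : ℕ → ℕ, (∀ m, k m ≤ 2 ^ m) ∧ Tendsto (fun m => dyadicTime T m (k m)) atTop (𝓝 t) := by
  have hT' : (0 : ℝ) < T := hT
  have ht' : (t : ℝ) ≤ T := ht
  refine ⟨fun m => ⌊(t : ℝ) / T * 2 ^ m⌋₊, fun m => ?_, ?_⟩
  · refine Nat.floor_le_of_le ?_
    push_cast
    exact mul_le_of_le_one_left (by positivity) ((div_le_one hT').2 ht')
  · rw [← NNReal.tendsto_coe]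
    have h1 := (tendsto_nat_floor_mul_div_atTop (R := ℝ) (a := (t : ℝ) / T) (by positivity)).comp
      (tendsto_pow_atTop_atTop_of_one_lt (r := (2 : ℝ)) one_lt_two)
    have h2 := h1.mul_const (T : ℝ)
    rw [div_mul_cancel₀ _ hT'.ne'] at h2
    refine h2.congr fun m => ?_
    simp only [Function.comp, dyadicTime]
    push_cast
    ring

section Solution

variable {σ : ℝ → ℝ} {ϖ : ℝ≥0} {u₀ : Torus → ℝ} {u : ℝ≥0 → Torus → Ω → ℝ} {T : ℝ≥0} {n : ℕ}

/-- The `L¹` distance of the noise parts at two times. -/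
def noiseDist (u₀ : Torus → ℝ) (u : ℝ≥0 → Torus → Ω → ℝ) (ω : Ω) (s t : ℝ≥0) : ℝ≥0∞ :=
  ∫⁻ x, ‖noisePart u₀ u t x ω - noisePart u₀ u s x ω‖ₑ

theorem measurable_noisePart (h0 : ∀ x, 0 ≤ u₀ x) (hu₀ : Measurable u₀)
    (hu : IsMildSolution 𝓕 P W σ u₀ u) (t : ℝ≥0) :
    Measurable fun p : Torus × Ω => noisePart u₀ u t p.1 p.2 := by
  unfold noisePart
  split_ifs with h
  · exact measurable_const
  · refine Measurable.sub ?_ ((measurable_heatSemigroup h0 hu₀ t).comp measurable_fst)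
    exact hu.predictable.jointlyMeasurable.comp
      ((measurable_const.prodMk measurable_fst).prodMk measurable_snd)

/-- The square root of the pointwise bound is linear in the profiles at times `t` and `s`, each of
integral at most 4; hence `64 = (4 + 4)²`. The initial condition enters through its mass alone. -/
theorem lintegral_noiseDist_pow_le [IsProbabilityMeasure P] (hW : IsWhiteNoise 𝓕 P W)
    (hσ : LipschitzWith ϖ σ) (hσ0 : σ 0 = 0) (h0 : ∀ x, 0 ≤ u₀ x) (hu₀ : Measurable u₀)
    (hmass : ∫⁻ y, ENNReal.ofReal (u₀ y) = 1)
    (hu : IsMildSolution 𝓕 P W σ u₀ u) (hn : n ≠ 0) (hT : T ≤ 1)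
    (hsmall : 24 * n * (ϖ : ℝ≥0∞) ^ 2 * (1410048 * ENNReal.ofReal √T) ≤ 1 / 2)
    {s t : ℝ≥0} (hst : s ≤ t) (htT : t ≤ T) :
    ∫⁻ ω, noiseDist u₀ u ω s t ^ (2 * n) ∂P ≤
      (64 * (12 * n * (ϖ : ℝ≥0∞) ^ 2 * 1296 * 1410048 *
        ENNReal.ofReal (((t : ℝ) - s) ^ (1 / 4 : ℝ) * (T : ℝ) ^ (1 / 4 : ℝ)))) ^ n := by
  have hm : Measurable (Function.uncurry fun (x : Torus) ω =>
      noisePart u₀ u t x ω - noisePart u₀ u s x ω) :=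
    (measurable_noisePart h0 hu₀ hu t).sub (measurable_noisePart h0 hu₀ hu s)
  refine (lintegral_lintegral_enorm_pow_le hn hm).trans ?_
  obtain ⟨A, hA⟩ : ∃ A, A = 12 * n * (ϖ : ℝ≥0∞) ^ 2 * 1296 * 1410048 *
        ENNReal.ofReal (((t : ℝ) - s) ^ (1 / 4 : ℝ) * (T : ℝ) ^ (1 / 4 : ℝ)) := ⟨_, rfl⟩
  set f : Torus → ℝ≥0∞ := fun y => ENNReal.ofReal (u₀ y) with hf
  have hfm : Measurable f := hu₀.ennreal_ofReal
  have hAt : A ≠ ∞ := by rw [hA]; finiteness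
  have h1 : ∀ x, mom P n (fun ω => noisePart u₀ u t x ω - noisePart u₀ u s x ω) ^ (1 / 2 : ℝ) ≤
      A ^ (1 / 2 : ℝ) * (smooth f t x + smooth f s x) := by
    intro x
    have h2 := mom_noisePart_sub_le hW hσ hσ0 h0 hu₀ hu hn hT hsmall hst htT x
    rw [← hA] at h2
    have h3 : A * (smooth f t x ^ 2 + smooth f s x ^ 2) ≤
        A * (smooth f t x + smooth f s x) ^ 2 := by
      gcongr
      rw [add_sq, add_right_comm]
      exact le_self_add
    refine (ENNReal.rpow_le_rpow (h2.trans h3) (by norm_num)).trans_eq ?_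
    rw [ENNReal.mul_rpow_of_nonneg _ _ (by norm_num), ← ENNReal.rpow_natCast, ← ENNReal.rpow_mul]
    norm_num
  have h4 : ∫⁻ x, mom P n (fun ω => noisePart u₀ u t x ω - noisePart u₀ u s x ω) ^ (1 / 2 : ℝ) ≤
      A ^ (1 / 2 : ℝ) * 8 := by
    refine (lintegral_mono h1).trans ?_
    rw [lintegral_const_mul' _ _ (ENNReal.rpow_ne_top_of_nonneg (by norm_num) hAt),
      lintegral_add_left (measurable_smooth hfm _)]
    gcongr
    have h5 := lintegral_smooth_le hfm t.coe_nonneg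
    have h6 := lintegral_smooth_le hfm s.coe_nonneg
    rw [hmass] at h5 h6
    refine (add_le_add h5 h6).trans_eq (by norm_num)
  refine (pow_le_pow_left' h4 _).trans_eq ?_
  have hA2 : (A ^ (1 / 2 : ℝ)) ^ 2 = A := by
    rw [← ENNReal.rpow_natCast, ← ENNReal.rpow_mul]
    norm_num
  rw [← hA, pow_mul, mul_pow, hA2, mul_comm A]
  norm_num

/-- The chaining thresholds. -/
def threshold (m : ℕ) : ℝ≥0∞ := ENNReal.ofReal (1 / 50 * (19 / 20) ^ m)

theorem sum_threshold_le (m : ℕ) : ∑ i ∈ Finset.range m, threshold i ≤ ENNReal.ofReal (2 / 5) := by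
  unfold threshold
  rw [← ENNReal.ofReal_sum_of_nonneg (fun i _ => by positivity)]
  refine ENNReal.ofReal_le_ofReal ?_
  rw [← Finset.mul_sum, geom_sum_eq (by norm_num)]
  have : (0 : ℝ) ≤ (19 / 20) ^ m := by positivity
  rw [show (19 / 20 - 1 : ℝ) = -(1 / 20) by norm_num]
  linarith

/-- Numerically `2^{-1/4} ≤ 17/20`. -/
theorem dyadic_rpow_le (T : ℝ≥0) (m : ℕ) :
    ((T : ℝ) / 2 ^ m) ^ (1 / 4 : ℝ) * (T : ℝ) ^ (1 / 4 : ℝ) ≤ √T * (17 / 20) ^ m := by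
  have h1 : √(T : ℝ) = (T : ℝ) ^ (1 / 4 : ℝ) * (T : ℝ) ^ (1 / 4 : ℝ) := by
    rw [Real.sqrt_eq_rpow, ← Real.rpow_add_of_nonneg T.coe_nonneg (by norm_num) (by norm_num)]
    norm_num
  have h2 : ((1 / 2 : ℝ) ^ m) ^ (1 / 4 : ℝ) ≤ (17 / 20) ^ m := by
    rw [← Real.rpow_natCast, ← Real.rpow_mul (by norm_num), mul_comm,
      Real.rpow_mul (by norm_num), Real.rpow_natCast]
    gcongr
    calc (1 / 2 : ℝ) ^ (1 / 4 : ℝ) ≤ ((17 / 20 : ℝ) ^ (4 : ℝ)) ^ (1 / 4 : ℝ) :=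
          Real.rpow_le_rpow (by norm_num) (by norm_num) (by norm_num)
      _ = 17 / 20 := by rw [← Real.rpow_mul (by norm_num)]; norm_num
  have h3 : (T : ℝ) / 2 ^ m = T * (1 / 2) ^ m := by rw [one_div, inv_pow, div_eq_mul_inv]
  have hT := Real.rpow_nonneg T.coe_nonneg (1 / 4)
  rw [h3, Real.mul_rpow T.coe_nonneg (by positivity), h1]
  nlinarith [mul_le_mul_of_nonneg_left h2 (mul_nonneg hT hT)]

/-- Markov's inequality with the power `2n`. The decay `17/20 ≤ (19/20)³` per level is split: two
factors `19/20` are absorbed by the squared threshold, and the third, raised to the power `n ≥ 32`,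
is below `1/4`. That outweighs the `2^m` intervals of level `m`. The constant 160000 is `64 · 50²`.
-/
theorem measure_threshold_le_noiseDist [IsProbabilityMeasure P] (hW : IsWhiteNoise 𝓕 P W)
    (hσ : LipschitzWith ϖ σ) (hσ0 : σ 0 = 0) (h0 : ∀ x, 0 ≤ u₀ x) (hu₀ : Measurable u₀)
    (hmass : ∫⁻ y, ENNReal.ofReal (u₀ y) = 1)
    (hu : IsMildSolution 𝓕 P W σ u₀ u) (hn : 32 ≤ n) (hT : T ≤ 1)
    (hsmall : 160000 * (12 * n * (ϖ : ℝ≥0∞) ^ 2 * 1296 * 1410048 * ENNReal.ofReal √T) ≤ 1 / 4)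
    (m : ℕ) {k : ℕ} (hk : k < 2 ^ m) :
    P {ω | threshold m ≤ noiseDist u₀ u ω (dyadicTime T m k) (dyadicTime T m (k + 1))} ≤
      (1 / 4) ^ n * (1 / 4) ^ m := by
  have hn0 : n ≠ 0 := by omega
  have hsmall' : 24 * n * (ϖ : ℝ≥0∞) ^ 2 * (1410048 * ENNReal.ofReal √T) ≤ 1 / 2 := by
    calc 24 * n * (ϖ : ℝ≥0∞) ^ 2 * (1410048 * ENNReal.ofReal √T)
        = 24 * (n * (ϖ : ℝ≥0∞) ^ 2 * 1410048 * ENNReal.ofReal √T) := by ring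
      _ ≤ (160000 * 12 * 1296) * (n * (ϖ : ℝ≥0∞) ^ 2 * 1410048 * ENNReal.ofReal √T) := by
          gcongr; norm_num
      _ = 160000 * (12 * n * (ϖ : ℝ≥0∞) ^ 2 * 1296 * 1410048 * ENNReal.ofReal √T) := by ring
      _ ≤ 1 / 4 := hsmall
      _ ≤ 1 / 2 := by gcongr; norm_num
  have h1 := lintegral_noiseDist_pow_le hW hσ hσ0 h0 hu₀ hmass hu hn0 hT hsmall'
    (dyadicTime_mono T m k) (dyadicTime_le T hk)
  rw [dyadicTime_sub] at h1
  obtain ⟨B, hB⟩ : ∃ B, B = 12 * n * (ϖ : ℝ≥0∞) ^ 2 * 1296 * 1410048 := ⟨_, rfl⟩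
  rw [← hB] at h1 hsmall
  have h2 : 64 * (B * ENNReal.ofReal (((T : ℝ) / 2 ^ m) ^ (1 / 4 : ℝ) * (T : ℝ) ^ (1 / 4 : ℝ))) ≤
      1 / 4 * ENNReal.ofReal (19 / 20) ^ m * threshold m ^ 2 := by
    have h3 : ENNReal.ofReal (((T : ℝ) / 2 ^ m) ^ (1 / 4 : ℝ) * (T : ℝ) ^ (1 / 4 : ℝ)) ≤
        ENNReal.ofReal √T * (2500 * (ENNReal.ofReal (19 / 20) ^ m * threshold m ^ 2)) := by
      refine (ENNReal.ofReal_le_ofReal (dyadic_rpow_le T m)).trans ?_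
      rw [threshold, show (2500 : ℝ≥0∞) = ENNReal.ofReal 2500 by simp,
        ← ENNReal.ofReal_pow (by norm_num), ← ENNReal.ofReal_pow (by positivity),
        ← ENNReal.ofReal_mul (by positivity), ← ENNReal.ofReal_mul (by positivity),
        ← ENNReal.ofReal_mul (by positivity)]
      refine ENNReal.ofReal_le_ofReal (mul_le_mul_of_nonneg_left ?_ (Real.sqrt_nonneg _))
      calc (17 / 20 : ℝ) ^ m ≤ (19 / 20 * (19 / 20) ^ 2) ^ m := by gcongr; norm_num
        _ = _ := by rw [mul_pow, ← pow_mul, mul_comm 2 m, pow_mul]; ring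
    calc _ ≤ 64 * (B * (ENNReal.ofReal √T * (2500 * (ENNReal.ofReal (19 / 20) ^ m *
          threshold m ^ 2)))) := by gcongr
      _ = 160000 * (B * ENNReal.ofReal √T) * (ENNReal.ofReal (19 / 20) ^ m * threshold m ^ 2) := by
          ring
      _ ≤ 1 / 4 * (ENNReal.ofReal (19 / 20) ^ m * threshold m ^ 2) := by gcongr
      _ = _ := by ring
  have h4 : (ENNReal.ofReal (19 / 20) ^ m) ^ n ≤ (1 / 4) ^ m := by
    rw [← pow_mul, mul_comm, pow_mul]
    refine pow_le_pow_left' ?_ m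
    calc ENNReal.ofReal (19 / 20) ^ n ≤ ENNReal.ofReal (19 / 20) ^ 32 :=
          pow_le_pow_right_of_le_one' (by simp; norm_num) hn
      _ ≤ ENNReal.ofReal (1 / 4) := by
          rw [← ENNReal.ofReal_pow (by norm_num)]
          exact ENNReal.ofReal_le_ofReal (by norm_num)
      _ = 1 / 4 := by
          rw [ENNReal.ofReal_div_of_pos (by norm_num)]; simp
  have hm : Measurable fun ω => noiseDist u₀ u ω (dyadicTime T m k) (dyadicTime T m (k + 1)) := by
    have h5 := ((measurable_noisePart h0 hu₀ hu (dyadicTime T m (k + 1))).sub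
      (measurable_noisePart h0 hu₀ hu (dyadicTime T m k))).enorm
    exact Measurable.lintegral_prod_left' (μ := (volume : Measure Torus)) h5
  have hth0 : threshold m ≠ 0 := by
    unfold threshold
    simp only [ne_eq, ENNReal.ofReal_eq_zero, not_le]
    positivity
  have hth : threshold m ≠ ∞ := ENNReal.ofReal_ne_top
  have h6 := mul_meas_ge_le_lintegral (μ := P) (hm.pow_const (2 * n)) (threshold m ^ (2 * n))
  have h7 : threshold m ^ (2 * n) *
      P {ω | threshold m ≤ noiseDist u₀ u ω (dyadicTime T m k) (dyadicTime T m (k + 1))} ≤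
      threshold m ^ (2 * n) * ((1 / 4) ^ n * (1 / 4) ^ m) := by
    calc _ ≤ threshold m ^ (2 * n) * P {ω | threshold m ^ (2 * n) ≤
          noiseDist u₀ u ω (dyadicTime T m k) (dyadicTime T m (k + 1)) ^ (2 * n)} := by
          exact mul_le_mul_right (measure_mono fun ω h => pow_le_pow_left' (show threshold m ≤
            noiseDist u₀ u ω (dyadicTime T m k) (dyadicTime T m (k + 1)) from h) _) _
      _ ≤ _ := h6
      _ ≤ _ := h1
      _ ≤ (1 / 4 * ENNReal.ofReal (19 / 20) ^ m * threshold m ^ 2) ^ n := pow_le_pow_left' h2 n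
      _ = threshold m ^ (2 * n) * ((1 / 4) ^ n * (ENNReal.ofReal (19 / 20) ^ m) ^ n) := by
          rw [mul_pow, mul_pow, ← pow_mul (threshold m)]; ring
      _ ≤ _ := by gcongr
  exact (ENNReal.mul_le_mul_iff_right (by positivity) (by finiteness)).1 h7

/-- The event that some dyadic increment exceeds its threshold. -/
def badEvent (u₀ : Torus → ℝ) (u : ℝ≥0 → Torus → Ω → ℝ) (T : ℝ≥0) : Set Ω :=
  ⋃ m : ℕ, ⋃ k ∈ Finset.range (2 ^ m),
    {ω | threshold m ≤ noiseDist u₀ u ω (dyadicTime T m k) (dyadicTime T m (k + 1))}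

/-- Union bound: level `m` has `2^m` intervals of probability at most `4^{-n} 4^{-m}`, and `∑ 2^{-m}
= 2`. -/
theorem measure_badEvent_le [IsProbabilityMeasure P] (hW : IsWhiteNoise 𝓕 P W)
    (hσ : LipschitzWith ϖ σ) (hσ0 : σ 0 = 0) (h0 : ∀ x, 0 ≤ u₀ x) (hu₀ : Measurable u₀)
    (hmass : ∫⁻ y, ENNReal.ofReal (u₀ y) = 1)
    (hu : IsMildSolution 𝓕 P W σ u₀ u) (hn : 32 ≤ n) (hT : T ≤ 1)
    (hsmall : 160000 * (12 * n * (ϖ : ℝ≥0∞) ^ 2 * 1296 * 1410048 * ENNReal.ofReal √T) ≤ 1 / 4) :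
    P (badEvent u₀ u T) ≤ 2 * (1 / 4) ^ n := by
  have h1 : ∀ m : ℕ, P (⋃ k ∈ Finset.range (2 ^ m),
      {ω | threshold m ≤ noiseDist u₀ u ω (dyadicTime T m k) (dyadicTime T m (k + 1))}) ≤
      (1 / 4) ^ n * 2⁻¹ ^ m := by
    intro m
    refine (measure_biUnion_finset_le _ _).trans ((Finset.sum_le_sum fun k hk =>
      measure_threshold_le_noiseDist hW hσ hσ0 h0 hu₀ hmass hu hn hT hsmall m
        (Finset.mem_range.1 hk)).trans_eq ?_)
    rw [Finset.sum_const, Finset.card_range, nsmul_eq_mul, mul_left_comm]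
    congr 1
    push_cast
    rw [← mul_pow]
    congr 1
    rw [one_div, show (4 : ℝ≥0∞) = 2 * 2 by norm_num,
      ENNReal.mul_inv (by simp) (by simp), ← mul_assoc,
      ENNReal.mul_inv_cancel (by simp) (by simp), one_mul]
  refine (measure_iUnion_le _).trans ((ENNReal.tsum_le_tsum h1).trans_eq ?_)
  rw [ENNReal.tsum_mul_left, ENNReal.tsum_geometric, ENNReal.one_sub_inv_two, inv_inv, mul_comm]

theorem continuous_lintegral_enorm {ω : Ω} (hc : Continuous fun p : ℝ≥0 × Torus => u p.1 p.2 ω) :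
    Continuous fun t => ∫⁻ x, ‖u t x ω‖ₑ := by
  have h1 : Continuous fun t : ℝ≥0 => ∫ x in Set.univ, ‖u t x ω‖ :=
    continuous_parametric_integral_of_continuous (f := fun (t : ℝ≥0) (x : Torus) => ‖u t x ω‖)
      hc.norm isCompact_univ
  have h2 : (fun t => ∫⁻ x, ‖u t x ω‖ₑ) = fun t => ENNReal.ofReal (∫ x in Set.univ, ‖u t x ω‖) := by
    ext t
    have hct : Continuous fun x => u t x ω := hc.comp (continuous_const.prodMk continuous_id)
    have hint : Integrable (fun x => u t x ω) (volume : Measure Torus) := by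
      rw [← integrableOn_univ]
      exact hct.continuousOn.integrableOn_compact isCompact_univ
    rw [setIntegral_univ, ofReal_integral_norm_eq_lintegral_enorm hint]
  rw [h2]
  exact ENNReal.continuous_ofReal.comp h1

/-- Off the bad event the noise part has `L¹` norm at most `2/5`, the sum of the thresholds, at
every dyadic time. The mass of the semigroup part is exactly 1, so the triangle inequality gives `1
± 2/5`. The condition is closed in time and the mass is continuous, so it holds on all of `[0, T]`.
-/
theorem totalMass_mem_of_notMem_badEvent (h0 : ∀ x, 0 ≤ u₀ x) (hu₀ : Measurable u₀)
    (hmass : ∫⁻ y, ENNReal.ofReal (u₀ y) = 1) (hT : T ≤ 1) (hT0 : 0 < T) {ω : Ω}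
    (hc : Continuous fun p : ℝ≥0 × Torus => u p.1 p.2 ω) (hi : ∀ x, u 0 x ω = u₀ x)
    (hω : ω ∉ badEvent u₀ u T) {t : ℝ≥0} (ht : t ≤ T) :
    ENNReal.ofReal (3 / 5) ≤ ∫⁻ x, ‖u t x ω‖ₑ ∧ ∫⁻ x, ‖u t x ω‖ₑ ≤ ENNReal.ofReal (7 / 5) := by
  have hum : ∀ s, Measurable fun x => u s x ω := fun s =>
    (hc.comp (continuous_const.prodMk continuous_id)).measurable
  have hZm : ∀ s, Measurable fun x => noisePart u₀ u s x ω := by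
    intro s
    unfold noisePart
    split_ifs
    · exact measurable_const
    · exact (hum s).sub (measurable_heatSemigroup h0 hu₀ s)
  have hdy : ∀ m k : ℕ, k ≤ 2 ^ m →
      noiseDist u₀ u ω 0 (dyadicTime T m k) ≤ ENNReal.ofReal (2 / 5) := by
    intro m k hk
    refine (dist_dyadicTime_le (d := noiseDist u₀ u ω) (ε := threshold) ?_ ?_ ?_ m hk).trans
      (sum_threshold_le _)
    · simp [noiseDist]
    · intro s t
      unfold noiseDist
      have hsub : Measurable fun x => noisePart u₀ u s x ω - noisePart u₀ u 0 x ω :=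
        (hZm s).sub (hZm 0)
      rw [← lintegral_add_left hsub.enorm]
      refine lintegral_mono fun x => ?_
      have := enorm_add_le (noisePart u₀ u s x ω - noisePart u₀ u 0 x ω)
        (noisePart u₀ u t x ω - noisePart u₀ u s x ω)
      rwa [add_comm (_ - _), sub_add_sub_cancel] at this
    · intro m k hk
      by_contra! hcon
      exact hω (Set.mem_iUnion.2 ⟨m, Set.mem_iUnion₂.2 ⟨k, Finset.mem_range.2 hk, hcon.le⟩⟩)
  have hclosed : IsClosed {s : ℝ≥0 | ENNReal.ofReal (3 / 5) ≤ ∫⁻ x, ‖u s x ω‖ₑ ∧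
      ∫⁻ x, ‖u s x ω‖ₑ ≤ ENNReal.ofReal (7 / 5)} :=
    (isClosed_le continuous_const (continuous_lintegral_enorm hc)).inter
      (isClosed_le (continuous_lintegral_enorm hc) continuous_const)
  obtain ⟨k, hk, hlim⟩ := tendsto_dyadicTime ht hT0
  refine hclosed.mem_of_tendsto hlim (Eventually.of_forall fun m => ?_)
  set s := dyadicTime T m (k m) with hs
  rcases eq_or_ne s 0 with hs0 | hs0
  · have : ∫⁻ x, ‖u s x ω‖ₑ = 1 := by
      rw [← hmass, hs0]
      refine lintegral_congr fun x => ?_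
      rw [hi, Real.enorm_of_nonneg (h0 x)]
    rw [Set.mem_ofPred_eq, this]
    constructor
    · simp; norm_num
    · simp; norm_num
  · have hs1 : s ≤ 1 := (dyadicTime_le T (hk m)).trans hT
    have h1 := lintegral_heatSemigroup h0 hu₀ (by rw [hmass]; simp) (t := s)
      (by positivity) (by exact_mod_cast hs1)
    rw [hmass] at h1
    have h2 : ∫⁻ x, ‖noisePart u₀ u s x ω‖ₑ ≤ ENNReal.ofReal (2 / 5) := by
      have := hdy m (k m) (hk m)
      simpa [noiseDist, noisePart] using this
    have hpart : ∀ x, noisePart u₀ u s x ω = u s x ω - heatSemigroup s u₀ x := fun x => by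
      simp [noisePart, hs0]
    constructor
    · have h3 : (1 : ℝ≥0∞) ≤ ENNReal.ofReal (2 / 5) + ∫⁻ x, ‖u s x ω‖ₑ := by
        rw [← h1]
        refine le_trans ?_ (add_le_add_left h2 _)
        rw [← lintegral_add_left (hZm s).enorm]
        refine lintegral_mono fun x => ?_
        have : ‖u s x ω - noisePart u₀ u s x ω‖ₑ ≤ ‖u s x ω‖ₑ + ‖noisePart u₀ u s x ω‖ₑ :=
          enorm_sub_le
        rw [hpart, sub_sub_cancel] at this
        rw [add_comm, hpart]
        exact this
      have h4 : (1 : ℝ≥0∞) = ENNReal.ofReal (2 / 5) + ENNReal.ofReal (3 / 5) := by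
        rw [← ENNReal.ofReal_add (by norm_num) (by norm_num)]; norm_num
      rw [h4] at h3
      exact (ENNReal.add_le_add_iff_left ENNReal.ofReal_ne_top).1 h3
    · have h4 : ENNReal.ofReal (7 / 5) = ENNReal.ofReal (2 / 5) + 1 := by
        rw [← ENNReal.ofReal_one, ← ENNReal.ofReal_add (by norm_num) (by norm_num)]; norm_num
      rw [h4]
      refine le_trans ?_ (add_le_add h2 h1.le)
      rw [← lintegral_add_left (hZm s).enorm]
      refine lintegral_mono fun x => ?_
      have := enorm_add_le (noisePart u₀ u s x ω) (heatSemigroup s u₀ x)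
      rw [hpart, sub_add_cancel] at this
      rw [hpart]
      exact this

end Solution

end

end SHE

end

/-! ### Choice of the moment order and conclusion. -/

theorem proposition3p8 :
    ∀ ϖ : ℝ≥0, 0 < ϖ → ∀ γ : ℝ, 4 / 3 < γ → γ < 2 →
      ∃ L : ℝ, 1 < L ∧
        ∀ (Ω : Type*) (mΩ : MeasurableSpace Ω) (P : Measure Ω) (_ : IsProbabilityMeasure P)
          (𝓕 : Filtration ℝ≥0 mΩ) (W : Set (ℝ≥0 × SHE.Torus) → Ω → ℝ),
          SHE.IsWhiteNoise 𝓕 P W →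
        ∀ N : ℝ, 2 ≤ N →
        ∀ σ : ℝ → ℝ, LipschitzWith ϖ σ → σ 0 = 0 →
        ∀ u₀ : C(SHE.Torus, ℝ), (∀ x, 0 ≤ u₀ x) → SHE.totalMass u₀ = 1 → ‖u₀‖ ≤ N →
        ∀ u : ℝ≥0 → SHE.Torus → Ω → ℝ, SHE.IsMildSolution 𝓕 P W σ u₀ u →
          P {ω | (⨅ t ∈ {t : ℝ≥0 | (t : ℝ) ≤ N ^ (-γ)}, SHE.totalMass (fun x => u t x ω)) ≤ 1 / 2 ∨
              2 ≤ ⨆ t ∈ {t : ℝ≥0 | (t : ℝ) ≤ N ^ (-γ)}, SHE.totalMass (fun x => u t x ω)}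
            ≤ ENNReal.ofReal (L * Real.exp (-(N ^ ((3 * γ - 4) / 3)) / L)) := by
  intro ϖ hϖ γ hγ1 hγ2
  -- With this `D` the smallness condition of the chaining step reads `n * D * √T ≤ 1`, where `√T =
  -- N ^ (-γ / 2)`.
  obtain ⟨D, hD⟩ : ∃ D : ℝ, D = 4 * 160000 * 12 * 1296 * 1410048 * (ϖ : ℝ) ^ 2 := ⟨_, rfl⟩
  have hϖ' : (0 : ℝ) < ϖ := hϖ
  have hD0 : 0 < D := by rw [hD]; positivity
  -- The part `32 * D` makes the claim trivial when the admissible moment order is below 32, and the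
  -- 8 absorbs the constants of the final comparison.
  obtain ⟨L, hL⟩ : ∃ L : ℝ, L = 8 + 32 * D := ⟨_, rfl⟩
  have hL0 : 0 < L := by rw [hL]; positivity
  refine ⟨L, by rw [hL]; linarith, ?_⟩
  intro Ω mΩ P _ 𝓕 W hW N hN σ hσ hσ0 u₀ h0 hmass _ u hu
  have hN1 : (1 : ℝ) ≤ N := by linarith
  have hN0 : (0 : ℝ) < N := by linarith
  -- The argument yields the exponent `γ/2`, which is at least `γ - 4/3` because `γ < 2`.
  have he : N ^ ((3 * γ - 4) / 3) ≤ N ^ (γ / 2) :=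
    Real.rpow_le_rpow_of_exponent_le hN1 (by linarith)
  have hpos := Real.rpow_pos_of_pos hN0 (γ / 2)
  -- In this case the exponent on the right is at least `-1`, and `L * exp (-1) ≥ 8/4`, so the bound
  -- exceeds 1.
  by_cases hx : N ^ (γ / 2) / D < 32
  · refine prob_le_one.trans (ENNReal.one_le_ofReal.2 ?_)
    have h1 : N ^ ((3 * γ - 4) / 3) / L ≤ 1 := by
      rw [div_le_one hL0, hL]
      rw [div_lt_iff₀ hD0] at hx
      linarith
    have h2 : Real.exp (-1) ≤ Real.exp (-(N ^ ((3 * γ - 4) / 3)) / L) := by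
      rw [neg_div]
      exact Real.exp_le_exp.2 (neg_le_neg h1)
    have h3 : 1 - 1 / 2 ≤ Real.exp (-1 / 2) := by
      have := Real.add_one_le_exp (-1 / 2 : ℝ)
      linarith
    have h4 : Real.exp (-1) = Real.exp (-1 / 2) ^ 2 := by
      rw [← Real.exp_nat_mul]; norm_num
    have h5 : 1 / 4 ≤ Real.exp (-1) := by rw [h4]; nlinarith
    nlinarith
  rw [not_lt] at hx
  obtain ⟨n, hn⟩ : ∃ n, n = ⌊N ^ (γ / 2) / D⌋₊ := ⟨_, rfl⟩
  have hn32 : 32 ≤ n := by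
    rw [hn]
    exact Nat.le_floor (by exact_mod_cast hx)
  have hnx : (n : ℝ) ≤ N ^ (γ / 2) / D := by
    rw [hn]
    exact Nat.floor_le (by positivity)
  have hxn : N ^ (γ / 2) / D < n + 1 := by
    rw [hn]
    exact Nat.lt_floor_add_one _
  obtain ⟨T, hT⟩ : ∃ T : ℝ≥0, (T : ℝ) = N ^ (-γ) := ⟨⟨N ^ (-γ), by positivity⟩, rfl⟩
  have hT0 : 0 < T := by
    have : (0 : ℝ) < T := by rw [hT]; positivity
    exact this
  have hT1 : T ≤ 1 := by
    have : (T : ℝ) ≤ 1 := by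
      rw [hT]
      exact Real.rpow_le_one_of_one_le_of_nonpos hN1 (by linarith)
    exact this
  have hsqrt : √(T : ℝ) = (N ^ (γ / 2))⁻¹ := by
    rw [hT, Real.sqrt_eq_rpow, ← Real.rpow_mul hN0.le, ← Real.rpow_neg hN0.le]
    congr 1
    ring
  have hu₀ : Measurable u₀ := u₀.continuous.measurable
  have hmass' : ∫⁻ y, ENNReal.ofReal (u₀ y) = 1 := by
    rw [← hmass, SHE.totalMass, eLpNorm_one_eq_lintegral_enorm]
    exact lintegral_congr fun y => (Real.enorm_of_nonneg (h0 y)).symm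
  have hsmall : 160000 * (12 * n * (ϖ : ℝ≥0∞) ^ 2 * 1296 * 1410048 * ENNReal.ofReal √T) ≤
      1 / 4 := by
    have h1 : (160000 * (12 * n * (ϖ : ℝ) ^ 2 * 1296 * 1410048 * √T)) ≤ 1 / 4 := by
      rw [le_div_iff₀ hD0, hD] at hnx
      rw [hsqrt]
      have h2 : n * (4 * 160000 * 12 * 1296 * 1410048 * (ϖ : ℝ) ^ 2) * (N ^ (γ / 2))⁻¹ ≤ 1 := by
        rw [← div_eq_mul_inv]
        exact (div_le_one hpos).2 hnx
      linarith
    have h2 := ENNReal.ofReal_le_ofReal h1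
    rw [ENNReal.ofReal_div_of_pos (by norm_num), ENNReal.ofReal_mul (by norm_num),
      ENNReal.ofReal_mul (by positivity), ENNReal.ofReal_mul (by positivity),
      ENNReal.ofReal_mul (by positivity), ENNReal.ofReal_mul (by positivity),
      ENNReal.ofReal_mul (by positivity), ENNReal.ofReal_pow (by positivity)] at h2
    simpa using h2
  have hbad := SHE.measure_badEvent_le hW hσ hσ0 h0 hu₀ hmass' hu hn32 hT1 hsmall
  have hsub : {ω | (⨅ t ∈ {t : ℝ≥0 | (t : ℝ) ≤ N ^ (-γ)}, SHE.totalMass (fun x => u t x ω)) ≤ 1 / 2 ∨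
      2 ≤ ⨆ t ∈ {t : ℝ≥0 | (t : ℝ) ≤ N ^ (-γ)}, SHE.totalMass (fun x => u t x ω)} ≤ᵐ[P]
      SHE.badEvent u₀ u T := by
    filter_upwards [hu.continuous, hu.initial] with ω hc hi hω
    by_contra hgood
    have key : ∀ t ∈ {t : ℝ≥0 | (t : ℝ) ≤ N ^ (-γ)},
        ENNReal.ofReal (3 / 5) ≤ SHE.totalMass (fun x => u t x ω) ∧
        SHE.totalMass (fun x => u t x ω) ≤ ENNReal.ofReal (7 / 5) := by
      intro t ht
      have ht' : (t : ℝ) ≤ T := by rw [hT]; exact ht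
      rw [SHE.totalMass, eLpNorm_one_eq_lintegral_enorm]
      exact SHE.totalMass_mem_of_notMem_badEvent h0 hu₀ hmass' hT1 hT0 hc hi hgood
        (by exact_mod_cast ht')
    rcases hω with hω | hω
    · have h1 := (le_iInf₂ fun t ht => (key t ht).1).trans hω
      have h2 : (1 / 2 : ℝ≥0∞) = ENNReal.ofReal (1 / 2) := by
        rw [ENNReal.ofReal_div_of_pos (by norm_num)]; simp
      rw [h2, ENNReal.ofReal_le_ofReal_iff (by norm_num)] at h1
      norm_num at h1
    · have h1 := hω.trans (iSup₂_le fun t ht => (key t ht).2)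
      have h2 : (2 : ℝ≥0∞) = ENNReal.ofReal 2 := by simp
      rw [h2, ENNReal.ofReal_le_ofReal_iff (by norm_num)] at h1
      norm_num at h1
  refine (measure_mono_ae hsub).trans (hbad.trans ?_)
  have hq : (2 : ℝ≥0∞) * (1 / 4) ^ n = ENNReal.ofReal (2 * (1 / 4) ^ n) := by
    rw [ENNReal.ofReal_mul (by norm_num), ENNReal.ofReal_pow (by norm_num),
      ENNReal.ofReal_div_of_pos (by norm_num)]
    simp
  rw [hq]
  refine ENNReal.ofReal_le_ofReal ?_
  have h3 : 1 - 1 / 2 ≤ Real.exp (-1 / 2) := by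
    have := Real.add_one_le_exp (-1 / 2 : ℝ)
    linarith
  have h4 : Real.exp (-1) = Real.exp (-1 / 2) ^ 2 := by
    rw [← Real.exp_nat_mul]; norm_num
  have h5 : 1 / 4 ≤ Real.exp (-1) := by rw [h4]; nlinarith
  have h6 : (1 / 4 : ℝ) ^ n ≤ Real.exp (-n) := by
    calc (1 / 4 : ℝ) ^ n ≤ Real.exp (-1) ^ n := by gcongr
      _ = Real.exp (-n) := by rw [← Real.exp_nat_mul]; simp
  -- Rounding down to `n` costs a factor `e ≤ 4`, so `2 · 4^{-n} ≤ 2 exp(-n) ≤ 8 exp(-N^{γ/2} / D)`.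
  have h7 : Real.exp (-n) * Real.exp (-1) ≤ Real.exp (-(N ^ (γ / 2) / D)) := by
    rw [← Real.exp_add]
    exact Real.exp_le_exp.2 (by linarith)
  have h8 : Real.exp (-(N ^ (γ / 2) / D)) ≤ Real.exp (-(N ^ ((3 * γ - 4) / 3)) / L) := by
    rw [neg_div]
    refine Real.exp_le_exp.2 (neg_le_neg ?_)
    refine div_le_div₀ hpos.le he hD0 ?_
    rw [hL]; linarith
  have h9 := mul_le_mul_of_nonneg_left h5 (Real.exp_pos (-(n : ℝ))).le
  have h10 : (8 : ℝ) ≤ L := by rw [hL]; linarith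
  have h11 := mul_le_mul_of_nonneg_right h10
    (Real.exp_pos (-(N ^ ((3 * γ - 4) / 3)) / L)).le
  linarith
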